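/- Digraphs are finite and strict: no loops and no parallel arcs, but opposite arcs $u\to w$, $w\to u$ (a 2-cycle, written $u\leftrightarrow w$) are allowed. The size of a digraph is its number of arcs. Let $P_{2,2}$ be the digraph on four distinct vertices $u_1,u_2,u_3,u_4$ with arcs $u_1\to u_2\to u_4$ and $u_1\to u_3\to u_4$. A digraph is $P_{2,2}$-free if it has no (not necessarily induced) subdigraph isomorphic to $P_{2,2}$. Let $ex(n)$ be the maximum size of a $P_{2,2}$-free digraph of order $n$, and $EX(n)$ the set of $P_{2,2}$-free digraphs of order $n$ and size $ex(n)$. Let $D'$ denote the digraph obtained from $D$ by reversing all arcs. **Theorem.** Let $n\ge 13$ be an integer. Then $$ex(n)=\begin{cases}\frac{n^2+4n-1}{4},& n\text{ odd};\\ \frac{n^2+4n}{4},& n\text{ even and } n/2\text{ even};\\ \frac{n^2+4n-4}{4},& n\text{ even and } n/2\text{ odd}.\end{cases}$$ Moreover, $D\in EX(n)$ if and only if one of the following holds: 1. $n$ is odd, and $D$ or $D'$ is isomorphic to a digraph of order $n$ in the class $D_1$ or $D_2$; 2. $n$ is even, $n/2$ is even, and $D$ or $D'$ is isomorphic to a digraph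 of order $n$ in the class $D_3$; 3. $n$ is even, $n/2$ is odd, and $D$ or $D'$ is isomorphic to a digraph of order $n$ in one of the classes $D_4,\dots,D_{10}$. **Notation for the classes.** $D(X)$ is the subdigraph induced by $X$, and $N^+_X(u)$ is the set of successors of $u$ in $X$. A set $S$ *matches* $T$ if every vertex of $S$ has exactly one successor in $T$ and every vertex of $T$ has exactly one predecessor in $S$. $S(y,z)$ is the digraph on a set $X$ containing distinct $y,z$ whose arcs are $y\to z$ and all $z\to a$ with $a\in X\setminus\{z\}$. An $r$-arborescence with root $u$ is an acyclic digraph with a unique directed path from $u$ to every other vertex, these paths having length at most $r$. $T(y_1,y_2)$ is the union of a 2-cycle $y_1\leftrightarrow y_2$ and two vertex-disjoint 2-arborescences with roots $y_1$ and $y_2$. In a disjoint union there are no arcs between the parts, and "2-cycles" stands for a disjoint union of zero or more 2-cycles. **The classes.** In each class the vertex set is the disjoint union of $V_1$ and $V_2$ with $|V_1|=\lfloor n/2\rfloor+1$. All arcs from $V_1$ to $V_2$ and from $V_2$ to $V_1$ are among those listed. In particular, a vertex of $V_1$ that is not covered by the matching has no successors in $V_2$ other than those listed explicitly. * $D_1$: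 $D(V_1)$ is the disjoint union of $S(y,z)$ and 2-cycles; $D(V_2)$ has no arcs; $V_1\setminus\{y\}$ matches $V_2$; $N^+_{V_1}(u)=V_1$ for all $u\in V_2$. * $D_2$: $D(V_1)=S(y,z)$; $V_2$ is the disjoint union of $V_3$ and $V_4$, and $D(V_2)$ is the disjoint union of the arcless digraph on $V_3$ and 2-cycles covering $V_4$; $V_1\setminus\{y\}$ matches $V_2$, with $z\to w$ for some $w\in V_3$; $N^+_{V_1}(u)=V_1$ for $u\in V_3$ and $N^+_{V_1}(u)=V_1\setminus\{z\}$ for $u\in V_4$. * $D_3$: $D(V_1)=S(y,z)$; $D(V_2)$ is the disjoint union of $n/4-1$ 2-cycles and an isolated vertex $v$; $z\to v$ and $V_1\setminus\{y,z\}$ matches $V_2$; $N^+_{V_1}(v)=V_1$ and $N^+_{V_1}(u)=V_1\setminus\{z\}$ for $u\in V_2\setminus\{v\}$. * $D_4$: $D(V_1)$ is the disjoint union of $T(y_1,y_2)$ and 2-cycles; $D(V_2)$ has no arcs; $V_1\setminus\{y_1,y_2\}$ matches $V_2$; $N^+_{V_1}(u)=V_1$ for all $u\in V_2$. * $D_5$: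 $D(V_1)$ is the disjoint union of $S(y_1,z_1)$, $S(y_2,z_2)$ and 2-cycles; $D(V_2)$ has no arcs; $V_1\setminus\{y_1,y_2\}$ matches $V_2$; $N^+_{V_1}(u)=V_1$ for all $u\in V_2$. * $D_6$: $D(V_1)$, $D(V_2)$, $V_3$, $V_4$ and the arcs from $V_2$ to $V_1$ are as in $D_2$; $V_1\setminus\{y,z\}$ matches $V_2$. * $D_7$: $D(V_1)$, $D(V_2)$, $V_3$, $V_4$ and the arcs from $V_2$ to $V_1$ are as in $D_2$; for some $x\in V_1\setminus\{y,z\}$, $V_1\setminus\{x,y\}$ matches $V_2$, with $z\to w$ for some $w\in V_3$. * $D_8$: $D(V_1)=S(y,z)$; $D(V_2)$ is the disjoint union of 2-cycles and two isolated vertices $v,x$; $z\to v$ and $V_1\setminus\{y,z\}$ matches $V_2$; $N^+_{V_1}(v)=V_1$; $N^+_{V_1}(u)=V_1\setminus\{z\}$ for $u\in V_2\setminus\{v,x\}$; and $N^+_{V_1}(x)$ is $V_1\setminus\{z\}$ or $V_1\setminus\{w\}$, where $w\in V_1\setminus\{y,z\}$ and $w\to v$. * $D_9$: $D(V_1)=S(y,z)$;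 $D(V_2)$ is the disjoint union of 2-cycles, an isolated vertex $v$ and the digraph on three vertices $x,x_1,x_2$ with arcs $x\to x_1$, $x_1\to x_2$, $x_2\to x_1$; $z\to v$ and $V_1\setminus\{y,z\}$ matches $V_2$; $N^+_{V_1}(v)=V_1$; $N^+_{V_1}(u)=V_1\setminus\{z\}$ for $u\in V_2\setminus\{v,x\}$; $N^+_{V_1}(x)=V_1\setminus\{z,x_2^*\}$, where $x_2^*$ is the predecessor of $x_2$ in $V_1$. * $D_{10}$: $D(V_1)$ is the disjoint union of $S(y,z)$ and 2-cycles; $D(V_2)$ has no arcs; for some $w\in V_1\setminus\{y,z\}$, $V_1\setminus\{y,w\}$ matches $V_2$; $N^+_{V_1}(u)=V_1$ for all $u\in V_2$. -/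

import Mathlib

namespace ExtremalP22

universe u v

/-! ### Digraphs

A digraph is Mathlib's `Digraph V`: a vertex type with a binary relation `Adj`, so there are no
parallel arcs, and `Adj u w` means that there is an arc from `u` to `w`.  The digraphs under
consideration are strict, hence loopless in addition (opposite arcs `u → w`, `w → u` are allowed). -/

section Basic

variable {V : Type u} {W : Type v}

/-- `D` has no loops. -/
def Strict (D : Digraph V) : Prop := ∀ u, ¬ D.Adj u u

/-- The size of `D`: its number of arcs. -/
noncomputable def size (D : Digraph V) : ℕ := Set.ncard {p : V × V | D.Adj p.1 p.2}

/-- The reverse of `D`, obtained by reversing the directions of all arcs. -/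
def reverse (D : Digraph V) : Digraph V where
  Adj u w := D.Adj w u

/-- `D` is isomorphic to `H`: there is a bijection of the vertex sets preserving and reflecting
arcs. -/
def Isomorphic (D : Digraph V) (H : Digraph W) : Prop :=
  ∃ f : V ≃ W, ∀ u w, D.Adj u w ↔ H.Adj (f u) (f w)

/-- `D` contains a copy of `H` as a (not necessarily induced) subdigraph. -/
def Contains (D : Digraph V) (H : Digraph W) : Prop :=
  ∃ f : W → V, Function.Injective f ∧ ∀ a b, H.Adj a b → D.Adj (f a) (f b)

end Basic

/-- `P_{2,2}`: the two directed 2-paths `0 → 1 → 3` and `0 → 2 → 3`. -/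
def P22 : Digraph (Fin 4) where
  Adj a b := (a = 0 ∧ b = 1) ∨ (a = 1 ∧ b = 3) ∨ (a = 0 ∧ b = 2) ∨ (a = 2 ∧ b = 3)

/-- `D` is a strict `P_{2,2}`-free digraph. -/
def StrictP22Free {V : Type u} (D : Digraph V) : Prop := Strict D ∧ ¬ Contains D P22

/-- The set of sizes of strict `P_{2,2}`-free digraphs of order `n`. -/
def freeSizes (n : ℕ) : Set ℕ := {m | ∃ D : Digraph (Fin n), StrictP22Free D ∧ size D = m}

/-- `ex n`: the maximum size of a strict `P_{2,2}`-free digraph of order `n`. -/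
noncomputable def ex (n : ℕ) : ℕ := sSup (freeSizes n)

/-- The supremum defining `ex n` is a maximum. -/
theorem isGreatest_ex (n : ℕ) : IsGreatest (freeSizes n) (ex n) := by
  have hne : (freeSizes n).Nonempty := by
    refine ⟨_, ⟨fun _ _ => False⟩, ⟨fun _ h => h, ?_⟩, rfl⟩
    rintro ⟨f, -, hf⟩
    exact hf 0 1 (Or.inl ⟨rfl, rfl⟩)
  have hb : BddAbove (freeSizes n) := by
    refine ⟨Nat.card (Fin n × Fin n), ?_⟩
    rintro m ⟨D, -, rfl⟩
    exact Set.ncard_le_card _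
  exact ⟨Nat.sSup_mem hne hb, fun m hm => le_csSup hb hm⟩

/-- `D ∈ EX(n)`: `D` is a strict `P_{2,2}`-free digraph with `n` vertices and `ex n` arcs. -/
def IsExtremal {V : Type u} (n : ℕ) (D : Digraph V) : Prop :=
  Nat.card V = n ∧ StrictP22Free D ∧ size D = ex n

/-! ### Building blocks

In what follows `D(X)` denotes the subdigraph of `D` induced by `X`. -/

section Blocks

variable {V : Type u} (D : Digraph V)

/-- `N⁺_X(u)`: the set of successors of `u` in `X`. -/
def succIn (X : Set V) (u : V) : Set V := {w | w ∈ X ∧ D.Adj u w}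

/-- `S` matches `T`: every vertex of `S` has a unique successor in `T` and every vertex of `T` has
a unique predecessor in `S`. -/
def Matches (S T : Set V) : Prop :=
  (∀ s ∈ S, ∃! t, t ∈ T ∧ D.Adj s t) ∧ (∀ t ∈ T, ∃! s, s ∈ S ∧ D.Adj s t)

/-- There is no arc between `S` and `T`, in either direction. -/
def NoArcsBetween (S T : Set V) : Prop := ∀ s ∈ S, ∀ t ∈ T, ¬ D.Adj s t ∧ ¬ D.Adj t s

/-- `D(X)` is an empty digraph (it has no arcs). -/
def IsEmptyOn (X : Set V) : Prop := ∀ a ∈ X, ∀ b ∈ X, ¬ D.Adj a b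

/-- `D(X)` is a disjoint union of 2-cycles (possibly of none of them, when `X = ∅`): every `a ∈ X`
has a partner `b ≠ a` in `X` with `b → a`, and `b` is the unique successor of `a` in `X`. -/
def IsTwoCycles (X : Set V) : Prop :=
  ∀ a ∈ X, ∃ b ∈ X, b ≠ a ∧ D.Adj b a ∧ ∀ c ∈ X, D.Adj a c ↔ c = b

/-- `D(X) = S(y, z)`: the vertex set is `X`, and the arcs are those of the 2-cycle `y ↔ z` and
those of the out-star with center `z`, that is, the arcs from `z` to all other vertices of `X`. -/
def IsS (X : Set V) (y z : V) : Prop :=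
  y ∈ X ∧ z ∈ X ∧ y ≠ z ∧
    ∀ a ∈ X, ∀ b ∈ X, D.Adj a b ↔ (a = y ∧ b = z) ∨ (a = z ∧ b ≠ z)

/-- `D(X)` is the disjoint union of `S(y, z)` and some (possibly no) 2-cycles. -/
def IsSWithTwoCycles (X : Set V) (y z : V) : Prop :=
  ∃ A C : Set V, A ∪ C = X ∧ Disjoint A C ∧ NoArcsBetween D A C ∧
    IsS D A y z ∧ IsTwoCycles D C

/-- The arc relation of `D(X)`. -/
def arcsIn (X : Set V) (a b : V) : Prop := a ∈ X ∧ b ∈ X ∧ D.Adj a b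

/-- `u :: l` is the list of vertices of a directed path of `D(X)` from `u` to `w`; its length
(number of arcs) is `l.length`. -/
def IsPathIn (X : Set V) (u w : V) (l : List V) : Prop :=
  (u :: l).IsChain (arcsIn D X) ∧ (u :: l).Nodup ∧ (u :: l).getLast? = some w

/-- `D(X)` is an `r`-arborescence with root `u`: it is acyclic, there is a unique directed path
from `u` to any other vertex, and these paths have length at most `r`. -/
def IsArborescence (r : ℕ) (X : Set V) (u : V) : Prop :=
  u ∈ X ∧ (∀ a, ¬ Relation.TransGen (arcsIn D X) a a) ∧
    (∀ w ∈ X, w ≠ u → ∃! l, IsPathIn D X u w l) ∧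
    (∀ w ∈ X, ∀ l, IsPathIn D X u w l → l.length ≤ r)

/-- `D(X) = T(x, y)`: the union of a 2-cycle `x ↔ y` and two (vertex-disjoint) 2-arborescences with
roots `x` and `y`. -/
def IsT (X : Set V) (x y : V) : Prop :=
  ∃ A B : Set V, A ∪ B = X ∧ Disjoint A B ∧
    IsArborescence D 2 A x ∧ IsArborescence D 2 B y ∧
    ∀ a ∈ A, ∀ b ∈ B, (D.Adj a b ↔ a = x ∧ b = y) ∧ (D.Adj b a ↔ a = x ∧ b = y)

end Blocks

/-! ### The ten classes of digraphs

In each class the vertex set is partitioned as `V₁ ∪ V₂` with `|V₁| = ⌊n/2⌋ + 1`; here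
`V₂ = V₁ᶜ`.  Each definition describes `D(V₁)`, then `D(V₂)`, then all arcs from `V₁` to `V₂`
(vertices of `V₁` not covered by the matching have no successors in `V₂` other than those listed),
then all arcs from `V₂` to `V₁`. -/

section Classes

variable {V : Type u} (D : Digraph V)

/-- `|V₁| = ⌊n/2⌋ + 1`, where `n` is the order of `D`. -/
def IsFirstPart (V₁ : Set V) : Prop := V₁.ncard = Nat.card V / 2 + 1

/-- The class `D₁`. -/
def ClassD1 : Prop :=
  ∃ (V₁ : Set V) (y z : V), IsFirstPart V₁ ∧
    IsSWithTwoCycles D V₁ y z ∧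
    IsEmptyOn D V₁ᶜ ∧
    (Matches D (V₁ \ {y}) V₁ᶜ ∧ succIn D V₁ᶜ y = ∅) ∧
    (∀ u ∈ V₁ᶜ, succIn D V₁ u = V₁)

/-- The class `D₂`. -/
def ClassD2 : Prop :=
  ∃ (V₁ V₃ V₄ : Set V) (y z : V), IsFirstPart V₁ ∧
    IsS D V₁ y z ∧
    (V₃ ∪ V₄ = V₁ᶜ ∧ Disjoint V₃ V₄ ∧ NoArcsBetween D V₃ V₄ ∧
      IsEmptyOn D V₃ ∧ IsTwoCycles D V₄) ∧
    (Matches D (V₁ \ {y}) V₁ᶜ ∧ succIn D V₁ᶜ y = ∅ ∧ ∃ w ∈ V₃, D.Adj z w) ∧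
    ((∀ u ∈ V₃, succIn D V₁ u = V₁) ∧ ∀ u ∈ V₄, succIn D V₁ u = V₁ \ {z})

/-- The class `D₃`.  As `|V₂ \ {v}| = n/2 - 2`, there are `n/4 - 1` 2-cycles in `D(V₂)`. -/
def ClassD3 : Prop :=
  ∃ (V₁ : Set V) (y z v : V), IsFirstPart V₁ ∧
    IsS D V₁ y z ∧
    (v ∈ V₁ᶜ ∧ NoArcsBetween D {v} V₁ᶜ ∧ IsTwoCycles D (V₁ᶜ \ {v})) ∧
    (succIn D V₁ᶜ z = {v} ∧ succIn D V₁ᶜ y = ∅ ∧ Matches D (V₁ \ {y, z}) V₁ᶜ) ∧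
    (succIn D V₁ v = V₁ ∧ ∀ u ∈ V₁ᶜ \ {v}, succIn D V₁ u = V₁ \ {z})

/-- The class `D₄`. -/
def ClassD4 : Prop :=
  ∃ (V₁ A C : Set V) (y₁ y₂ : V), IsFirstPart V₁ ∧
    (A ∪ C = V₁ ∧ Disjoint A C ∧ NoArcsBetween D A C ∧ IsT D A y₁ y₂ ∧ IsTwoCycles D C) ∧
    IsEmptyOn D V₁ᶜ ∧
    (Matches D (V₁ \ {y₁, y₂}) V₁ᶜ ∧ succIn D V₁ᶜ y₁ = ∅ ∧ succIn D V₁ᶜ y₂ = ∅) ∧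
    (∀ u ∈ V₁ᶜ, succIn D V₁ u = V₁)

/-- The class `D₅`. -/
def ClassD5 : Prop :=
  ∃ (V₁ A B C : Set V) (y₁ z₁ y₂ z₂ : V), IsFirstPart V₁ ∧
    (A ∪ B ∪ C = V₁ ∧ Disjoint A B ∧ Disjoint A C ∧ Disjoint B C ∧
      NoArcsBetween D A B ∧ NoArcsBetween D A C ∧ NoArcsBetween D B C ∧
      IsS D A y₁ z₁ ∧ IsS D B y₂ z₂ ∧ IsTwoCycles D C) ∧
    IsEmptyOn D V₁ᶜ ∧
    (Matches D (V₁ \ {y₁, y₂}) V₁ᶜ ∧ succIn D V₁ᶜ y₁ = ∅ ∧ succIn D V₁ᶜ y₂ = ∅) ∧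
    (∀ u ∈ V₁ᶜ, succIn D V₁ u = V₁)

/-- The class `D₆`. -/
def ClassD6 : Prop :=
  ∃ (V₁ V₃ V₄ : Set V) (y z : V), IsFirstPart V₁ ∧
    IsS D V₁ y z ∧
    (V₃ ∪ V₄ = V₁ᶜ ∧ Disjoint V₃ V₄ ∧ NoArcsBetween D V₃ V₄ ∧
      IsEmptyOn D V₃ ∧ IsTwoCycles D V₄) ∧
    (Matches D (V₁ \ {y, z}) V₁ᶜ ∧ succIn D V₁ᶜ y = ∅ ∧ succIn D V₁ᶜ z = ∅) ∧
    ((∀ u ∈ V₄, succIn D V₁ u = V₁ \ {z}) ∧ ∀ u ∈ V₃, succIn D V₁ u = V₁)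

/-- The class `D₇`. -/
def ClassD7 : Prop :=
  ∃ (V₁ V₃ V₄ : Set V) (y z x : V), IsFirstPart V₁ ∧
    IsS D V₁ y z ∧
    (V₃ ∪ V₄ = V₁ᶜ ∧ Disjoint V₃ V₄ ∧ NoArcsBetween D V₃ V₄ ∧
      IsEmptyOn D V₃ ∧ IsTwoCycles D V₄) ∧
    (x ∈ V₁ \ {y, z} ∧ Matches D (V₁ \ {x, y}) V₁ᶜ ∧
      succIn D V₁ᶜ x = ∅ ∧ succIn D V₁ᶜ y = ∅ ∧ ∃ w ∈ V₃, D.Adj z w) ∧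
    ((∀ u ∈ V₄, succIn D V₁ u = V₁ \ {z}) ∧ ∀ u ∈ V₃, succIn D V₁ u = V₁)

/-- The class `D₈`. -/
def ClassD8 : Prop :=
  ∃ (V₁ : Set V) (y z v x : V), IsFirstPart V₁ ∧
    IsS D V₁ y z ∧
    (v ∈ V₁ᶜ ∧ x ∈ V₁ᶜ ∧ v ≠ x ∧ NoArcsBetween D {v, x} V₁ᶜ ∧
      IsTwoCycles D (V₁ᶜ \ {v, x})) ∧
    (succIn D V₁ᶜ z = {v} ∧ succIn D V₁ᶜ y = ∅ ∧ Matches D (V₁ \ {y, z}) V₁ᶜ) ∧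
    (succIn D V₁ v = V₁ ∧ (∀ u ∈ V₁ᶜ \ {v, x}, succIn D V₁ u = V₁ \ {z}) ∧
      (succIn D V₁ x = V₁ \ {z} ∨
        ∃ w ∈ V₁ \ {y, z}, D.Adj w v ∧ succIn D V₁ x = V₁ \ {w}))

/-- The class `D₉`.  The digraph on `{x, x₁, x₂}` has the arcs `x → x₁`, `x₁ → x₂`, `x₂ → x₁`;
`p` is the predecessor of `x₂` in `V₁`. -/
def ClassD9 : Prop :=
  ∃ (V₁ C : Set V) (y z v x x₁ x₂ p : V), IsFirstPart V₁ ∧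
    IsS D V₁ y z ∧
    ((C ∪ {v} ∪ {x, x₁, x₂} = V₁ᶜ ∧ v ∉ C ∧ Disjoint C {x, x₁, x₂} ∧
        v ∉ ({x, x₁, x₂} : Set V) ∧ x ≠ x₁ ∧ x ≠ x₂ ∧ x₁ ≠ x₂) ∧
      NoArcsBetween D {v} V₁ᶜ ∧ NoArcsBetween D C {x, x₁, x₂} ∧ IsTwoCycles D C ∧
      (∀ a ∈ ({x, x₁, x₂} : Set V), ∀ b ∈ ({x, x₁, x₂} : Set V), D.Adj a b ↔
        (a = x ∧ b = x₁) ∨ (a = x₁ ∧ b = x₂) ∨ (a = x₂ ∧ b = x₁))) ∧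
    (succIn D V₁ᶜ z = {v} ∧ succIn D V₁ᶜ y = ∅ ∧ Matches D (V₁ \ {y, z}) V₁ᶜ) ∧
    (succIn D V₁ v = V₁ ∧ (∀ u ∈ V₁ᶜ \ {v, x}, succIn D V₁ u = V₁ \ {z}) ∧
      p ∈ V₁ ∧ D.Adj p x₂ ∧ succIn D V₁ x = V₁ \ {z, p})

/-- The class `D₁₀`. -/
def ClassD10 : Prop :=
  ∃ (V₁ : Set V) (y z w : V), IsFirstPart V₁ ∧
    IsSWithTwoCycles D V₁ y z ∧
    IsEmptyOn D V₁ᶜ ∧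
    (w ∈ V₁ \ {y, z} ∧ Matches D (V₁ \ {y, w}) V₁ᶜ ∧
      succIn D V₁ᶜ y = ∅ ∧ succIn D V₁ᶜ w = ∅) ∧
    (∀ u ∈ V₁ᶜ, succIn D V₁ u = V₁)

end Classes

/-- `D` or its reverse is isomorphic to a digraph of order `n` in the class `C`. -/
def UpToReverse {V : Type u} (n : ℕ) (C : Digraph (Fin n) → Prop) (D : Digraph V) : Prop :=
  ∃ H : Digraph (Fin n), C H ∧ (Isomorphic D H ∨ Isomorphic (reverse D) H)

end ExtremalP22

open ExtremalP22

/-!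
A strict digraph is `P_{2,2}`-free exactly if any two 2-paths with the same distinct ends coincide
(`strictP22Free_iff`).  Fix a vertex `u` of maximum out-degree `k`, and write `N = N⁺(u)`.  A vertex
`b ≠ u` then has at most one predecessor in `N`, so that counting the arcs by their tails outside `N`,
and by their heads for tails in `N`, gives
`size D + P = k (n - k) + (n - 1) + c` (`IsFrame.size_add`), where `c` is the number of 2-cycles
through `u` and the defect `P` counts the vertices other than `u` without a predecessor in `N` and
the amounts by which the out-degrees of the vertices outside `N` fall short of `k`.

**Local structure.**  After reversing all arcs if necessary, no in-degree exceeds `k`.  The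
uniqueness of 2-paths makes the out-neighbourhoods of the successors of a vertex almost disjoint.
Combined with the size identity this shows that every vertex has at most one successor outside `N`,
that `c ≤ 2`, and that `k = ⌊n/2⌋ + 1` (`IsFrame.local_structure`, with the arithmetic in
`le_one_and_le_two_of_bounds`).  Hence `P ≤ 1`, and a vertex outside `N` without deficit either
dominates `N` and has no successor outside `N`, or misses exactly one vertex of `N` and has exactly
one successor outside `N`.  If `x → y` are two vertices outside `N`, `x` misses exactly `z`, and `y`
misses at most one vertex, then `D(N)` is the star `S(y', z)` for some `y'`
(`IsFrame.isS_of_missing`).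

**Extremal structure.**  Choose `u` with `c` as small as possible, and then with the smallest
in-degree.  If `c = 1`, then `P = 0` and the map `π` that takes a vertex to its predecessor in `N`
determines the digraph: if there is no arc outside `N`, the second iterate of `π` fixes a vertex or
takes it to one of the at most two vertices of `N` without successors outside `N`, which leads to
`D₁`, `D₄`, `D₅` and `D₁₀`; if there is one, then `D(N)` is a star, and the class is `D₂`, `D₆` or
`D₇` (`IsCovered`).  If `c = 2` and `P = 0`, the vertices outside `N` other than `u` form 2-cycles,
which is `D₃` and requires `4 ∣ n`.  If `c = 2` and `P = 1`, a vertex without a predecessor in `N`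
contradicts the choice of `u` or parity, and a vertex of deficit one gives `D₈` or `D₉`
(`IsDoubled`).  In all cases the size is the one claimed (`size_eq_and_inClasses_or_reverse`).

**Converse.**  In each class every vertex of `V₁` has exactly one predecessor in `V₁`, and almost
every one has exactly one successor outside `V₁`, so that both the uniqueness of 2-paths and the
size follow from few conditions on the arcs outside `V₁` (`uniqueTwoPaths_of_layout`,
`size_of_layout`).  Explicit members of `D₁`, `D₃` and `D₁₀` show that the bound is attained for
each residue of `n` (`exists_isOptimal`).
-/

namespace ExtremalP22

open Finset

/-! ### Unique 2-paths and the counting of arcs -/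

section TwoPaths
variable {V : Type*} {D : Digraph V}

/-- Two directed 2-paths with the same distinct ends have the same middle vertex. -/
def UniqueTwoPaths (D : Digraph V) : Prop :=
  ∀ ⦃p a b q⦄, p ≠ q → D.Adj p a → D.Adj a q → D.Adj p b → D.Adj b q → a = b

/-- Without loops, the four vertices of two distinct 2-paths with the same distinct ends are distinct,
hence form a copy of `P22`. -/
theorem strictP22Free_iff : StrictP22Free D ↔ Strict D ∧ UniqueTwoPaths D := by
  constructor
  · rintro ⟨hS, hc⟩
    refine ⟨hS, fun p a b q hpq h1 h2 h3 h4 => ?_⟩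
    by_contra hab
    apply hc
    have n1 : p ≠ a := fun h => hS a (h ▸ h1)
    have n2 : p ≠ b := fun h => hS b (h ▸ h3)
    have n3 : a ≠ q := fun h => hS q (h ▸ h2)
    have n4 : b ≠ q := fun h => hS q (h ▸ h4)
    refine ⟨![p, a, b, q], ?_, ?_⟩
    · intro i j hij
      fin_cases i <;> fin_cases j <;> simp_all
    · rintro i j (⟨rfl, rfl⟩ | ⟨rfl, rfl⟩ | ⟨rfl, rfl⟩ | ⟨rfl, rfl⟩) <;> simpa
  · rintro ⟨hS, hU⟩
    refine ⟨hS, ?_⟩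
    rintro ⟨f, hf, h⟩
    have := hU (p := f 0) (a := f 1) (b := f 2) (q := f 3) (fun h => by simpa using hf h)
      (h _ _ (by simp [P22])) (h _ _ (by simp [P22])) (h _ _ (by simp [P22]))
      (h _ _ (by simp [P22]))
    simpa using hf this

theorem Strict.ne (hS : Strict D) {a b : V} (h : D.Adj a b) : a ≠ b := fun e => hS b (e ▸ h)

theorem Strict.reverse (hS : Strict D) : Strict (reverse D) := hS

theorem UniqueTwoPaths.reverse (hU : UniqueTwoPaths D) : UniqueTwoPaths (reverse D) :=
  fun _ _ _ _ hpq h1 h2 h3 h4 => hU hpq.symm h2 h1 h4 h3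

end TwoPaths

section Counting
variable {V : Type*} [Fintype V] (D : Digraph V)

open Classical in
/-- The finite set of successors of `v`. -/
noncomputable def outSet (v : V) : Finset V := {w | D.Adj v w}

open Classical in
/-- The finite set of predecessors of `v`. -/
noncomputable def inSet (v : V) : Finset V := {w | D.Adj w v}

variable {D}

@[simp] theorem mem_outSet {v w : V} : w ∈ outSet D v ↔ D.Adj v w := by simp [outSet]
@[simp] theorem mem_inSet {v w : V} : w ∈ inSet D v ↔ D.Adj w v := by simp [inSet]

theorem size_eq_sum_outSet : size D = ∑ v, (outSet D v).card := by
  classical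
  have h : {p : V × V | D.Adj p.1 p.2} =
      ((univ.sigma (fun v => outSet D v)).map
        ⟨fun x : (_ : V) × V => (x.1, x.2), fun ⟨a, b⟩ ⟨c, d⟩ h => by simp_all⟩ : Finset (V × V)) := by
    ext ⟨a, b⟩
    simp only [Set.mem_ofPred_eq, coe_map, coe_sigma, Set.mem_image, Set.mem_sigma_iff, mem_coe,
      mem_univ, true_and, mem_outSet, Sigma.exists]
    constructor
    · exact fun h => ⟨a, b, h, rfl⟩
    · rintro ⟨c, d, h, e⟩
      cases e
      exact h
  rw [size, h, Set.ncard_coe_finset, card_map, card_sigma]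

theorem outSet_reverse (v : V) : outSet (reverse D) v = inSet D v := by
  ext; simp [reverse]

theorem inSet_reverse (v : V) : inSet (reverse D) v = outSet D v := by
  ext; simp [reverse]

variable [DecidableEq V]

/-- Double counting of the arcs from `S` to `T`. -/
theorem sum_card_outSet_inter (S T : Finset V) :
    ∑ a ∈ S, (outSet D a ∩ T).card = ∑ b ∈ T, (inSet D b ∩ S).card := by
  classical
  have := sum_card_bipartiteAbove_eq_sum_card_bipartiteBelow (s := S) (t := T) D.Adj
  simp only [bipartiteAbove, bipartiteBelow] at this
  convert this using 3 <;> (ext; simp [and_comm])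

theorem size_eq_sum_inSet : size D = ∑ v, (inSet D v).card := by
  classical
  have := sum_card_outSet_inter (D := D) univ univ
  simpa [size_eq_sum_outSet] using this

theorem size_reverse : size (reverse D) = size D := by
  rw [size_eq_sum_outSet, size_eq_sum_inSet]; simp only [outSet_reverse]

/-- The number of arcs, counted from the sets of predecessors inside `N` and the out-degrees of
the vertices outside `N`. -/
theorem size_eq_of_split (N : Finset V) :
    size D = ∑ b ∈ N, (inSet D b ∩ N).card + ∑ b ∈ Nᶜ, (inSet D b ∩ N).card +
      ∑ x ∈ Nᶜ, (outSet D x).card := by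
  rw [size_eq_sum_outSet, ← sum_add_sum_compl N, sum_add_sum_compl N (fun b => (inSet D b ∩ N).card),
    ← sum_card_outSet_inter N univ]
  simp

theorem card_eq_sum_add_card_zero {ι : Type*} [DecidableEq ι] (T : Finset ι) (g : ι → ℕ)
    (h : ∀ b ∈ T, g b ≤ 1) :
    ∑ b ∈ T, g b + (T.filter (fun b => g b = 0)).card = T.card := by
  rw [card_filter, ← sum_add_distrib, card_eq_sum_ones]
  refine sum_congr rfl fun b hb => ?_
  have := h b hb
  split_ifs <;> omega

end Counting

/-! ### Successors of a vertex of maximum out-degree -/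

section Frame
variable {V : Type*} [Fintype V] [DecidableEq V]

/-- The vertices of `N⁺(u)` that are not successors of `x`. -/
noncomputable def missing (D : Digraph V) (u x : V) : Finset V := outSet D u \ outSet D x

/-- The successors of `x` outside `N⁺(u)`. -/
noncomputable def away (D : Digraph V) (u x : V) : Finset V := outSet D x \ outSet D u

/-- The amount by which the out-degree of `x` falls short of that of `u`. -/
noncomputable def deficit (D : Digraph V) (u x : V) : ℕ := (outSet D u).card - (outSet D x).card

/-- The vertices of `T` without a predecessor in `N⁺(u)`. -/
noncomputable def sourcesIn (D : Digraph V) (u : V) (T : Finset V) : Finset V :=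
  T.filter (fun b => (inSet D b ∩ outSet D u).card = 0)

/-- The sum of the deficits over the vertices outside `N⁺(u)`. -/
noncomputable def totalDeficit (D : Digraph V) (u : V) : ℕ := ∑ x ∈ (outSet D u)ᶜ, deficit D u x

/-- `D` is strict, has unique 2-paths, and `u` is a vertex of maximum out-degree. -/
structure IsFrame (D : Digraph V) (u : V) : Prop where
  strict : Strict D
  unique : UniqueTwoPaths D
  le_card : ∀ v, (outSet D v).card ≤ (outSet D u).card

variable {D : Digraph V} {u : V}

@[simp] theorem mem_missing {x b : V} : b ∈ missing D u x ↔ D.Adj u b ∧ ¬ D.Adj x b := by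
  simp [missing]

@[simp] theorem mem_away {x b : V} : b ∈ away D u x ↔ D.Adj x b ∧ ¬ D.Adj u b := by
  simp [away]

theorem away_self : away D u u = ∅ := by simp [away]

theorem missing_self : missing D u u = ∅ := by simp [missing]

theorem card_outSet_inter_add (x : V) :
    (outSet D x ∩ outSet D u).card + (missing D u x).card = (outSet D u).card := by
  rw [missing, inter_comm, card_inter_add_card_sdiff]

theorem card_le_one_of_unique (hU : UniqueTwoPaths D) {x b : V} (h : x ≠ b) {S : Finset V}
    (hS : S ⊆ outSet D x) : (inSet D b ∩ S).card ≤ 1 := by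
  refine card_le_one.2 fun a ha a' ha' => ?_
  rw [mem_inter, mem_inSet] at ha ha'
  exact hU h (mem_outSet.1 (hS ha.2)) ha.1 (mem_outSet.1 (hS ha'.2)) ha'.1

theorem away_subset (x : V) : away D u x ⊆ outSet D x := sdiff_subset

theorem sum_inter_away_add (x : V) :
    ∑ y ∈ away D u x, (outSet D y ∩ outSet D u).card + ∑ y ∈ away D u x, (missing D u y).card =
      (away D u x).card * (outSet D u).card := by
  rw [← sum_add_distrib, sum_congr rfl fun y _ => card_outSet_inter_add y, sum_const, smul_eq_mul]

theorem sum_deficit_le {S : Finset V} (hS : ∀ y ∈ S, ¬ D.Adj u y) :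
    ∑ y ∈ S, deficit D u y ≤ totalDeficit D u :=
  sum_le_sum_of_subset fun y hy => by simpa using hS y hy

namespace IsFrame

variable (hF : IsFrame D u)
include hF

/-- The basic exchange: a vertex of large out-degree misses as many vertices of `N⁺(u)` as it has
successors elsewhere, up to its deficit. -/
theorem card_missing (x : V) : (missing D u x).card = (away D u x).card + deficit D u x := by
  have h1 := card_outSet_inter_add (D := D) (u := u) x
  have h2 : (outSet D x ∩ outSet D u).card + (away D u x).card = (outSet D x).card := by
    rw [away, card_inter_add_card_sdiff]
  have := hF.le_card x
  unfold deficit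
  omega

/-- The size is counted through the predecessors in `N⁺(u)` of each vertex, of which there is at most
one except for `u`, and through the out-degrees of the vertices outside `N⁺(u)`. -/
theorem size_add : size D + (sourcesIn D u (outSet D u)).card +
      (sourcesIn D u ((outSet D u)ᶜ.erase u)).card + totalDeficit D u =
    (outSet D u).card * (outSet D u)ᶜ.card + (Fintype.card V - 1) +
      (inSet D u ∩ outSet D u).card := by
  have hu : u ∈ (outSet D u)ᶜ := by simpa using hF.strict u
  rw [size_eq_of_split (outSet D u), ← add_sum_erase _ _ hu]
  have h1 := card_eq_sum_add_card_zero (outSet D u) (fun b => (inSet D b ∩ outSet D u).card)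
    fun b hb => card_le_one_of_unique hF.unique (hF.strict.ne (mem_outSet.1 hb)) subset_rfl
  have h2 := card_eq_sum_add_card_zero ((outSet D u)ᶜ.erase u)
    (fun b => (inSet D b ∩ outSet D u).card)
    fun b hb => card_le_one_of_unique hF.unique (ne_of_mem_erase hb).symm subset_rfl
  have h3 : ∑ x ∈ (outSet D u)ᶜ, (outSet D x).card + totalDeficit D u =
      (outSet D u).card * (outSet D u)ᶜ.card := by
    rw [totalDeficit, ← sum_add_distrib, mul_comm, ← smul_eq_mul, ← sum_const]
    refine sum_congr rfl fun x _ => ?_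
    have := hF.le_card x
    unfold deficit
    omega
  have h4 : (outSet D u).card + ((outSet D u)ᶜ.erase u).card + 1 = Fintype.card V := by
    rw [add_assoc, card_erase_add_one hu, card_add_card_compl]
  unfold sourcesIn
  omega

/-- A vertex `x ≠ u` has at most one successor among the predecessors of `u`, hence misses all but one
of those in `N⁺(u)`. -/
theorem card_inter_le_one_add_missing {x : V} (hx : x ≠ u) :
    (inSet D u ∩ outSet D u).card ≤ 1 + (missing D u x).card := by
  have h1 : (inSet D u ∩ (outSet D x ∩ outSet D u)).card ≤ 1 :=
    card_le_one_of_unique hF.unique hx inter_subset_left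
  have h2 : inSet D u ∩ outSet D u ⊆ inSet D u ∩ (outSet D x ∩ outSet D u) ∪ missing D u x := by
    intro a
    simp only [mem_inter, mem_union, mem_inSet, mem_outSet, mem_missing]
    tauto
  exact (card_le_card h2).trans ((card_union_le _ _).trans (by omega))

/-- The successors outside `N⁺(u)` of a vertex `x ∉ N⁺(u)` have disjoint sets of successors in
`N⁺(u)`. -/
theorem away_mul_le_of_notMem {x : V} (hx : ¬ D.Adj u x) :
    (away D u x).card * (outSet D u).card ≤
      (outSet D u).card + ∑ y ∈ away D u x, (missing D u y).card := by
  have h := sum_inter_away_add (D := D) (u := u) x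
  have h2 : ∑ y ∈ away D u x, (outSet D y ∩ outSet D u).card ≤ (outSet D u).card := by
    rw [sum_card_outSet_inter, card_eq_sum_ones]
    refine sum_le_sum fun b hb => card_le_one_of_unique hF.unique (x := x) ?_ (away_subset x)
    rintro rfl
    exact hx (mem_outSet.1 hb)
  omega

/-- For `x ∈ N⁺(u)`, the successors of `x` outside `N⁺(u)` have disjoint sets of successors in
`N⁺(u) \ {x}`. -/
theorem away_mul_le_of_mem {x : V} (hx : D.Adj u x) :
    (away D u x).card * (outSet D u).card + 1 ≤
      (outSet D u).card + (away D u x).card + ∑ y ∈ away D u x, (missing D u y).card := by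
  have h := sum_inter_away_add (D := D) (u := u) x
  have h2 : ∑ y ∈ away D u x, (outSet D y ∩ outSet D u).card + 1 ≤
      (outSet D u).card + (away D u x).card := by
    have hx' := mem_outSet.2 hx
    rw [sum_card_outSet_inter, ← add_sum_erase _ _ hx', ← card_erase_add_one hx',
      card_eq_sum_ones (erase _ _)]
    have h3 : ∑ b ∈ (outSet D u).erase x, (inSet D b ∩ away D u x).card ≤
        ∑ b ∈ (outSet D u).erase x, 1 :=
      sum_le_sum fun b hb => card_le_one_of_unique hF.unique (ne_of_mem_erase hb).symm
        (away_subset x)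
    have h4 : (inSet D x ∩ away D u x).card ≤ (away D u x).card := card_le_card inter_subset_right
    omega
  omega

/-- The successors of `x` outside `N⁺(u)` have disjoint sets of successors other than `x`, and their
out-degrees are those of `u` up to the deficits. -/
theorem away_mul_le (x : V) :
    (away D u x).card * (outSet D u).card + 1 ≤
      Fintype.card V + (away D u x).card + totalDeficit D u := by
  have h1 : ∑ y ∈ away D u x, (outSet D y).card + 1 ≤ Fintype.card V + (away D u x).card := by
    have := sum_card_outSet_inter (D := D) (away D u x) univ
    simp only [inter_univ] at this
    rw [this, ← add_sum_erase _ _ (mem_univ x), ← card_univ, ← card_erase_add_one (mem_univ x),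
      card_eq_sum_ones (erase _ _)]
    have h3 : ∑ b ∈ univ.erase x, (inSet D b ∩ away D u x).card ≤ ∑ b ∈ univ.erase x, 1 :=
      sum_le_sum fun b hb => card_le_one_of_unique hF.unique (ne_of_mem_erase hb).symm
        (away_subset x)
    have h4 : (inSet D x ∩ away D u x).card ≤ (away D u x).card := card_le_card inter_subset_right
    omega
  have h2 : (away D u x).card * (outSet D u).card =
      ∑ y ∈ away D u x, (outSet D y).card + ∑ y ∈ away D u x, deficit D u y := by
    rw [← smul_eq_mul, ← sum_const, ← sum_add_distrib]
    refine sum_congr rfl fun y _ => ?_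
    have := hF.le_card y
    unfold deficit
    omega
  have h3 := sum_deficit_le (D := D) (u := u) (S := away D u x) fun y hy => (mem_away.1 hy).2
  omega

/-- If no in-degree exceeds the maximum out-degree, many arcs from the complement of `N⁺(u)` to
`N⁺(u)` are missing as soon as `N⁺(u)` is at most half of the vertex set. -/
theorem card_add_le_of_inSet_le (hin : ∀ v, (inSet D v).card ≤ (outSet D u).card) :
    (outSet D u).card + (outSet D u).card * (outSet D u)ᶜ.card ≤
      (outSet D u).card * (outSet D u).card + (sourcesIn D u (outSet D u)).card +
        ∑ x ∈ (outSet D u)ᶜ, (missing D u x).card := by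
  have h1 := card_eq_sum_add_card_zero (outSet D u) (fun b => (inSet D b ∩ outSet D u).card)
    fun b hb => card_le_one_of_unique hF.unique (hF.strict.ne (mem_outSet.1 hb)) subset_rfl
  have h2 : ∑ x ∈ (outSet D u)ᶜ, (outSet D x ∩ outSet D u).card +
      ∑ x ∈ (outSet D u)ᶜ, (missing D u x).card = (outSet D u).card * (outSet D u)ᶜ.card := by
    rw [← sum_add_distrib, sum_congr rfl fun y _ => card_outSet_inter_add y, sum_const,
      smul_eq_mul, mul_comm]
  rw [sum_card_outSet_inter] at h2
  have h3 : ∑ b ∈ outSet D u, (inSet D b ∩ outSet D u).card +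
      ∑ b ∈ outSet D u, (inSet D b ∩ (outSet D u)ᶜ).card ≤ (outSet D u).card * (outSet D u).card := by
    rw [← sum_add_distrib, ← smul_eq_mul, ← sum_const]
    refine sum_le_sum fun b _ => le_trans (le_of_eq ?_) (hin b)
    rw [← sdiff_eq_inter_compl, card_inter_add_card_sdiff]
  unfold sourcesIn
  omega

end IsFrame
end Frame

/-! ### Arithmetic -/

section Arithmetic

/-- The numerical core of the local structure.  Here `n` is the order, `k` the maximum out-degree,
attained at `u`, and `h` the number of vertices other than `u` outside `N⁺(u)`; `c` is the number of
2-cycles through `u`, `t` the total deficit, `P` the total deficit plus the number of vertices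
without a predecessor in `N⁺(u)`, and `s` the largest number of successors outside `N⁺(u)` of a
vertex outside `N⁺(u)`. -/
theorem le_one_and_le_two_of_bounds (n k h c t P s : ℤ) (hn : n = k + h + 1) (h13 : 13 ≤ n)
    (ht : 0 ≤ t) (htP : t ≤ P) (hck : c ≤ k) (hc : 4 * P + (n - 2 * k) ^ 2 ≤ 4 * c)
    (hh : 0 ≤ h) (hs : 0 ≤ s)
    (hA : s * k + 1 ≤ n + s + t) (hB : h * c ≤ h * (1 + s) + t)
    (hC : 2 ≤ s → (s - 1) * k ≤ s * s + t - 1 ∨ t = 0 ∧ (s - 1) * k ≤ s * s) :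
    s ≤ 1 ∧ c ≤ 2 := by
  have hk5 : 5 ≤ k := by
    by_contra! hlt
    have h1 : (n - 2 * k) ^ 2 ≤ 16 := by linarith
    have : n - 2 * k ≤ 4 := by nlinarith
    have : k = 4 := by omega
    subst this
    nlinarith
  have hj0 := sq_nonneg (n - 2 * k)
  have hhe : h = n - k - 1 := by linarith
  have hk1 : k - 1 ≥ 4 := by linarith
  have hs3 : s ≤ 3 := by
    by_contra! hs4
    nlinarith [sq_nonneg (n - 2 * k - 2), mul_nonneg (sub_nonneg.2 hs4) (sub_nonneg.2 hk5)]
  have hs1 : s ≤ 1 := by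
    by_contra! hs2
    have hC := hC (by linarith)
    have hs' : s = 2 ∨ s = 3 := by omega
    rcases hs' with rfl | rfl
    · have ht3 : k - 3 ≤ t := by omega
      have hj : (n - 2 * k) ^ 2 ≤ 12 := by linarith
      have hj1 : n - 2 * k ≤ 3 := by nlinarith
      have hj2 : -3 ≤ n - 2 * k := by nlinarith
      rcases lt_or_ge k 7 with hk | hk
      · have : k = 5 ∨ k = 6 := by omega
        rcases this with rfl | rfl
        · have : n = 13 := by omega
          subst this
          subst hhe
          omega
        · have : n = 13 ∨ n = 14 ∨ n = 15 := by omega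
          rcases this with rfl | rfl | rfl <;> subst hhe <;> omega
      · have hc4 : 4 ≤ c := by nlinarith
        have : h ≤ 4 := by nlinarith [sq_nonneg (n - 2 * k)]
        interval_cases h <;> omega
    · have hj : (n - 2 * k - 2) ^ 2 ≤ 12 := by nlinarith
      have hj1 : n - 2 * k ≤ 5 := by nlinarith
      have hj2 : -1 ≤ n - 2 * k := by nlinarith
      have hk8 : k ≤ 8 := by nlinarith [sq_nonneg (n - 2 * k)]
      have hn' : n ≤ 21 := by linarith
      subst hhe
      interval_cases k <;> interval_cases n <;> omega
  refine ⟨hs1, ?_⟩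
  by_contra! hc3
  have h1 : h * c ≤ 2 * h + t := by nlinarith
  have h2 : h ≤ 3 := by nlinarith [sq_nonneg (n - 2 * k)]
  have hn2 : n - 2 * k = h + 1 - k := by linarith
  rw [hn2] at hc
  interval_cases h <;> nlinarith

end Arithmetic

/-! ### The local structure at a vertex of maximum out-degree -/

section LocalStructure
variable {V : Type*} [Fintype V] [DecidableEq V] {D : Digraph V} {u : V}

theorem exists_pred_of_notMem {T : Finset V} {b : V} (hb : b ∈ T) (h : b ∉ sourcesIn D u T) :
    ∃ a, D.Adj u a ∧ D.Adj a b := by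
  have : (inSet D b ∩ outSet D u).card ≠ 0 := fun h0 => h (mem_filter.2 ⟨hb, h0⟩)
  obtain ⟨a, ha⟩ := card_ne_zero.1 this
  exact ⟨a, by simpa using (mem_inter.1 ha).2, by simpa using (mem_inter.1 ha).1⟩

namespace IsFrame

variable (hF : IsFrame D u)
include hF

theorem self_mem_compl : u ∈ (outSet D u)ᶜ := by simpa using hF.strict u

theorem card_eq : Fintype.card V = (outSet D u).card + ((outSet D u)ᶜ.erase u).card + 1 := by
  rw [add_assoc, card_erase_add_one hF.self_mem_compl, card_add_card_compl]

/-- The size identity `IsFrame.size_add` as an inequality: a large size bounds the number of vertices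
without a predecessor in `N⁺(u)`, the total deficit, and the distance of the out-degree of `u` from
`n / 2`, all in terms of the number of 2-cycles through `u`. -/
theorem four_mul_le (he : Fintype.card V ^ 2 + 4 * Fintype.card V ≤ 4 * size D + 4) :
    4 * (((sourcesIn D u (outSet D u)).card + (sourcesIn D u ((outSet D u)ᶜ.erase u)).card +
        totalDeficit D u : ℕ) : ℤ) + ((Fintype.card V : ℤ) - 2 * ((outSet D u).card : ℤ)) ^ 2 ≤
      4 * ((inSet D u ∩ outSet D u).card : ℤ) := by
  have h1 := hF.size_add
  have h2 := (card_add_card_compl (outSet D u)).symm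
  have h3 := hF.card_eq
  have h4 : Fintype.card V - 1 = (outSet D u).card + ((outSet D u)ᶜ.erase u).card := by omega
  have h5 : (outSet D u)ᶜ.card = ((outSet D u)ᶜ.erase u).card + 1 :=
    (card_erase_add_one hF.self_mem_compl).symm
  rw [h4, h5] at h1
  generalize ((outSet D u)ᶜ.erase u).card = h at *
  rw [h3] at he ⊢
  zify at h1 he ⊢
  nlinarith

/-- Let `s` be the largest number of successors outside `N⁺(u)` of a vertex outside `N⁺(u)`.  If the
bound failed, then for each `x` attaining `s`, all vertices of `away D u x` would attain `s` and all
vertices of positive deficit would lie in `away D u x`.  A vertex `y` of positive deficit would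
thus attain `s` itself, hence lie in `away D u y`, which is a loop at `y`. -/
theorem sub_one_mul_le {s : ℕ} (hmax : ∀ x, ¬ D.Adj u x → (away D u x).card ≤ s)
    {x₀ : V} (hx₀ : ¬ D.Adj u x₀) (hs : (away D u x₀).card = s) :
    s * (outSet D u).card + 1 ≤ (outSet D u).card + s * s + totalDeficit D u ∨
      totalDeficit D u = 0 ∧ s * (outSet D u).card ≤ (outSet D u).card + s * s := by
  have key : ∀ x, ¬ D.Adj u x → (away D u x).card = s →
      s * (outSet D u).card ≤ (outSet D u).card + ∑ y ∈ away D u x, (away D u y).card +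
        ∑ y ∈ away D u x, deficit D u y := by
    intro x hx hxs
    have := hF.away_mul_le_of_notMem hx
    rw [sum_congr rfl fun y _ => hF.card_missing y, sum_add_distrib, hxs] at this
    omega
  have key2 : ∀ x, (away D u x).card = s → ∑ y ∈ away D u x, (away D u y).card ≤ s * s := by
    intro x hxs
    nth_rw 1 [← hxs, ← smul_eq_mul, ← sum_const]
    exact sum_le_sum fun y hy => hmax y (mem_away.1 hy).2
  have key3 : ∀ x, ∑ y ∈ away D u x, deficit D u y ≤ totalDeficit D u := fun x =>
    sum_deficit_le fun y hy => (mem_away.1 hy).2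
  by_contra! hcon
  obtain ⟨hcon1, hcon2⟩ := hcon
  have ht : totalDeficit D u ≠ 0 := by
    intro h0
    have := hcon2 h0
    have := key x₀ hx₀ hs
    have := key2 x₀ hs
    have := key3 x₀
    omega
  have hall : ∀ x, ¬ D.Adj u x → (away D u x).card = s →
      (∀ y ∈ away D u x, (away D u y).card = s) ∧
        ∀ y, ¬ D.Adj u y → y ∉ away D u x → deficit D u y = 0 := by
    intro x hx hxs
    have k1 := key x hx hxs
    have k2 := key2 x hxs
    have k3 := key3 x
    constructor
    · have e : ∑ y ∈ away D u x, (away D u y).card = ∑ y ∈ away D u x, s := by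
        rw [sum_const, smul_eq_mul, hxs]; omega
      exact (sum_eq_sum_iff_of_le fun y hy => hmax y (mem_away.1 hy).2).1 e
    · intro y hy hyx
      have := sum_deficit_le (D := D) (u := u) (S := insert y (away D u x)) (by
        intro z hz
        rcases mem_insert.1 hz with rfl | hz
        · exact hy
        · exact (mem_away.1 hz).2)
      rw [sum_insert hyx] at this
      omega
  obtain ⟨y, hyM, hy⟩ : ∃ y ∈ (outSet D u)ᶜ, deficit D u y ≠ 0 := by
    by_contra! h
    exact ht (sum_eq_zero h)
  have hyu : ¬ D.Adj u y := by simpa using hyM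
  have hy0 : y ∈ away D u x₀ := by
    by_contra h
    exact hy ((hall x₀ hx₀ hs).2 y hyu h)
  have hys := (hall x₀ hx₀ hs).1 y hy0
  exact hy ((hall y hyu hys).2 y hyu fun h => hF.strict y (mem_away.1 h).1)

/-- Outside `N⁺(u)`, every vertex has at most one successor outside `N⁺(u)`, and `u` is on at most two
2-cycles. -/
theorem away_le_one_of_notMem_and (hn : 13 ≤ Fintype.card V)
    (he : Fintype.card V ^ 2 + 4 * Fintype.card V ≤ 4 * size D + 4) :
    (∀ x, ¬ D.Adj u x → (away D u x).card ≤ 1) ∧ (inSet D u ∩ outSet D u).card ≤ 2 := by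
  obtain ⟨x₀, hx₀, hmax⟩ := exists_max_image (outSet D u)ᶜ (fun x => (away D u x).card)
    ⟨u, hF.self_mem_compl⟩
  have hx₀ : ¬ D.Adj u x₀ := by simpa using hx₀
  have hmax : ∀ x, ¬ D.Adj u x → (away D u x).card ≤ (away D u x₀).card :=
    fun x hx => hmax x (by simpa using hx)
  generalize hs : (away D u x₀).card = s at hmax
  have hA := hF.away_mul_le x₀
  rw [hs] at hA
  have hC := hF.sub_one_mul_le hmax hx₀ hs
  have hE := hF.four_mul_le he
  have hcard := hF.card_eq
  have hB : ((outSet D u)ᶜ.erase u).card * (inSet D u ∩ outSet D u).card ≤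
      ((outSet D u)ᶜ.erase u).card * (1 + s) + totalDeficit D u := by
    have : ∑ x ∈ (outSet D u)ᶜ.erase u, (inSet D u ∩ outSet D u).card ≤
        ∑ x ∈ (outSet D u)ᶜ.erase u, ((1 + s) + deficit D u x) := by
      refine sum_le_sum fun x hx => ?_
      rw [mem_erase, mem_compl, mem_outSet] at hx
      have h1 := hF.card_inter_le_one_add_missing hx.1
      rw [hF.card_missing x] at h1
      have := hmax x hx.2
      omega
    rw [sum_add_distrib, sum_const, sum_const, smul_eq_mul, smul_eq_mul] at this
    refine this.trans (Nat.add_le_add_left (sum_deficit_le fun y hy => ?_) _)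
    simpa using (mem_erase.1 hy).2
  have hck : (inSet D u ∩ outSet D u).card ≤ (outSet D u).card := card_le_card inter_subset_right
  obtain ⟨h1, h2⟩ := le_one_and_le_two_of_bounds (Fintype.card V) (outSet D u).card
    ((outSet D u)ᶜ.erase u).card (inSet D u ∩ outSet D u).card (totalDeficit D u)
    (((sourcesIn D u (outSet D u)).card + (sourcesIn D u ((outSet D u)ᶜ.erase u)).card +
        totalDeficit D u : ℕ) : ℤ) s (by omega) (by omega) (by omega) (by omega) (by omega) hE
    (by omega) (by omega) (by exact_mod_cast hA) (by exact_mod_cast hB) (by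
      intro _
      rcases hC with h | ⟨h0, h⟩
      · left; zify at h; linarith
      · right; zify at h h0; exact ⟨h0, by linarith⟩)
  exact ⟨fun x hx => (hmax x hx).trans (by omega), by omega⟩

/-- If `x → y → b` with `x` and `y` outside `N⁺(u)` and `b` inside, then `x` misses each
predecessor of `b` in `N⁺(u)`. -/
theorem mem_missing_of_adj {x y a b : V} (hxy : D.Adj x y) (hy : ¬ D.Adj u y) (hyb : D.Adj y b)
    (ha : D.Adj u a) (hab : D.Adj a b) (hxb : x ≠ b) : a ∈ missing D u x := by
  rw [mem_missing]
  refine ⟨ha, fun hxa => hy ?_⟩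
  rwa [hF.unique hxb hxy hyb hxa hab]

/-- A maximum out-degree of exactly `n / 2` is impossible: each vertex of `N⁺(u)` with a predecessor in
`N⁺(u)` would be missed by some vertex outside `N⁺(u)`, its in-degree being at most `n / 2`, whereas
the vertices of deficit zero all miss the same vertex, if any. -/
theorem not_card_eq_two_mul (hn : 13 ≤ Fintype.card V)
    (hin : ∀ v, (inSet D v).card ≤ (outSet D u).card)
    (haway : ∀ x, ¬ D.Adj u x → (away D u x).card ≤ 1)
    (hP : (sourcesIn D u (outSet D u)).card + totalDeficit D u ≤ 2) :
    Fintype.card V ≠ 2 * (outSet D u).card := by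
  intro hcard
  have hcard' := (card_add_card_compl (outSet D u)).symm
  -- Each vertex of `N⁺(u)` with a predecessor in `N⁺(u)` is missed by someone.
  have hmiss : ∀ a ∈ outSet D u \ sourcesIn D u (outSet D u),
      ∃ x, ¬ D.Adj u x ∧ a ∈ missing D u x := by
    intro a ha
    rw [mem_sdiff] at ha
    by_contra! hno
    obtain ⟨b, hub, hba⟩ := exists_pred_of_notMem ha.1 ha.2
    have hsub : insert b (outSet D u)ᶜ ⊆ inSet D a := by
      intro x hx
      rw [mem_insert, mem_compl, mem_outSet] at hx
      rw [mem_inSet]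
      rcases hx with rfl | hx
      · exact hba
      · have := hno x hx
        rw [mem_missing] at this
        by_contra h
        exact this ⟨mem_outSet.1 ha.1, h⟩
    have h1 := card_le_card hsub
    rw [card_insert_of_notMem (by simpa using hub)] at h1
    have := hin a
    omega
  set Z := (outSet D u)ᶜ.filter (fun x => deficit D u x ≠ 0) with hZ
  have hZsum : ∑ x ∈ Z, (missing D u x).card ≤ 2 * totalDeficit D u := by
    rw [totalDeficit, mul_sum]
    refine le_trans (sum_le_sum fun x hx => ?_) (sum_le_sum_of_subset (filter_subset _ _))
    have hx := mem_filter.1 hx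
    have := hF.card_missing x
    have := haway x (by simpa using hx.1)
    have := hx.2
    omega
  have hdef : ∀ x, ¬ D.Adj u x → deficit D u x ≤ totalDeficit D u := fun x hx => by
    simpa using sum_deficit_le (D := D) (u := u) (S := {x}) (by simpa using hx)
  -- The vertices of deficit zero miss at most one vertex, the same for all.
  obtain ⟨z, hz⟩ : ∃ z, ∀ x, ¬ D.Adj u x → deficit D u x = 0 → missing D u x ⊆ {z} := by
    by_cases hex : ∃ x, ¬ D.Adj u x ∧ deficit D u x = 0 ∧ (missing D u x).Nonempty
    · have hsingle : ∀ x, ¬ D.Adj u x → deficit D u x = 0 → (missing D u x).Nonempty →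
          ∃ z y, missing D u x = {z} ∧ D.Adj x y ∧ ¬ D.Adj u y := by
        intro x hx hd hne
        have h1 := hF.card_missing x
        have h2 := haway x hx
        have h3 := hne.card_pos
        obtain ⟨z, hz⟩ := card_eq_one.1 (show (missing D u x).card = 1 by omega)
        obtain ⟨y, hy⟩ := card_pos.1 (show 0 < (away D u x).card by omega)
        exact ⟨z, y, hz, mem_away.1 hy⟩
      obtain ⟨x, hx, hd, hne⟩ := hex
      obtain ⟨z, y, hz, hxy, huy⟩ := hsingle x hx hd hne
      refine ⟨z, fun x' hx' hd' => ?_⟩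
      rcases (missing D u x').eq_empty_or_nonempty with h0 | hne'
      · simp [h0]
      obtain ⟨z', y', hz', hxy', huy'⟩ := hsingle x' hx' hd' hne'
      rw [hz', singleton_subset_iff, mem_singleton]
      -- a common successor of `y` and `y'` with a predecessor in `N⁺(u)`
      have hb : ((missing D u y ∪ missing D u y') ∪ sourcesIn D u (outSet D u)).card <
          (outSet D u).card := by
        have e1 := hF.card_missing y
        have e2 := hF.card_missing y'
        have e3 := haway y huy
        have e4 := haway y' huy'
        have e5 := hdef y huy
        have e6 := hdef y' huy'
        have e7 := card_union_le (missing D u y ∪ missing D u y') (sourcesIn D u (outSet D u))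
        have e8 := card_union_le (missing D u y) (missing D u y')
        omega
      obtain ⟨b, hbN, hb⟩ := exists_mem_notMem_of_card_lt_card hb
      simp only [mem_union, not_or] at hb
      have hub : D.Adj u b := by simpa using hbN
      obtain ⟨a, hua, hab⟩ := exists_pred_of_notMem hbN hb.2
      have hyb : D.Adj y b := by
        by_contra h; exact hb.1.1 (mem_missing.2 ⟨hub, h⟩)
      have hyb' : D.Adj y' b := by
        by_contra h; exact hb.1.2 (mem_missing.2 ⟨hub, h⟩)
      have m1 := hF.mem_missing_of_adj hxy huy hyb hua hab (fun h => hx (h ▸ hub))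
      have m2 := hF.mem_missing_of_adj hxy' huy' hyb' hua hab (fun h => hx' (h ▸ hub))
      rw [hz, mem_singleton] at m1
      rw [hz', mem_singleton] at m2
      rw [← m1, ← m2]
    · push Not at hex
      refine ⟨u, fun x hx hd => ?_⟩
      simp [hex x hx hd]
  have hcover : outSet D u ⊆ sourcesIn D u (outSet D u) ∪ ({z} ∪ Z.biUnion (missing D u)) := by
    intro a ha
    simp only [mem_union, mem_biUnion, mem_singleton]
    by_cases has : a ∈ sourcesIn D u (outSet D u)
    · exact Or.inl has
    obtain ⟨x, hx, hax⟩ := hmiss a (mem_sdiff.2 ⟨ha, has⟩)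
    by_cases hd : deficit D u x = 0
    · exact Or.inr (Or.inl (by simpa using hz x hx hd hax))
    · exact Or.inr (Or.inr ⟨x, mem_filter.2 ⟨by simpa using hx, hd⟩, hax⟩)
  have c1 := card_le_card hcover
  have c2 := card_union_le (sourcesIn D u (outSet D u)) ({z} ∪ Z.biUnion (missing D u))
  have c3 := card_union_le {z} (Z.biUnion (missing D u))
  have c4 : (Z.biUnion (missing D u)).card ≤ _ := card_biUnion_le
  rw [card_singleton] at c3
  omega

/-- The local structure at a vertex of maximum out-degree of a digraph of large size. -/
theorem local_structure (hn : 13 ≤ Fintype.card V)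
    (he : Fintype.card V ^ 2 + 4 * Fintype.card V ≤ 4 * size D + 4)
    (hin : ∀ v, (inSet D v).card ≤ (outSet D u).card) :
    (∀ x, (away D u x).card ≤ 1) ∧ (inSet D u ∩ outSet D u).card ≤ 2 ∧
      (Fintype.card V + 1 = 2 * (outSet D u).card ∨
        Fintype.card V + 2 = 2 * (outSet D u).card) := by
  obtain ⟨h1, h2⟩ := hF.away_le_one_of_notMem_and hn he
  have hE := hF.four_mul_le he
  have hcard := hF.card_eq
  have hcard' := (card_add_card_compl (outSet D u)).symm
  have hj : ((Fintype.card V : ℤ) - 2 * ((outSet D u).card : ℤ)) ^ 2 ≤ 8 := by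
    have := Int.natCast_nonneg ((sourcesIn D u (outSet D u)).card +
      (sourcesIn D u ((outSet D u)ᶜ.erase u)).card + totalDeficit D u)
    omega
  have hP : (sourcesIn D u (outSet D u)).card +
      (sourcesIn D u ((outSet D u)ᶜ.erase u)).card + totalDeficit D u ≤ 2 := by
    have := sq_nonneg ((Fintype.card V : ℤ) - 2 * ((outSet D u).card : ℤ))
    omega
  have hj1 : (Fintype.card V : ℤ) - 2 * ((outSet D u).card : ℤ) ≤ 2 := by nlinarith
  have hj2 : -2 ≤ (Fintype.card V : ℤ) - 2 * ((outSet D u).card : ℤ) := by nlinarith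
  have hsum : ∑ x ∈ (outSet D u)ᶜ, (missing D u x).card ≤
      ((outSet D u)ᶜ.erase u).card + totalDeficit D u := by
    rw [sum_congr rfl fun x _ => hF.card_missing x, sum_add_distrib, totalDeficit]
    refine Nat.add_le_add_right ?_ _
    rw [← add_sum_erase _ _ hF.self_mem_compl, away_self, card_empty, zero_add, card_eq_sum_ones]
    refine sum_le_sum fun x hx => h1 x ?_
    simpa using (mem_erase.1 hx).2
  have hD := hF.card_add_le_of_inSet_le hin
  have h2k := hF.not_card_eq_two_mul hn hin h1 (by omega)
  have hle : Fintype.card V ≤ 2 * (outSet D u).card := by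
    by_contra! hlt
    have : (outSet D u)ᶜ.card = ((outSet D u)ᶜ.erase u).card + 1 :=
      (card_erase_add_one hF.self_mem_compl).symm
    rw [this] at hD
    generalize ((outSet D u)ᶜ.erase u).card = h at *
    have hhk : (outSet D u).card ≤ h := by omega
    have hk6 : 6 ≤ (outSet D u).card := by omega
    generalize (outSet D u).card = k at *
    have : k * (h + 2) ≤ k * k + h + 2 := by linarith
    obtain ⟨d, rfl⟩ := Nat.exists_eq_add_of_le hhk
    nlinarith
  refine ⟨fun x => ?_, h2, by omega⟩
  by_cases hx : D.Adj u x
  · by_contra! hlt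
    have h3 := hF.away_mul_le_of_mem hx
    have h4 : ∑ y ∈ away D u x, (missing D u y).card ≤ (away D u x).card + totalDeficit D u := by
      rw [sum_congr rfl fun x _ => hF.card_missing x, sum_add_distrib, card_eq_sum_ones]
      exact Nat.add_le_add (sum_le_sum fun y hy => h1 y (mem_away.1 hy).2)
        (sum_deficit_le fun y hy => (mem_away.1 hy).2)
    have hk6 : 6 ≤ (outSet D u).card := by omega
    obtain ⟨r, hr⟩ := Nat.exists_eq_add_of_lt hlt
    have h5 := Nat.mul_le_mul_left (r + 1) hk6
    have h6 : (1 + r + 1) * (outSet D u).card =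
      (r + 1) * (outSet D u).card + (outSet D u).card := by ring
    rw [hr, h6] at h3
    omega
  · exact h1 x hx

end IsFrame
end LocalStructure

/-! ### Digraphs in which every vertex has a unique predecessor -/

section PredecessorMap
variable {V : Type*} {D : Digraph V} {N : Set V} {π : V → V}

/-- In `D(N)`, every vertex `b` has exactly one predecessor, namely `π b`. -/
structure IsPredMap (D : Digraph V) (N : Set V) (π : V → V) : Prop where
  mem : ∀ b ∈ N, π b ∈ N
  adj : ∀ b ∈ N, ∀ a ∈ N, D.Adj a b ↔ a = π b
  ne : ∀ b ∈ N, π b ≠ b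

namespace IsPredMap
variable (h : IsPredMap D N π)
include h

theorem isTwoCycles {C : Set V} (hC : C ⊆ N) (hπ : ∀ c ∈ C, π c ∈ C)
    (hcyc : ∀ c ∈ C, π (π c) = c) : IsTwoCycles D C := by
  intro a ha
  refine ⟨π a, hπ a ha, h.ne a (hC ha), (h.adj a (hC ha) _ (h.mem a (hC ha))).2 rfl,
    fun c hc => ?_⟩
  rw [h.adj c (hC hc) a (hC ha)]
  constructor
  · rintro rfl
    exact (hcyc c hc).symm
  · rintro rfl
    exact (hcyc a ha).symm

theorem isS {y : V} (hy : y ∈ N) (hyy : π (π y) = y) :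
    IsS D {d | d ∈ N ∧ (d = π y ∨ π d = π y)} y (π y) := by
  refine ⟨⟨hy, Or.inr rfl⟩, ⟨h.mem y hy, Or.inl rfl⟩, (h.ne y hy).symm, ?_⟩
  rintro a ⟨ha, ha'⟩ b ⟨hb, hb'⟩
  rw [h.adj b hb a ha]
  have := h.ne b hb
  have := h.ne y hy
  grind

theorem noArcsBetween {S T : Set V} (hS : S ⊆ N) (hT : T ⊆ N) (h1 : ∀ s ∈ S, π s ∉ T)
    (h2 : ∀ t ∈ T, π t ∉ S) : NoArcsBetween D S T := by
  intro s hs t ht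
  rw [h.adj t (hT ht) s (hS hs), h.adj s (hS hs) t (hT ht)]
  exact ⟨fun e => h2 t ht (e ▸ hs), fun e => h1 s hs (e ▸ ht)⟩

/-- If every vertex is either on a 2-cycle or the second iterate of `π` takes it to the vertex `y`
of a 2-cycle, then `D(N)` consists of `S(y, π y)` and 2-cycles. -/
theorem isSWithTwoCycles {y : V} (hy : y ∈ N) (hyy : π (π y) = y)
    (hd : ∀ d ∈ N, π (π d) = d ∨ π (π d) = y) : IsSWithTwoCycles D N y (π y) := by
  have hm := h.mem
  have hne := h.ne
  refine ⟨{d | d ∈ N ∧ (d = π y ∨ π d = π y)}, {d | d ∈ N ∧ ¬ (d = π y ∨ π d = π y)},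
    ?_, ?_, ?_, h.isS hy hyy, ?_⟩
  · ext d; simp only [Set.mem_union, Set.mem_ofPred_eq]; tauto
  · rw [Set.disjoint_left]; rintro d ⟨-, h1⟩ ⟨-, h2⟩; exact h2 h1
  · apply h.noArcsBetween (fun _ h => h.1) (fun _ h => h.1)
    all_goals
      simp only [Set.mem_ofPred_eq]
      grind
  · apply h.isTwoCycles (fun _ h => h.1)
    all_goals
      simp only [Set.mem_ofPred_eq]
      grind

/-- A set whose vertices reach the root `r` by at most two steps of `π` carries a 2-arborescence.  The
distance to the root gives both acyclicity and the bound on the length of paths. -/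
theorem isArborescence {A : Set V} {r : V} (hA : A ⊆ N) (hr : r ∈ A) (hrA : π r ∉ A)
    (hd : ∀ a ∈ A, a ≠ r → π a = r ∨ π a ∈ A ∧ π a ≠ r ∧ π (π a) = r) :
    IsArborescence D 2 A r := by
  classical
  have arc : ∀ a b, arcsIn D A a b ↔ b ∈ A ∧ b ≠ r ∧ a = π b := by
    intro a b
    constructor
    · rintro ⟨ha, hb, hab⟩
      rw [h.adj b (hA hb) a (hA ha)] at hab
      refine ⟨hb, ?_, hab⟩
      rintro rfl
      exact hrA (hab ▸ ha)
    · rintro ⟨hb, hbr, rfl⟩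
      refine ⟨?_, hb, (h.adj b (hA hb) _ (h.mem b (hA hb))).2 rfl⟩
      rcases hd b hb hbr with e | e
      · rwa [e]
      · exact e.1
  let dep : V → ℕ := fun a => if a = r then 0 else if π a = r then 1 else 2
  have hdep : ∀ a b, arcsIn D A a b → dep b = dep a + 1 := by
    intro a b hab
    rw [arc] at hab
    obtain ⟨hb, hbr, rfl⟩ := hab
    rcases hd b hb hbr with e | ⟨e1, e2, e3⟩
    · simp [dep, e, hbr]
    · simp [dep, e2, e3, hbr]
  have hle : ∀ a, dep a ≤ 2 := fun a => by simp only [dep]; split_ifs <;> omega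
  have path : ∀ w l, IsPathIn D A r w l → (l = [] ∧ w = r) ∨ (l = [w] ∧ π w = r) ∨
      (l = [π w, w] ∧ π w ≠ r) := by
    intro w l hl
    obtain ⟨hc, -, hlast⟩ := hl
    match l, hc, hlast with
    | [], _, hlast => left; simpa using hlast.symm
    | [a], hc, hlast =>
      right; left
      simp only [List.isChain_cons_cons, arc] at hc
      have : a = w := by simpa using hlast
      subst this
      exact ⟨rfl, hc.1.2.2.symm⟩
    | [a, b], hc, hlast =>
      right; right
      simp only [List.isChain_cons_cons, arc] at hc
      have : b = w := by simpa using hlast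
      subst this
      obtain ⟨⟨h1, h2, h3⟩, ⟨h4, h5, h6⟩, -⟩ := hc
      exact ⟨by rw [h6], fun e => h2 (h6.trans e)⟩
    | a :: b :: c :: l, hc, _ =>
      simp only [List.isChain_cons_cons] at hc
      have := hdep _ _ hc.1
      have := hdep _ _ hc.2.1
      have := hdep _ _ hc.2.2.1
      have := hle c
      omega
  refine ⟨hr, ?_, ?_, ?_⟩
  · have : ∀ a b, Relation.TransGen (arcsIn D A) a b → dep a < dep b := by
      intro a b hab
      induction hab with
      | single hab => have := hdep _ _ hab; omega
      | tail _ hab ih => have := hdep _ _ hab; omega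
    exact fun a ha => lt_irrefl _ (this a a ha)
  · intro w hw hwr
    rcases hd w hw hwr with e | ⟨e1, e2, e3⟩
    · refine ⟨[w], ⟨?_, by simpa using hwr.symm, by simp⟩, fun l hl => ?_⟩
      · simp [arc, hw, hwr, e]
      · rcases path w l hl with ⟨-, e'⟩ | ⟨e', -⟩ | ⟨-, e'⟩
        · exact absurd e' hwr
        · exact e'
        · exact absurd e e'
    · refine ⟨[π w, w], ⟨?_, ?_, by simp⟩, fun l hl => ?_⟩
      · simp [arc, hw, hwr, e1, e2, e3]
      · have := h.ne w (hA hw)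
        simp [e2.symm, hwr.symm, this]
      · rcases path w l hl with ⟨-, e'⟩ | ⟨-, e'⟩ | ⟨e', -⟩
        · exact absurd e' hwr
        · exact absurd e' e2
        · exact e'
  · intro w _ l hl
    rcases path w l hl with ⟨rfl, -⟩ | ⟨rfl, -⟩ | ⟨rfl, -⟩ <;> simp

/-- If `y₁` and `y₂` form a 2-cycle and `π ∘ π` takes every vertex to itself, to `y₁` or to `y₂`, then
`D(N)` consists of `T(y₁, y₂)` and 2-cycles. -/
theorem isT_and_isTwoCycles {y₁ y₂ : V} (hy₁ : y₁ ∈ N) (hy₂ : y₂ ∈ N) (h1 : π y₁ = y₂)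
    (h2 : π y₂ = y₁) (hd : ∀ d ∈ N, π (π d) = d ∨ π (π d) = y₁ ∨ π (π d) = y₂) :
    ∃ A C : Set V, A ∪ C = N ∧ Disjoint A C ∧ NoArcsBetween D A C ∧ IsT D A y₁ y₂ ∧
      IsTwoCycles D C := by
  have hm := h.mem
  have hne := h.ne
  let A : Set V := {d | d ∈ N ∧ (d = y₁ ∨ (d ≠ y₂ ∧ π d = y₁) ∨ (π d ≠ y₂ ∧ π (π d) = y₁))}
  let B : Set V := {d | d ∈ N ∧ (d = y₂ ∨ (d ≠ y₁ ∧ π d = y₂) ∨ (π d ≠ y₁ ∧ π (π d) = y₂))}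
  have hAdef : ∀ d, d ∈ A ↔ d ∈ N ∧ (d = y₁ ∨ (d ≠ y₂ ∧ π d = y₁) ∨
      (π d ≠ y₂ ∧ π (π d) = y₁)) := fun d => Iff.rfl
  have hBdef : ∀ d, d ∈ B ↔ d ∈ N ∧ (d = y₂ ∨ (d ≠ y₁ ∧ π d = y₂) ∨
      (π d ≠ y₁ ∧ π (π d) = y₂)) := fun d => Iff.rfl
  have hn1 := hne y₁ hy₁
  refine ⟨A ∪ B, N \ (A ∪ B), ?_, Set.disjoint_sdiff_right, ?_,
    ⟨A, B, rfl, ?_, ?_, ?_, ?_⟩, ?_⟩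
  · apply Set.union_sdiff_cancel
    rintro d (hd | hd)
    · exact hd.1
    · exact hd.1
  · apply h.noArcsBetween
    · rintro d (hd | hd)
      · exact hd.1
      · exact hd.1
    · exact Set.sdiff_subset
    · simp only [Set.mem_union, Set.mem_sdiff, hAdef, hBdef]
      grind
    · simp only [Set.mem_union, Set.mem_sdiff, hAdef, hBdef]
      grind
  · rw [Set.disjoint_left]
    simp only [hAdef, hBdef]
    grind
  · apply h.isArborescence (fun d hd => hd.1)
    · simp only [hAdef]; grind
    · simp only [hAdef]; grind
    · simp only [hAdef]; grind
  · apply h.isArborescence (fun d hd => hd.1)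
    · simp only [hBdef]; grind
    · simp only [hBdef]; grind
    · simp only [hBdef]; grind
  · intro a ha b hb
    rw [h.adj b hb.1 a ha.1, h.adj a ha.1 b hb.1]
    simp only [hAdef, hBdef] at ha hb
    grind
  · apply h.isTwoCycles Set.sdiff_subset
    · simp only [Set.mem_union, Set.mem_sdiff, hAdef, hBdef]
      grind
    · simp only [Set.mem_union, Set.mem_sdiff, hAdef, hBdef]
      grind

/-- If `y₁` and `y₂` lie on distinct 2-cycles and `π ∘ π` takes every vertex to itself, to `y₁` or to
`y₂`, then `D(N)` consists of `S(y₁, π y₁)`, `S(y₂, π y₂)` and 2-cycles. -/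
theorem isS_isS_and_isTwoCycles {y₁ y₂ : V} (hy₁ : y₁ ∈ N) (hy₂ : y₂ ∈ N) (h1 : π (π y₁) = y₁)
    (h2 : π (π y₂) = y₂) (h12 : y₁ ≠ y₂) (h12' : π y₁ ≠ y₂)
    (hd : ∀ d ∈ N, π (π d) = d ∨ π (π d) = y₁ ∨ π (π d) = y₂) :
    ∃ A B C : Set V, A ∪ B ∪ C = N ∧ Disjoint A B ∧ Disjoint A C ∧ Disjoint B C ∧
      NoArcsBetween D A B ∧ NoArcsBetween D A C ∧ NoArcsBetween D B C ∧
      IsS D A y₁ (π y₁) ∧ IsS D B y₂ (π y₂) ∧ IsTwoCycles D C := by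
  have hm := h.mem
  have hne := h.ne
  let A : Set V := {d | d ∈ N ∧ (d = π y₁ ∨ π d = π y₁)}
  let B : Set V := {d | d ∈ N ∧ (d = π y₂ ∨ π d = π y₂)}
  have hAdef : ∀ d, d ∈ A ↔ d ∈ N ∧ (d = π y₁ ∨ π d = π y₁) := fun d => Iff.rfl
  have hBdef : ∀ d, d ∈ B ↔ d ∈ N ∧ (d = π y₂ ∨ π d = π y₂) := fun d => Iff.rfl
  have hAN : A ⊆ N := fun d hd => hd.1
  have hBN : B ⊆ N := fun d hd => hd.1
  have hAS : IsS D A y₁ (π y₁) := h.isS hy₁ h1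
  have hBS : IsS D B y₂ (π y₂) := h.isS hy₂ h2
  clear_value A B
  refine ⟨A, B, N \ (A ∪ B), ?_, ?_, ?_, ?_, ?_, ?_, ?_, hAS, hBS, ?_⟩
  · exact Set.union_sdiff_cancel (Set.union_subset hAN hBN)
  · rw [Set.disjoint_left]
    simp only [hAdef, hBdef]
    grind
  · exact Set.disjoint_sdiff_right.mono_left Set.subset_union_left
  · exact Set.disjoint_sdiff_right.mono_left Set.subset_union_right
  · apply h.noArcsBetween hAN hBN
    · simp only [hAdef, hBdef]; grind
    · simp only [hAdef, hBdef]; grind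
  · apply h.noArcsBetween hAN Set.sdiff_subset
    · simp only [Set.mem_union, Set.mem_sdiff, hAdef, hBdef]; grind
    · simp only [Set.mem_union, Set.mem_sdiff, hAdef, hBdef]; grind
  · apply h.noArcsBetween hBN Set.sdiff_subset
    · simp only [Set.mem_union, Set.mem_sdiff, hAdef, hBdef]; grind
    · simp only [Set.mem_union, Set.mem_sdiff, hAdef, hBdef]; grind
  · apply h.isTwoCycles Set.sdiff_subset
    · simp only [Set.mem_union, Set.mem_sdiff, hAdef, hBdef]; grind
    · intro c hc
      simp only [Set.mem_sdiff, Set.mem_union, hAdef, hBdef] at hc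
      have e1 := hd c hc.1
      have e2 := hd (π c) (hm c hc.1)
      clear hd hAdef hBdef hAN hBN hAS hBS
      grind

end IsPredMap
end PredecessorMap

/-! ### Arcs leaving the successors of `u`, and stars -/

section Extraction
variable {V : Type*} [Fintype V] [DecidableEq V] {D : Digraph V} {u : V}

/-- The set `N⁺(u)`. -/
def succSet (D : Digraph V) (u : V) : Set V := {b | D.Adj u b}

omit [Fintype V] [DecidableEq V] in
@[simp] theorem mem_succSet {b : V} : b ∈ succSet D u ↔ D.Adj u b := Iff.rfl

omit [DecidableEq V] in
theorem ncard_succSet : (succSet D u).ncard = (outSet D u).card := by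
  rw [← Set.ncard_coe_finset]
  congr 1
  ext
  simp

/-- The vertices of `N⁺(u)` without successors outside `N⁺(u)`. -/
noncomputable def dead (D : Digraph V) (u : V) : Finset V :=
  (outSet D u).filter (fun a => (away D u a).card = 0)

theorem mem_dead {a : V} : a ∈ dead D u ↔ D.Adj u a ∧ ∀ x, D.Adj a x → D.Adj u x := by
  simp [dead, Finset.ext_iff]

theorem succIn_eq_empty_of_dead {a : V} (ha : a ∈ dead D u) : succIn D (succSet D u)ᶜ a = ∅ := by
  rw [mem_dead] at ha
  ext x
  simp only [succIn, Set.mem_compl_iff, mem_succSet, Set.mem_ofPred_eq, Set.mem_empty_iff_false,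
    iff_false, not_and]
  exact fun hx hax => hx (ha.2 x hax)

theorem exists_away_of_not_dead {a : V} (ha : D.Adj u a) (hd : a ∉ dead D u) :
    ∃ x, ¬ D.Adj u x ∧ D.Adj a x := by
  rw [mem_dead] at hd
  push Not at hd
  obtain ⟨x, h1, h2⟩ := hd ha
  exact ⟨x, h2, h1⟩

theorem succIn_eq_of_missing {x : V} {S : Set V}
    (hS : ∀ b, b ∈ missing D u x ↔ D.Adj u b ∧ b ∈ S) :
    succIn D (succSet D u) x = succSet D u \ S := by
  ext b
  have := hS b
  rw [mem_missing] at this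
  simp only [succIn, Set.mem_sdiff, Set.mem_ofPred_eq, mem_succSet]
  tauto

omit [Fintype V] [DecidableEq V] in
theorem succIn_self : succIn D (succSet D u) u = succSet D u := by
  ext b
  simp [succIn]

theorem away_unique (h : ∀ x, (away D u x).card ≤ 1) {a x y : V} (hax : D.Adj a x)
    (hx : ¬ D.Adj u x) (hay : D.Adj a y) (hy : ¬ D.Adj u y) : x = y :=
  card_le_one.1 (h a) x (mem_away.2 ⟨hax, hx⟩) y (mem_away.2 ⟨hay, hy⟩)

theorem missing_subset_singleton {x z : V} (h : (missing D u x).card ≤ 1)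
    (hz : z ∈ missing D u x) : missing D u x = {z} :=
  eq_singleton_iff_unique_mem.2 ⟨hz, fun _ hw => card_le_one.1 h _ hw _ hz⟩

theorem deficit_eq_zero (h : totalDeficit D u = 0) {x : V} (hx : ¬ D.Adj u x) :
    deficit D u x = 0 :=
  (sum_eq_zero_iff.1 h) x (by simpa using hx)

omit [DecidableEq V] in
theorem exists_mem_not_mem (hk : 4 ≤ (outSet D u).card) (S : Finset V) (hS : S.card ≤ 3) :
    ∃ b, D.Adj u b ∧ b ∉ S := by
  obtain ⟨b, hb, hbS⟩ := exists_mem_notMem_of_card_lt_card (show S.card < (outSet D u).card by omega)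
  exact ⟨b, mem_outSet.1 hb, hbS⟩

namespace IsFrame
variable (hF : IsFrame D u)
include hF

/-- Double counting of the arcs leaving `N⁺(u)`. -/
theorem card_dead_add (h : ∀ x, (away D u x).card ≤ 1) :
    (dead D u).card + ((outSet D u)ᶜ.erase u).card + (inSet D u ∩ outSet D u).card =
      (outSet D u).card + (sourcesIn D u ((outSet D u)ᶜ.erase u)).card := by
  have h1 := card_eq_sum_add_card_zero (outSet D u) (fun a => (away D u a).card) fun a _ => h a
  have h2 := card_eq_sum_add_card_zero ((outSet D u)ᶜ.erase u)
    (fun b => (inSet D b ∩ outSet D u).card)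
    fun b hb => card_le_one_of_unique hF.unique (ne_of_mem_erase hb).symm subset_rfl
  have h3 : ∑ a ∈ outSet D u, (away D u a).card =
      ∑ b ∈ (outSet D u)ᶜ, (inSet D b ∩ outSet D u).card := by
    rw [← sum_card_outSet_inter]
    simp only [away, sdiff_eq_inter_compl]
  rw [← add_sum_erase _ _ hF.self_mem_compl] at h3
  unfold dead sourcesIn
  omega

/-- If `x → y` are vertices outside `N⁺(u)` that miss at most one vertex of `N⁺(u)` and `x` misses
exactly `z`, then all vertices of `N⁺(u)` other than `z` are successors of `z`. -/
theorem isS_of_missing (hpred : ∀ b, D.Adj u b → ∃ a, D.Adj u a ∧ D.Adj a b) {x y z : V}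
    (hx : ¬ D.Adj u x) (hxz : missing D u x = {z}) (hxy : D.Adj x y) (hy : ¬ D.Adj u y)
    (hmy : (missing D u y).card ≤ 1) :
    missing D u y = {z} ∧ ∃ w, IsS D (succSet D u) w z := by
  have key : ∀ a b, D.Adj u a → D.Adj u b → D.Adj a b → D.Adj y b → a = z := by
    intro a b ha hb hab hyb
    have := hF.mem_missing_of_adj hxy hy hyb ha hab (fun h => hx (h ▸ hb))
    simpa [hxz] using this
  have huz : D.Adj u z := by
    have : z ∈ missing D u x := by simp [hxz]
    exact (mem_missing.1 this).1
  obtain ⟨w, huw, hwz⟩ := hpred z huz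
  have hwz' : w ≠ z := hF.strict.ne hwz
  have hzy : z ∈ missing D u y := by
    rw [mem_missing]
    exact ⟨huz, fun h => hwz' (key w z huw huz hwz h)⟩
  have hmy' := missing_subset_singleton hmy hzy
  have hzb : ∀ b, D.Adj u b → b ≠ z → D.Adj z b := by
    intro b hb hbz
    obtain ⟨a, hua, hab⟩ := hpred b hb
    have hyb : D.Adj y b := by
      by_contra h
      have : b ∈ missing D u y := mem_missing.2 ⟨hb, h⟩
      rw [hmy', mem_singleton] at this
      exact hbz this
    rwa [← key a b hua hb hab hyb]
  refine ⟨hmy', w, huw, huz, hwz', ?_⟩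
  intro a ha b hb
  constructor
  · intro hab
    by_cases hbz : b = z
    · subst hbz
      exact Or.inl ⟨hF.unique (hF.strict.ne hb) ha hab huw hwz, rfl⟩
    · exact Or.inr ⟨hF.unique (hF.strict.ne hb) ha hab huz (hzb b hb hbz), hbz⟩
  · rintro (⟨rfl, rfl⟩ | ⟨rfl, hbz⟩)
    · exact hwz
    · exact hzb b hb hbz

theorem eq_of_isS (hk : 4 ≤ (outSet D u).card) {y z y' z' : V} (h : IsS D (succSet D u) y z)
    (h' : IsS D (succSet D u) y' z') : z = z' := by
  obtain ⟨b, hb, hbS⟩ := exists_mem_not_mem hk {z, z'} (card_le_two.trans (by omega))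
  simp only [mem_insert, mem_singleton, not_or] at hbS
  exact hF.unique (hF.strict.ne hb) h.2.1 ((h.2.2.2 z h.2.1 b hb).2 (Or.inr ⟨rfl, hbS.1⟩)) h'.2.1
    ((h'.2.2.2 z' h'.2.1 b hb).2 (Or.inr ⟨rfl, hbS.2⟩))

/-- A predecessor `y` of a vertex `z` dominating almost all of `N⁺(u)` has no successors outside
`N⁺(u)`: such a successor `x` and `z` would have a common successor. -/
theorem mem_dead_of_adj {y z : V} (hy : D.Adj u y) (hz : D.Adj u z) (hyz : D.Adj y z)
    {S : Finset V} (hS : S.card ≤ 2) (hzb : ∀ b, D.Adj u b → b ∉ S → D.Adj z b)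
    (hk : 6 ≤ (outSet D u).card) (hm : ∀ x, ¬ D.Adj u x → (missing D u x).card ≤ 2) :
    y ∈ dead D u := by
  refine mem_dead.2 ⟨hy, fun x hyx => ?_⟩
  by_contra hx
  obtain ⟨b, hb, hbS⟩ := exists_mem_notMem_of_card_lt_card
    (show (missing D u x ∪ insert y S).card < (outSet D u).card by
      have := hm x hx
      have := card_union_le (missing D u x) (insert y S)
      have := card_insert_le y S
      omega)
  simp only [mem_union, mem_insert, not_or, mem_missing, not_and, not_not] at hbS
  rw [mem_outSet] at hb
  have := hF.unique (Ne.symm hbS.2.1) hyx (hbS.1 hb) hyz (hzb b hb hbS.2.2)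
  exact hx (this ▸ hz)

theorem mem_dead_of_isS {y z : V} (h : IsS D (succSet D u) y z) (hk : 6 ≤ (outSet D u).card)
    (hm : ∀ x, ¬ D.Adj u x → (missing D u x).card ≤ 2) : y ∈ dead D u :=
  hF.mem_dead_of_adj h.1 h.2.1 ((h.2.2.2 y h.1 z h.2.1).2 (Or.inl ⟨rfl, rfl⟩)) (S := {z})
    (by simp) (fun b hb hbz => (h.2.2.2 z h.2.1 b hb).2 (Or.inr ⟨rfl, by simpa using hbz⟩)) hk hm

end IsFrame
end Extraction

/-! ### A vertex of maximum out-degree on one 2-cycle -/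

section Covered
variable {V : Type*} [Fintype V] [DecidableEq V] {D : Digraph V} {u : V} {π : V → V}

/-- A vertex `u` of maximum out-degree such that every vertex `b` has exactly one predecessor in
`N⁺(u)`, namely `π b`, and such that all vertices outside `N⁺(u)` have maximum out-degree. -/
structure IsCovered (D : Digraph V) (u : V) (π : V → V) : Prop extends IsFrame D u where
  mem : ∀ b, D.Adj u (π b)
  adj : ∀ b, D.Adj (π b) b
  eq : ∀ a b, D.Adj u a → D.Adj a b → a = π b
  away_le : ∀ x, (away D u x).card ≤ 1
  card_missing : ∀ x, ¬ D.Adj u x → (missing D u x).card = (away D u x).card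
  six_le : 6 ≤ (outSet D u).card

namespace IsCovered
variable (h : IsCovered D u π)
include h

theorem isPredMap : IsPredMap D (succSet D u) π where
  mem b _ := h.mem b
  adj b _ a ha := ⟨fun hab => h.eq a b ha hab, fun e => e ▸ h.adj b⟩
  ne b _ := h.strict.ne (h.adj b)

theorem missing_le {x : V} (hx : ¬ D.Adj u x) : (missing D u x).card ≤ 1 :=
  (h.card_missing x hx).trans_le (h.away_le x)

theorem matches_of_dead {Q : Set V} (hQ : ∀ a, a ∈ Q ↔ a ∈ dead D u) :
    Matches D (succSet D u \ Q) (succSet D u)ᶜ := by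
  constructor
  · rintro a ⟨ha, haQ⟩
    rw [hQ, mem_dead] at haQ
    push Not at haQ
    obtain ⟨x, hax, hx⟩ := haQ ha
    exact ⟨x, ⟨hx, hax⟩, fun y hy => away_unique h.away_le hy.2 hy.1 hax hx⟩
  · intro x hx
    refine ⟨π x, ⟨⟨h.mem x, fun hd => ?_⟩, h.adj x⟩, fun a ha => h.eq a x ha.1.1 ha.2⟩
    rw [hQ, mem_dead] at hd
    exact hx (hd.2 x (h.adj x))

/-- If there are no arcs outside `N⁺(u)`, a 2-path of `N⁺(u)` starts in a dead vertex or belongs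
to a 2-cycle. -/
theorem pred_pred (hno : ∀ x y, ¬ D.Adj u x → ¬ D.Adj u y → ¬ D.Adj x y) {d : V}
    (hd : D.Adj u d) : π (π d) = d ∨ π (π d) ∈ dead D u := by
  by_contra! hcon
  obtain ⟨h1, h2⟩ := hcon
  rw [mem_dead] at h2
  push Not at h2
  obtain ⟨x, hax, hx⟩ := h2 (h.mem _)
  have hxd : D.Adj x d := by
    by_contra hxd
    have h0 : (away D u x).card = 0 := by
      rw [card_eq_zero, eq_empty_iff_forall_notMem]
      intro y hy
      rw [mem_away] at hy
      exact hno x y hx hy.2 hy.1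
    have h3 := h.card_missing x hx
    rw [h0, card_eq_zero] at h3
    have : d ∈ missing D u x := mem_missing.2 ⟨hd, hxd⟩
    simp [h3] at this
  exact hx (h.unique h1 hax hxd (h.adj _) (h.adj d) ▸ h.mem d)

theorem succIn_eq_of_no_arcs (hno : ∀ x y, ¬ D.Adj u x → ¬ D.Adj u y → ¬ D.Adj x y) {x : V}
    (hx : ¬ D.Adj u x) : succIn D (succSet D u) x = succSet D u := by
  ext d
  refine ⟨fun hd => hd.1, fun hd => ⟨hd, ?_⟩⟩
  by_contra hxd
  have h0 : (away D u x).card = 0 := by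
    rw [card_eq_zero, eq_empty_iff_forall_notMem]
    intro y hy
    rw [mem_away] at hy
    exact hno x y hx hy.2 hy.1
  have h3 := h.card_missing x hx
  rw [h0, card_eq_zero] at h3
  have : d ∈ missing D u x := mem_missing.2 ⟨hd, hxd⟩
  simp [h3] at this

theorem classD1_of_no_arcs (hfirst : IsFirstPart (succSet D u))
    (hno : ∀ x y, ¬ D.Adj u x → ¬ D.Adj u y → ¬ D.Adj x y) {y : V} (hy : dead D u = {y}) :
    ClassD1 D := by
  have hyd : y ∈ dead D u := by simp [hy]
  have hsq : ∀ d ∈ succSet D u, π (π d) = d ∨ π (π d) = y := fun d hd => by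
    simpa [hy] using h.pred_pred hno hd
  have huy := (mem_dead.1 hyd).1
  refine ⟨succSet D u, y, π y, hfirst,
    h.isPredMap.isSWithTwoCycles huy (by simpa using hsq y huy) hsq,
    fun a ha b hb => hno a b ha hb, ⟨h.matches_of_dead (by simp [hy]),
      succIn_eq_empty_of_dead hyd⟩, fun x hx => h.succIn_eq_of_no_arcs hno hx⟩

/-- Two dead vertices, of which `y₁` is on a 2-cycle: if `y₂` is the partner of `y₁`, the class is
`D₄`; if `y₂` is on another 2-cycle, it is `D₅`; otherwise it is `D₁₀`. -/
theorem class_of_no_arcs_of_pair (hfirst : IsFirstPart (succSet D u))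
    (hno : ∀ x y, ¬ D.Adj u x → ¬ D.Adj u y → ¬ D.Adj x y) {y₁ y₂ : V} (hne : y₁ ≠ y₂)
    (hy : dead D u = {y₁, y₂}) (hcyc : π (π y₁) = y₁) :
    ClassD4 D ∨ ClassD5 D ∨ ClassD10 D := by
  have hyd₁ : y₁ ∈ dead D u := by simp [hy]
  have hyd₂ : y₂ ∈ dead D u := by simp [hy]
  have hsq : ∀ d ∈ succSet D u, π (π d) = d ∨ π (π d) = y₁ ∨ π (π d) = y₂ := fun d hd => by
    simpa [hy] using h.pred_pred hno hd
  have huy₁ := (mem_dead.1 hyd₁).1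
  have huy₂ := (mem_dead.1 hyd₂).1
  have hempty : IsEmptyOn D (succSet D u)ᶜ := fun a ha b hb => hno a b ha hb
  have hsucc : ∀ x ∈ (succSet D u)ᶜ, succIn D (succSet D u) x = succSet D u :=
    fun x hx => h.succIn_eq_of_no_arcs hno hx
  have hmatch : Matches D (succSet D u \ {y₁, y₂}) (succSet D u)ᶜ :=
    h.matches_of_dead (by simp [hy])
  by_cases h12 : π y₁ = y₂
  · left
    obtain ⟨A, C, hAC⟩ := h.isPredMap.isT_and_isTwoCycles huy₁ huy₂ h12 (h12 ▸ hcyc) hsq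
    exact ⟨succSet D u, A, C, y₁, y₂, hfirst, hAC, hempty,
      ⟨hmatch, succIn_eq_empty_of_dead hyd₁, succIn_eq_empty_of_dead hyd₂⟩, hsucc⟩
  · by_cases hcyc₂ : π (π y₂) = y₂
    · right; left
      obtain ⟨A, B, C, hABC⟩ :=
        h.isPredMap.isS_isS_and_isTwoCycles huy₁ huy₂ hcyc hcyc₂ hne h12 hsq
      exact ⟨succSet D u, A, B, C, y₁, π y₁, y₂, π y₂, hfirst, hABC, hempty,
        ⟨hmatch, succIn_eq_empty_of_dead hyd₁, succIn_eq_empty_of_dead hyd₂⟩, hsucc⟩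
    · right; right
      have hm := h.isPredMap.ne
      have h1 : ∀ d ∈ succSet D u, π (π d) = d ∨ π (π d) = y₁ := by
        intro d hd
        have e1 := hsq d hd
        have e2 := hsq (π d) (h.mem d)
        have e3 := hsq y₂ huy₂
        have e4 := hm y₂ huy₂
        have e5 := hm _ (h.mem y₂)
        have e6 := hm _ (h.mem d)
        grind
      exact ⟨succSet D u, y₁, π y₁, y₂, hfirst, h.isPredMap.isSWithTwoCycles huy₁ hcyc h1, hempty,
        ⟨⟨huy₂, by simp [hne.symm, Ne.symm h12]⟩, hmatch, succIn_eq_empty_of_dead hyd₁,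
          succIn_eq_empty_of_dead hyd₂⟩, hsucc⟩

theorem class_of_no_arcs (hfirst : IsFirstPart (succSet D u))
    (hno : ∀ x y, ¬ D.Adj u x → ¬ D.Adj u y → ¬ D.Adj x y) {y₁ y₂ : V} (hne : y₁ ≠ y₂)
    (hy : dead D u = {y₁, y₂}) : ClassD4 D ∨ ClassD5 D ∨ ClassD10 D := by
  have huy₁ : D.Adj u y₁ := (mem_dead.1 (show y₁ ∈ dead D u by simp [hy])).1
  have huy₂ : D.Adj u y₂ := (mem_dead.1 (show y₂ ∈ dead D u by simp [hy])).1
  have hsq : ∀ d ∈ succSet D u, π (π d) = d ∨ π (π d) = y₁ ∨ π (π d) = y₂ := fun d hd => by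
    simpa [hy] using h.pred_pred hno hd
  have hm := h.isPredMap.ne
  have : π (π y₁) = y₁ ∨ π (π y₂) = y₂ := by
    have e1 := hsq y₁ huy₁
    have e2 := hsq y₂ huy₂
    have e3 := hsq _ (h.mem y₁)
    have e4 := hm _ huy₁
    have e5 := hm _ huy₂
    have e6 := hm _ (h.mem y₁)
    have e7 := hm _ (h.mem y₂)
    grind
  rcases this with hc | hc
  · exact h.class_of_no_arcs_of_pair hfirst hno hne hy hc
  · exact h.class_of_no_arcs_of_pair hfirst hno hne.symm (by rw [hy, pair_comm]) hc

/-- The structure outside `N⁺(u)` when it contains an arc: `N⁺(u)` carries `S(y, z)`, and the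
vertices outside `N⁺(u)` are isolated or on 2-cycles, those on 2-cycles missing exactly `z`. -/
theorem exists_isS_of_arc {x₀ y₀ : V} (hx₀ : ¬ D.Adj u x₀) (hy₀ : ¬ D.Adj u y₀)
    (hxy₀ : D.Adj x₀ y₀) :
    ∃ (V₃ V₄ : Set V) (y z : V), IsS D (succSet D u) y z ∧
      (V₃ ∪ V₄ = (succSet D u)ᶜ ∧ Disjoint V₃ V₄ ∧ NoArcsBetween D V₃ V₄ ∧
        IsEmptyOn D V₃ ∧ IsTwoCycles D V₄) ∧
      ((∀ a ∈ V₃, succIn D (succSet D u) a = succSet D u) ∧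
        ∀ a ∈ V₄, succIn D (succSet D u) a = succSet D u \ {z}) ∧
      y ∈ dead D u ∧ ∀ w, ¬ D.Adj u w → D.Adj z w → w ∈ V₃ := by
  have hpred : ∀ b, D.Adj u b → ∃ a, D.Adj u a ∧ D.Adj a b := fun b _ => ⟨π b, h.mem b, h.adj b⟩
  have hk : 4 ≤ (outSet D u).card := le_trans (by omega) h.six_le
  have hex : ∀ x y, ¬ D.Adj u x → ¬ D.Adj u y → D.Adj x y → ∃ z w, missing D u x = {z} ∧
      missing D u y = {z} ∧ IsS D (succSet D u) w z := by
    intro x y hx hy hxy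
    have h1 : 0 < (away D u x).card := card_pos.2 ⟨y, mem_away.2 ⟨hxy, hy⟩⟩
    have h2 := h.card_missing x hx
    have h3 := h.missing_le hx
    obtain ⟨z, hz⟩ := card_eq_one.1 (show (missing D u x).card = 1 by omega)
    obtain ⟨h4, w, hw⟩ := h.toIsFrame.isS_of_missing hpred hx hz hxy hy (h.missing_le hy)
    exact ⟨z, w, hz, h4, hw⟩
  obtain ⟨z, y, -, -, hS⟩ := hex x₀ y₀ hx₀ hy₀ hxy₀
  have hall : ∀ a b, ¬ D.Adj u a → ¬ D.Adj u b → D.Adj a b →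
      missing D u a = {z} ∧ missing D u b = {z} := by
    intro a b ha hb hab
    obtain ⟨z', w, h1, h2, h3⟩ := hex a b ha hb hab
    obtain rfl := h.toIsFrame.eq_of_isS hk hS h3
    exact ⟨h1, h2⟩
  have hout : ∀ b, ¬ D.Adj u b → missing D u b = {z} → ∃ c, ¬ D.Adj u c ∧ D.Adj b c := by
    intro b hb hbz
    have h2 := h.card_missing b hb
    rw [hbz, card_singleton] at h2
    obtain ⟨c, hc⟩ := card_pos.1 (show 0 < (away D u b).card by omega)
    exact ⟨c, (mem_away.1 hc).2, (mem_away.1 hc).1⟩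
  have hzN : D.Adj u z := hS.2.1
  have hzb : ∀ b, D.Adj u b → b ≠ z → D.Adj z b := fun b hb hbz =>
    (hS.2.2.2 z hzN b hb).2 (Or.inr ⟨rfl, hbz⟩)
  -- The successor of `z` outside `N⁺(u)` has no successor outside `N⁺(u)`.
  have hz0 : ∀ w c, ¬ D.Adj u w → D.Adj z w → ¬ D.Adj u c → ¬ D.Adj w c := by
    intro w c hw hzw hc hwc
    have hne : π c ≠ z := by
      intro e
      have := away_unique h.away_le hzw hw (e ▸ h.adj c) hc
      exact h.strict c (this ▸ hwc)
    have := h.unique (fun e : z = c => hc (e ▸ hzN)) hzw hwc (hzb _ (h.mem c) hne) (h.adj c)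
    exact hw (this ▸ h.mem c)
  have hback : ∀ a b, ¬ D.Adj u a → ¬ D.Adj u b → D.Adj a b → D.Adj b a := by
    intro a b ha hb hab
    obtain ⟨c, hc, hbc⟩ := hout b hb (hall a b ha hb hab).2
    by_cases hca : a = c
    · rwa [hca]
    exfalso
    have hm : π c ∈ missing D u a := by
      rw [mem_missing]
      refine ⟨h.mem c, fun hac => ?_⟩
      exact hb (h.unique hca hab hbc hac (h.adj c) ▸ h.mem c)
    rw [(hall a b ha hb hab).1, mem_singleton] at hm
    obtain ⟨d, hd, hcd⟩ := hout c hc (hall b c hb hc hbc).2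
    exact hz0 c d hc (hm ▸ h.adj c) hd hcd
  refine ⟨{x | ¬ D.Adj u x ∧ ∀ c, ¬ D.Adj u c → ¬ D.Adj x c},
    {x | ¬ D.Adj u x ∧ ∃ c, ¬ D.Adj u c ∧ D.Adj x c}, y, z, hS, ⟨?_, ?_, ?_, ?_, ?_⟩, ⟨?_, ?_⟩, ?_, ?_⟩
  · ext x
    simp only [Set.mem_union, Set.mem_ofPred_eq, Set.mem_compl_iff, mem_succSet]
    by_cases hx : ∃ c, ¬ D.Adj u c ∧ D.Adj x c
    · simp [hx]
    · simp only [hx, and_false, or_false, and_iff_left_iff_imp]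
      push Not at hx
      exact fun _ => hx
  · rw [Set.disjoint_left]
    rintro x ⟨-, h1⟩ ⟨-, c, hc, hxc⟩
    exact h1 c hc hxc
  · rintro a ⟨ha, ha'⟩ b ⟨hb, -⟩
    exact ⟨ha' b hb, fun hba => ha' b hb (hback b a hb ha hba)⟩
  · rintro a ⟨ha, ha'⟩ b ⟨hb, -⟩
    exact ha' b hb
  · rintro a ⟨ha, b, hb, hab⟩
    refine ⟨b, ⟨hb, a, ha, hback a b ha hb hab⟩, (h.strict.ne hab).symm, hback a b ha hb hab,
      fun c hc => ⟨fun hac => away_unique h.away_le hac hc.1 hab hb, ?_⟩⟩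
    rintro rfl
    exact hab
  · rintro a ⟨ha, ha'⟩
    ext b
    refine ⟨fun hb => hb.1, fun hb => ⟨hb, ?_⟩⟩
    by_contra hab
    have h2 := h.card_missing a ha
    have h3 : 0 < (missing D u a).card := card_pos.2 ⟨b, mem_missing.2 ⟨hb, hab⟩⟩
    obtain ⟨c, hc⟩ := card_pos.1 (show 0 < (away D u a).card by omega)
    exact ha' c (mem_away.1 hc).2 (mem_away.1 hc).1
  · rintro a ⟨ha, b, hb, hab⟩
    have hm := (hall a b ha hb hab).1
    ext c
    have := Finset.ext_iff.1 hm c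
    simp only [mem_missing, mem_singleton] at this
    simp only [succIn, Set.mem_sdiff, Set.mem_ofPred_eq, Set.mem_singleton_iff, mem_succSet]
    tauto
  · exact h.toIsFrame.mem_dead_of_isS hS h.six_le fun x hx => (h.missing_le hx).trans (by omega)
  · exact fun w hw hzw => ⟨hw, fun c hc => hz0 w c hw hzw hc⟩

theorem classD1_or_classD2 (hfirst : IsFirstPart (succSet D u)) (hd : (dead D u).card = 1) :
    ClassD1 D ∨ ClassD2 D := by
  obtain ⟨q, hq⟩ := card_eq_one.1 hd
  by_cases hno : ∀ x y, ¬ D.Adj u x → ¬ D.Adj u y → ¬ D.Adj x y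
  · exact Or.inl (h.classD1_of_no_arcs hfirst hno hq)
  · push Not at hno
    obtain ⟨x, y, hx, hy, hxy⟩ := hno
    obtain ⟨V₃, V₄, y, z, hS, h34, hsucc, hyd, hz⟩ := h.exists_isS_of_arc hx hy hxy
    obtain rfl : y = q := by simpa [hq] using hyd
    obtain ⟨w, hw, hzw⟩ := exists_away_of_not_dead hS.2.1 (a := z)
      (by simpa [hq] using hS.2.2.1.symm)
    exact Or.inr ⟨succSet D u, V₃, V₄, y, z, hfirst, hS, h34,
      ⟨h.matches_of_dead (by simp [hq]), succIn_eq_empty_of_dead hyd, w, hz w hw hzw, hzw⟩, hsucc⟩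

/-- If there are arcs outside `N⁺(u)`, then one of the two dead vertices is `y`, and the class is `D₆` or
`D₇` according to whether the other one is `z`. -/
theorem class_of_card_dead_eq_two (hfirst : IsFirstPart (succSet D u))
    (hd : (dead D u).card = 2) :
    ClassD4 D ∨ ClassD5 D ∨ ClassD6 D ∨ ClassD7 D ∨ ClassD10 D := by
  obtain ⟨q₁, q₂, hne, hq⟩ := card_eq_two.1 hd
  by_cases hno : ∀ x y, ¬ D.Adj u x → ¬ D.Adj u y → ¬ D.Adj x y
  · have := h.class_of_no_arcs hfirst hno hne hq
    tauto
  · push Not at hno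
    obtain ⟨x, y, hx, hy, hxy⟩ := hno
    obtain ⟨V₃, V₄, y, z, hS, h34, hsucc, hyd, hz⟩ := h.exists_isS_of_arc hx hy hxy
    obtain ⟨q, hyq, hq⟩ : ∃ q, y ≠ q ∧ dead D u = {y, q} := by
      have : y = q₁ ∨ y = q₂ := by simpa [hq] using hyd
      rcases this with rfl | rfl
      · exact ⟨q₂, hne, hq⟩
      · exact ⟨q₁, hne.symm, by rw [hq, pair_comm]⟩
    have hqd : q ∈ dead D u := by simp [hq]
    by_cases hqz : q = z
    · subst hqz
      exact Or.inr (Or.inr (Or.inl ⟨succSet D u, V₃, V₄, y, q, hfirst, hS, h34,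
        ⟨h.matches_of_dead (by simp [hq]), succIn_eq_empty_of_dead hyd,
          succIn_eq_empty_of_dead hqd⟩, hsucc.2, hsucc.1⟩))
    · obtain ⟨w, hw, hzw⟩ := exists_away_of_not_dead hS.2.1 (a := z) (by
        simpa [hq] using ⟨hS.2.2.1.symm, Ne.symm hqz⟩)
      exact Or.inr (Or.inr (Or.inr (Or.inl ⟨succSet D u, V₃, V₄, y, z, q, hfirst, hS, h34,
        ⟨⟨(mem_dead.1 hqd).1, by simp [hyq.symm, hqz]⟩,
          h.matches_of_dead (by simp [hq, or_comm]), succIn_eq_empty_of_dead hqd,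
          succIn_eq_empty_of_dead hyd, w, hz w hw hzw, hzw⟩, hsucc.2, hsucc.1⟩)))

end IsCovered
end Covered

/-! ### A vertex of maximum out-degree on two 2-cycles, without defect -/

/-- Exchanging the partners is a fixed-point-free involution. -/
theorem IsTwoCycles.even_card {V : Type*} {D : Digraph V} {S : Finset V}
    (h : IsTwoCycles D (S : Set V)) : Even S.card := by
  classical
  choose! f hf hne hadj huniq using h
  have hff : ∀ a ∈ S, f (f a) = a := fun a ha =>
    ((huniq (f a) (hf a ha) a ha).1 (hadj a ha)).symm
  have := Finset.sum_involution (s := S) (f := fun _ => (1 : ZMod 2)) (fun a _ => f a)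
    (fun a _ => by decide) (fun a ha _ => hne a ha) (fun a ha => hf a ha) (fun a ha => hff a ha)
  rw [sum_const, nsmul_eq_mul, mul_one] at this
  exact (ZMod.natCast_eq_zero_iff_even).1 this

section Doubled
variable {V : Type*} [Fintype V] [DecidableEq V] {D : Digraph V} {u a₁ a₂ : V}

/-- A vertex `u` of maximum out-degree with exactly two predecessors `a₁` and `a₂` in `N⁺(u)` such
that all other vertices outside `N⁺(u)` have a predecessor in `N⁺(u)`. -/
structure IsDoubled (D : Digraph V) (u a₁ a₂ : V) : Prop extends IsFrame D u where
  away_le : ∀ x, (away D u x).card ≤ 1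
  six_le : 6 ≤ (outSet D u).card
  ne : a₁ ≠ a₂
  adj₁ : D.Adj u a₁
  adj₁' : D.Adj a₁ u
  adj₂ : D.Adj u a₂
  adj₂' : D.Adj a₂ u
  eq_or_eq : ∀ a, D.Adj u a → D.Adj a u → a = a₁ ∨ a = a₂
  exists_pred : ∀ w, ¬ D.Adj u w → w ≠ u → ∃ a, D.Adj u a ∧ D.Adj a w

theorem even_of_isTwoCycles (h2 : IsTwoCycles D ((succSet D u)ᶜ \ {u})) :
    Even ((outSet D u)ᶜ.erase u).card := by
  apply IsTwoCycles.even_card (D := D)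
  convert h2 using 1
  ext
  simp [and_comm]

namespace IsDoubled
variable (h : IsDoubled D u a₁ a₂)
include h

/-- The two predecessors `a₁` and `a₂` of `u` have no common predecessor besides `u`. -/
theorem exists_adj_mem_missing {x : V} (hxu : x ≠ u) :
    ∃ a, D.Adj u a ∧ D.Adj a u ∧ a ∈ missing D u x := by
  by_contra! hcon
  have h1 := hcon a₁ h.adj₁ h.adj₁'
  have h2 := hcon a₂ h.adj₂ h.adj₂'
  simp only [mem_missing, not_and, not_not] at h1 h2
  exact h.ne (h.unique hxu (h1 h.adj₁) h.adj₁' (h2 h.adj₂) h.adj₂')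

theorem adj_of_missing_eq {x z : V} (hxu : x ≠ u) (hz : missing D u x = {z}) : D.Adj z u := by
  obtain ⟨a, -, ha, hm⟩ := h.exists_adj_mem_missing hxu
  rw [hz, mem_singleton] at hm
  exact hm ▸ ha

theorem one_le_card_missing {x : V} (hxu : x ≠ u) : 1 ≤ (missing D u x).card := by
  obtain ⟨a, -, -, hm⟩ := h.exists_adj_mem_missing hxu
  exact card_pos.2 ⟨a, hm⟩

/-- A vertex `x ≠ u` outside `N⁺(u)` of maximum out-degree misses exactly one vertex of `N⁺(u)`,
and has a successor outside `N⁺(u)`. -/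
theorem exists_missing_eq {x : V} (hxu : x ≠ u) (hd : deficit D u x = 0) :
    ∃ z y, missing D u x = {z} ∧ D.Adj u z ∧ D.Adj z u ∧ D.Adj x y ∧ ¬ D.Adj u y := by
  have h1 := h.one_le_card_missing hxu
  have h2 := h.card_missing x
  have h3 := h.away_le x
  obtain ⟨z, hz⟩ := card_eq_one.1 (show (missing D u x).card = 1 by omega)
  obtain ⟨y, hy⟩ := card_pos.1 (show 0 < (away D u x).card by omega)
  have hzm : z ∈ missing D u x := by simp [hz]
  exact ⟨z, y, hz, (mem_missing.1 hzm).1, h.adj_of_missing_eq hxu hz, mem_away.1 hy⟩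

/-- Outside `N⁺(u)`, a 2-path from a vertex missing exactly one vertex of `N⁺(u)` returns. -/
theorem eq_of_adj_adj {x w₁ w₂ z : V} (hxu : x ≠ u) (hz : missing D u x = {z})
    (h1 : D.Adj x w₁) (hw₁ : ¬ D.Adj u w₁) (h2 : D.Adj w₁ w₂) (hw₂ : ¬ D.Adj u w₂) : w₂ = x := by
  by_contra hne
  have key : ∀ a, D.Adj u a → D.Adj a w₂ → a = z := by
    intro a ha haw
    have : a ∈ missing D u x := by
      rw [mem_missing]
      exact ⟨ha, fun hxa => hw₁ (h.unique (Ne.symm hne) h1 h2 hxa haw ▸ ha)⟩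
    simpa [hz] using this
  by_cases hwu : w₂ = u
  · subst hwu
    exact h.ne ((key a₁ h.adj₁ h.adj₁').trans (key a₂ h.adj₂ h.adj₂').symm)
  · obtain ⟨a, ha, haw⟩ := h.exists_pred w₂ hw₂ hwu
    have := key a ha haw
    subst this
    exact hwu (away_unique h.away_le haw hw₂ (h.adj_of_missing_eq hxu hz) (h.strict u))

/-- If all vertices outside `N⁺(u)` other than `u` miss exactly `z` and none has `u` as a successor,
then they form 2-cycles. -/
theorem isTwoCycles_of_missing {z : V}
    (hm : ∀ x, ¬ D.Adj u x → x ≠ u → missing D u x = {z} ∧ deficit D u x = 0)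
    (hu : ∀ x, ¬ D.Adj u x → ¬ D.Adj x u) : IsTwoCycles D ((succSet D u)ᶜ \ {u}) := by
  have hex : ∀ x, ¬ D.Adj u x → x ≠ u → ∃ y, D.Adj x y ∧ ¬ D.Adj u y ∧ y ≠ u := by
    intro x hx hxu
    obtain ⟨-, y, -, -, -, hxy, hy⟩ := h.exists_missing_eq hxu (hm x hx hxu).2
    exact ⟨y, hxy, hy, fun e => hu x hx (e ▸ hxy)⟩
  rintro x ⟨hx, hxu⟩
  obtain ⟨y, hxy, hy, hyu⟩ := hex x hx hxu
  obtain ⟨w, hyw, hw, -⟩ := hex y hy hyu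
  obtain rfl := h.eq_of_adj_adj hxu (hm x hx hxu).1 hxy hy hyw hw
  refine ⟨y, ⟨hy, hyu⟩, (h.strict.ne hxy).symm, hyw, fun c hc => ⟨fun hxc =>
    away_unique h.away_le hxc hc.1 hxy hy, ?_⟩⟩
  rintro rfl
  exact hxy

/-- A predecessor `z` of `u` in `N⁺(u)` has no other successor outside `N⁺(u)`.  Once `z` is discarded,
`u` has a single predecessor in `N⁺(u)`, as all other vertices outside `N⁺(u)` do. -/
theorem matches_of_dead {y z : V} (hy : dead D u = {y}) (hz : D.Adj u z) (hzu : D.Adj z u) :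
    Matches D (succSet D u \ {y, z}) (succSet D u)ᶜ ∧ succIn D (succSet D u)ᶜ z = {u} := by
  have hyd : y ∈ dead D u := by simp [hy]
  rw [mem_dead] at hyd
  have hzx : ∀ x, ¬ D.Adj u x → D.Adj z x → x = u := fun x hx hzx =>
    away_unique h.away_le hzx hx hzu (h.strict u)
  refine ⟨⟨?_, ?_⟩, ?_⟩
  · rintro a ⟨ha, haQ⟩
    simp only [Set.mem_insert_iff, Set.mem_singleton_iff, not_or] at haQ
    have had : a ∉ dead D u := by simpa [hy] using haQ.1
    rw [mem_dead] at had
    push Not at had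
    obtain ⟨x, hax, hx⟩ := had ha
    exact ⟨x, ⟨hx, hax⟩, fun w hw => away_unique h.away_le hw.2 hw.1 hax hx⟩
  · intro x hx
    simp only [Set.mem_compl_iff, mem_succSet] at hx
    by_cases hxu : x = u
    · subst hxu
      obtain ⟨a, hua, hau, haz, hall⟩ : ∃ a, D.Adj x a ∧ D.Adj a x ∧ a ≠ z ∧
          ∀ b, D.Adj x b → D.Adj b x → b = z ∨ b = a := by
        have hne := h.ne
        rcases h.eq_or_eq z hz hzu with e | e
        · exact ⟨a₂, h.adj₂, h.adj₂', e ▸ h.ne.symm, fun b hb hb' => e ▸ h.eq_or_eq b hb hb'⟩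
        · exact ⟨a₁, h.adj₁, h.adj₁', e ▸ h.ne, fun b hb hb' => e ▸ (h.eq_or_eq b hb hb').symm⟩
      refine ⟨a, ⟨⟨hua, ?_⟩, hau⟩, ?_⟩
      · simp only [Set.mem_insert_iff, Set.mem_singleton_iff, not_or]
        exact ⟨fun e => hx (hyd.2 x (e ▸ hau)), haz⟩
      · rintro b ⟨⟨hb, hbQ⟩, hbx⟩
        simp only [Set.mem_insert_iff, Set.mem_singleton_iff, not_or] at hbQ
        exact (hall b hb hbx).resolve_left hbQ.2
    · obtain ⟨a, hua, hax⟩ := h.exists_pred x hx hxu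
      refine ⟨a, ⟨⟨hua, ?_⟩, hax⟩, ?_⟩
      · simp only [Set.mem_insert_iff, Set.mem_singleton_iff, not_or]
        exact ⟨fun e => hx (hyd.2 x (e ▸ hax)), fun e => hxu (hzx x hx (e ▸ hax))⟩
      · rintro b ⟨⟨hb, -⟩, hbx⟩
        exact h.unique (Ne.symm hxu) hb hbx hua hax
  · ext x
    simp only [succIn, Set.mem_compl_iff, mem_succSet, Set.mem_ofPred_eq, Set.mem_singleton_iff]
    constructor
    · exact fun hx => hzx x hx.1 hx.2
    · rintro rfl
      exact ⟨h.strict x, hzu⟩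

/-- If no vertex outside `N⁺(u)` has a positive deficit and every vertex of `N⁺(u)` has a
predecessor in `N⁺(u)`, the digraph is in the class `D₃`.  The 2-cycles force the number of vertices
other than `u` outside `N⁺(u)` to be even. -/
theorem classD3_of_deficit (hfirst : IsFirstPart (succSet D u)) (ht : totalDeficit D u = 0)
    (hpred : ∀ b, D.Adj u b → ∃ a, D.Adj u a ∧ D.Adj a b)
    (hcard : ((outSet D u)ᶜ.erase u).card + 2 ≤ (outSet D u).card)
    (hcard' : (outSet D u).card ≤ ((outSet D u)ᶜ.erase u).card + 3)
    (hh : 2 ≤ ((outSet D u)ᶜ.erase u).card)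
    (hdead : (dead D u).card + ((outSet D u)ᶜ.erase u).card + 2 = (outSet D u).card) :
    ClassD3 D ∧ (outSet D u).card = ((outSet D u)ᶜ.erase u).card + 3 ∧
      Even ((outSet D u)ᶜ.erase u).card := by
  have hk : 4 ≤ (outSet D u).card := by omega
  have hd : ∀ x, ¬ D.Adj u x → deficit D u x = 0 := fun x hx => deficit_eq_zero ht hx
  have hm1 : ∀ x, ¬ D.Adj u x → (missing D u x).card ≤ 1 := fun x hx => by
    rw [h.card_missing, hd x hx]; exact h.away_le x
  obtain ⟨x₀, hx₀⟩ := card_pos.1 (show 0 < ((outSet D u)ᶜ.erase u).card by omega)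
  simp only [mem_erase, mem_compl, mem_outSet] at hx₀
  obtain ⟨z, y₀, hz₀, huz, hzu, hxy₀, hy₀⟩ := h.exists_missing_eq hx₀.1 (hd x₀ hx₀.2)
  obtain ⟨-, y, hS⟩ := h.isS_of_missing hpred hx₀.2 hz₀ hxy₀ hy₀ (hm1 _ hy₀)
  have hall : ∀ x, ¬ D.Adj u x → x ≠ u → missing D u x = {z} ∧
      ∀ w, ¬ D.Adj u w → D.Adj x w → w ≠ u := by
    intro x hx hxu
    obtain ⟨z', y', hz', -, -, hxy, hy'⟩ := h.exists_missing_eq hxu (hd x hx)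
    obtain ⟨h1, w, hw⟩ := h.isS_of_missing hpred hx hz' hxy hy' (hm1 _ hy')
    obtain rfl := h.eq_of_isS hk hS hw
    refine ⟨hz', fun w hw hxw e => ?_⟩
    obtain rfl := away_unique h.away_le hxw hw hxy hy'
    rw [e, missing_self] at h1
    exact absurd h1 (singleton_ne_empty z).symm
  have hno : ∀ x, ¬ D.Adj u x → ¬ D.Adj x u := by
    intro x hx hxu
    exact (hall x hx (h.strict.ne hxu)).2 u (h.strict u) hxu rfl
  have h2 : IsTwoCycles D ((succSet D u)ᶜ \ {u}) :=
    h.isTwoCycles_of_missing (fun x hx hxu => ⟨(hall x hx hxu).1, hd x hx⟩) hno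
  have hyd := h.mem_dead_of_isS hS h.six_le fun x hx => (hm1 x hx).trans (by omega)
  have := card_pos.2 ⟨y, hyd⟩
  have hdy : dead D u = {y} := by
    obtain ⟨q, hq⟩ := card_eq_one.1 (show (dead D u).card = 1 by omega)
    rw [hq] at hyd ⊢
    rw [mem_singleton.1 hyd]
  obtain ⟨hmat, hsz⟩ := h.matches_of_dead hdy huz hzu
  refine ⟨⟨succSet D u, y, z, u, hfirst, hS, ⟨h.strict u, ?_, h2⟩,
    ⟨hsz, succIn_eq_empty_of_dead hyd, hmat⟩, succIn_self, ?_⟩, by omega, even_of_isTwoCycles h2⟩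
  · rintro a rfl b hb
    exact ⟨hb, hno b hb⟩
  · rintro x ⟨hx, hxu⟩
    refine succIn_eq_of_missing fun b => ?_
    rw [(hall x hx hxu).1]
    simp only [mem_singleton, Set.mem_singleton_iff]
    exact ⟨fun e => ⟨e ▸ huz, e⟩, fun e => e.2⟩

end IsDoubled
end Doubled

/-! ### A vertex of maximum out-degree on two 2-cycles, with one defect -/

section Extremal
variable {V : Type*} [Fintype V] [DecidableEq V] {D : Digraph V} {u a₁ a₂ : V}

/-- A vertex without predecessors in `N⁺(u)` is on at most one 2-cycle, as the other vertex of such a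
2-cycle is a successor outside `N⁺(u)`. -/
theorem card_inter_le_one_of_source (haway : ∀ x, (away D u x).card ≤ 1) {w : V}
    (hw : ∀ a, D.Adj u a → ¬ D.Adj a w) : (inSet D w ∩ outSet D w).card ≤ 1 := by
  refine (card_le_card fun v hv => ?_).trans (haway w)
  simp only [mem_inter, mem_inSet, mem_outSet] at hv
  exact mem_away.2 ⟨hv.2, fun huv => hw v huv hv.1⟩

namespace IsDoubled
variable (h : IsDoubled D u a₁ a₂)
include h

/-- If exactly one vertex `n₀` of `N⁺(u)` has no predecessor in `N⁺(u)`, then some vertex of maximum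
out-degree is on at most one 2-cycle, contrary to the choice of `u`.  Such a vertex is `n₀` itself if
`n₀` is missed by some vertex outside `N⁺(u)`.  Otherwise all these vertices miss the same `z` and
form 2-cycles, which is excluded by parity. -/
theorem false_of_source (hmin : ∀ v, (outSet D v).card = (outSet D u).card →
      2 ≤ (inSet D v ∩ outSet D v).card) (ht : totalDeficit D u = 0) {n₀ : V} (hn₀ : D.Adj u n₀)
    (hsrc : ∀ a, D.Adj u a → ¬ D.Adj a n₀)
    (hpred : ∀ b, D.Adj u b → b ≠ n₀ → ∃ a, D.Adj u a ∧ D.Adj a b)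
    (hodd : (outSet D u).card = ((outSet D u)ᶜ.erase u).card + 3 →
      ¬ Even ((outSet D u)ᶜ.erase u).card)
    (hcard' : (outSet D u).card ≤ ((outSet D u)ᶜ.erase u).card + 3)
    (hh : 2 ≤ ((outSet D u)ᶜ.erase u).card)
    (hdead : (dead D u).card + ((outSet D u)ᶜ.erase u).card + 2 = (outSet D u).card) : False := by
  have hk6 := h.six_le
  have hd : ∀ x, ¬ D.Adj u x → deficit D u x = 0 := fun x hx => deficit_eq_zero ht hx
  have hm1 : ∀ x, ¬ D.Adj u x → (missing D u x).card ≤ 1 := fun x hx => by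
    rw [h.card_missing, hd x hx]; exact h.away_le x
  have hex := fun x (hx : ¬ D.Adj u x) (hxu : x ≠ u) => h.exists_missing_eq hxu (hd x hx)
  have avoid : ∀ S : Finset V, S.card ≤ 5 → ∃ b, D.Adj u b ∧ b ∉ S := by
    intro S hS
    obtain ⟨b, hb, hbS⟩ :=
      exists_mem_notMem_of_card_lt_card (show S.card < (outSet D u).card by omega)
    exact ⟨b, mem_outSet.1 hb, hbS⟩
  -- If `x → y`, then `z` dominates the successors of `y` in `N⁺(u)` other than `n₀`.
  have key : ∀ x y z b, ¬ D.Adj u x → missing D u x = {z} → D.Adj x y → ¬ D.Adj u y →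
      D.Adj u b → b ≠ n₀ → D.Adj y b → D.Adj z b := by
    intro x y z b hx hz hxy hy hb hbn hyb
    obtain ⟨a, ha, hab⟩ := hpred b hb hbn
    have := h.mem_missing_of_adj hxy hy hyb ha hab (fun e => hx (e ▸ hb))
    rw [hz, mem_singleton] at this
    exact this ▸ hab
  -- `n₀` is not the vertex missed by any `x`
  have hzn : ∀ x, ¬ D.Adj u x → x ≠ u → missing D u x ≠ {n₀} := by
    intro x hx hxu hz
    obtain ⟨z', y, hz', -, hzu, hxy, hy⟩ := hex x hx hxu
    obtain rfl : n₀ = z' := singleton_injective (hz.symm.trans hz')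
    have hdom : ∀ b, D.Adj u b → b ≠ n₀ → D.Adj n₀ b := by
      intro b hb hbn
      refine key x y n₀ b hx hz hxy hy hb hbn ?_
      by_contra hyb
      have hbm := missing_subset_singleton (hm1 y hy) (mem_missing.2 ⟨hb, hyb⟩)
      have hyu : y ≠ u := fun e => by
        rw [e, missing_self] at hbm
        exact absurd hbm (singleton_ne_empty b).symm
      obtain ⟨w, y₁, hw, -, -, hyy₁, hy₁⟩ := hex y hy hyu
      obtain rfl : b = w := singleton_injective (hbm.symm.trans hw)
      obtain ⟨c, hc, hcS⟩ := avoid (missing D u y₁ ∪ {n₀, b}) (by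
        have := card_union_le (missing D u y₁) {n₀, b}
        have := hm1 y₁ hy₁
        have : ({n₀, b} : Finset V).card ≤ 2 := card_le_two
        omega)
      simp only [mem_union, mem_missing, mem_insert, mem_singleton, not_or, not_and, not_not]
        at hcS
      have hyc : D.Adj y c := by
        by_contra hyc
        have : c ∈ missing D u y := mem_missing.2 ⟨hc, hyc⟩
        rw [hbm, mem_singleton] at this
        exact hcS.2.2 this
      have e1 := key x y n₀ c hx hz hxy hy hc hcS.2.1 hyc
      have e2 := key y y₁ b c hy hbm hyy₁ hy₁ hc hcS.2.1 (hcS.1 hc)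
      exact hbn (h.unique (h.strict.ne hc) hb e2 hn₀ e1)
    have hout : (outSet D n₀).card = (outSet D u).card := by
      refine le_antisymm (h.le_card n₀) ?_
      have hsub : insert u ((outSet D u).erase n₀) ⊆ outSet D n₀ := by
        intro b hb
        rw [mem_insert, mem_erase, mem_outSet] at hb
        rw [mem_outSet]
        rcases hb with rfl | hb
        · exact hzu
        · exact hdom b hb.2 hb.1
      have := card_le_card hsub
      rw [card_insert_of_notMem (by simp [h.strict u]),
        card_erase_add_one (mem_outSet.2 hn₀)] at this
      exact this
    have := hmin n₀ hout
    have := card_inter_le_one_of_source h.away_le hsrc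
    omega
  obtain ⟨x₀, hx₀⟩ := card_pos.1 (show 0 < ((outSet D u)ᶜ.erase u).card by omega)
  simp only [mem_erase, mem_compl, mem_outSet] at hx₀
  obtain ⟨z, y₀, hz₀, huz, hzu, hxy₀, hy₀⟩ := hex x₀ hx₀.2 hx₀.1
  have hback : ∀ x y z', ¬ D.Adj u x → x ≠ u → missing D u x = {z'} → D.Adj u z' → D.Adj x y →
      ¬ D.Adj u y → missing D u y = {z'} := by
    intro x y z' hx hxu hz' huz' hxy hy
    refine missing_subset_singleton (hm1 y hy) (mem_missing.2 ⟨huz', fun hyz => ?_⟩)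
    exact h.strict z' (key x y z' z' hx hz' hxy hy huz' (fun e => hzn x hx hxu (e ▸ hz')) hyz)
  have hzn₀ : z ≠ n₀ := fun e => hzn x₀ hx₀.2 hx₀.1 (e ▸ hz₀)
  have hdom : ∀ b, D.Adj u b → b ∉ ({z, n₀} : Finset V) → D.Adj z b := by
    intro b hb hbS
    simp only [mem_insert, mem_singleton, not_or] at hbS
    refine key x₀ y₀ z b hx₀.2 hz₀ hxy₀ hy₀ hb hbS.2 ?_
    by_contra hyb
    have : b ∈ missing D u y₀ := mem_missing.2 ⟨hb, hyb⟩
    rw [hback x₀ y₀ z hx₀.2 hx₀.1 hz₀ huz hxy₀ hy₀, mem_singleton] at this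
    exact hbS.1 this
  have hall : ∀ x, ¬ D.Adj u x → x ≠ u → missing D u x = {z} ∧ ¬ D.Adj x u := by
    intro x hx hxu
    obtain ⟨z', y', hz', huz', -, hxy, hy'⟩ := hex x hx hxu
    have h1 := hback x y' z' hx hxu hz' huz' hxy hy'
    obtain ⟨b, hb, hbS⟩ := avoid {z', z, n₀} (card_le_three.trans (by omega))
    simp only [mem_insert, mem_singleton, not_or] at hbS
    have hyb : D.Adj y' b := by
      by_contra hyb
      have : b ∈ missing D u y' := mem_missing.2 ⟨hb, hyb⟩
      rw [h1, mem_singleton] at this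
      exact hbS.1 this
    have e1 := key x y' z' b hx hz' hxy hy' hb hbS.2.2 hyb
    have e2 := hdom b hb (by simp [hbS.2.1, hbS.2.2])
    obtain rfl := h.unique (h.strict.ne hb) huz e2 huz' e1
    refine ⟨hz', fun hxu' => ?_⟩
    obtain rfl := away_unique h.away_le hxu' (h.strict u) hxy hy'
    rw [missing_self] at h1
    exact absurd h1 (singleton_ne_empty z).symm
  have hno : ∀ x, ¬ D.Adj u x → ¬ D.Adj x u := fun x hx hxu =>
    (hall x hx (h.strict.ne hxu)).2 hxu
  have h2 : IsTwoCycles D ((succSet D u)ᶜ \ {u}) :=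
    h.isTwoCycles_of_missing (fun x hx hxu => ⟨(hall x hx hxu).1, hd x hx⟩) hno
  obtain ⟨y, huy, hyz⟩ := hpred z huz hzn₀
  have hyd := h.mem_dead_of_adj huy huz hyz (S := {z, n₀}) card_le_two hdom hk6
    fun x hx => (hm1 x hx).trans (by omega)
  have := card_pos.2 ⟨y, hyd⟩
  exact hodd (by omega) (even_of_isTwoCycles h2)

/-- The case of a single vertex `x` of positive deficit.  The class is `D₈` if `x` has no successor
outside `N⁺(u)`, and `D₉` otherwise. -/
theorem classD8_or_classD9 (hmin : ∀ v, (outSet D v).card = (outSet D u).card →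
      2 ≤ (inSet D v ∩ outSet D v).card)
    (hmin' : ∀ v, (outSet D v).card = (outSet D u).card → (inSet D v ∩ outSet D v).card ≤ 2 →
      (inSet D u).card ≤ (inSet D v).card)
    (hfirst : IsFirstPart (succSet D u)) {x : V} (hx : ¬ D.Adj u x) (hdx : deficit D u x = 1)
    (hd : ∀ w, ¬ D.Adj u w → w ≠ x → deficit D u w = 0)
    (hpred : ∀ b, D.Adj u b → ∃ a, D.Adj u a ∧ D.Adj a b)
    (hodd : (outSet D u).card = ((outSet D u)ᶜ.erase u).card + 3 →
      ¬ Even ((outSet D u)ᶜ.erase u).card)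
    (hcard' : (outSet D u).card ≤ ((outSet D u)ᶜ.erase u).card + 3)
    (hh : 3 ≤ ((outSet D u)ᶜ.erase u).card)
    (hdead : (dead D u).card + ((outSet D u)ᶜ.erase u).card + 2 = (outSet D u).card) :
    (ClassD8 D ∨ ClassD9 D) ∧ (outSet D u).card = ((outSet D u)ᶜ.erase u).card + 3 := by
  have hk6 := h.six_le
  have hxu : x ≠ u := by
    rintro rfl
    simp [deficit] at hdx
  have hm2 : ∀ w, ¬ D.Adj u w → (missing D u w).card ≤ 2 := fun w hw => by
    have h1 := h.card_missing w
    have h2 := h.away_le w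
    by_cases hwx : w = x
    · subst hwx; omega
    · have := hd w hw hwx; omega
  have hm1 : ∀ w, ¬ D.Adj u w → w ≠ x → (missing D u w).card ≤ 1 := fun w hw hwx => by
    rw [h.card_missing, hd w hw hwx]; exact h.away_le w
  have hex := fun w (hw : ¬ D.Adj u w) (hwu : w ≠ u) (hwx : w ≠ x) =>
    h.exists_missing_eq hwu (hd w hw hwx)
  have avoid : ∀ S : Finset V, S.card ≤ 5 → ∃ b, D.Adj u b ∧ b ∉ S := by
    intro S hS
    obtain ⟨b, hb, hbS⟩ :=
      exists_mem_notMem_of_card_lt_card (show S.card < (outSet D u).card by omega)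
    exact ⟨b, mem_outSet.1 hb, hbS⟩
  -- `D(N⁺(u)) = S(y, z)`: otherwise `x` would be a successor of every other vertex `w ≠ u` outside
  -- `N⁺(u)`, and its own successor outside `N⁺(u)` would have to be each of these `w`, of which there are
  -- at least two.
  obtain ⟨y, z, hS⟩ : ∃ y z, IsS D (succSet D u) y z := by
    by_contra hcon
    have hbad : ∀ w, ¬ D.Adj u w → w ≠ u → w ≠ x → D.Adj w x ∧ 2 ≤ (missing D u x).card := by
      intro w hw hwu hwx
      obtain ⟨z, y, hz, -, -, hwy, hy⟩ := hex w hw hwu hwx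
      have h2 : ¬ (missing D u y).card ≤ 1 := fun h1 => by
        obtain ⟨-, v, hv⟩ := h.isS_of_missing hpred hw hz hwy hy h1
        exact hcon ⟨v, z, hv⟩
      obtain rfl : y = x := by
        by_contra hyx
        exact h2 (hm1 y hy hyx)
      exact ⟨hwy, by omega⟩
    obtain ⟨w₀, hw₀⟩ := exists_mem_notMem_of_card_lt_card
      (show ({x} : Finset V).card < ((outSet D u)ᶜ.erase u).card by rw [card_singleton]; omega)
    simp only [mem_erase, mem_compl, mem_outSet, mem_singleton] at hw₀
    have h2 := (hbad w₀ hw₀.1.2 hw₀.1.1 hw₀.2).2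
    have h3 := h.card_missing x
    obtain ⟨v, hv⟩ := card_pos.1 (show 0 < (away D u x).card by omega)
    rw [mem_away] at hv
    obtain ⟨w, hw⟩ := exists_mem_notMem_of_card_lt_card
      (show ({x, v} : Finset V).card < ((outSet D u)ᶜ.erase u).card from
        card_le_two.trans_lt (by omega))
    simp only [mem_erase, mem_compl, mem_outSet, mem_insert, mem_singleton, not_or] at hw
    obtain ⟨z, -, hz, -, -, -, -⟩ := hex w hw.1.2 hw.1.1 hw.2.1
    exact hw.2.2 (h.eq_of_adj_adj hw.1.1 hz (hbad w hw.1.2 hw.1.1 hw.2.1).1 hx hv.1 hv.2).symm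
  have huy : D.Adj u y := hS.1
  have huz : D.Adj u z := hS.2.1
  have hyz : D.Adj y z := (hS.2.2.2 y hS.1 z hS.2.1).2 (Or.inl ⟨rfl, rfl⟩)
  have hdom : ∀ b, D.Adj u b → b ≠ z → D.Adj z b := fun b hb hbz =>
    (hS.2.2.2 z hS.2.1 b hb).2 (Or.inr ⟨rfl, hbz⟩)
  have hzmiss : ∀ w v, ¬ D.Adj u w → D.Adj w v → ¬ D.Adj u v → z ∈ missing D u w := by
    intro w v hw hwv hv
    obtain ⟨b, hb, hbS⟩ := avoid (missing D u v ∪ {z}) (by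
      have h1 := card_union_le (missing D u v) {z}
      have h2 := hm2 v hv
      rw [card_singleton] at h1
      omega)
    simp only [mem_union, mem_missing, mem_singleton, not_or, not_and, not_not] at hbS
    exact h.mem_missing_of_adj hwv hv (hbS.1 hb) huz (hdom b hb hbS.2) (fun e => hw (e ▸ hb))
  have hX : ∀ w, ¬ D.Adj u w → w ≠ u → w ≠ x → missing D u w = {z} ∧
      ∃ v, D.Adj w v ∧ ¬ D.Adj u v ∧ v ≠ u := by
    intro w hw hwu hwx
    obtain ⟨z', v, hz', -, -, hwv, hv⟩ := hex w hw hwu hwx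
    have hzw := hzmiss w v hw hwv hv
    have hmw : missing D u w = {z} := missing_subset_singleton (hm1 w hw hwx) hzw
    refine ⟨hmw, v, hwv, hv, ?_⟩
    rintro rfl
    have := h.mem_missing_of_adj hwv hv huz huy hyz (fun e => hw (e ▸ huz))
    rw [hmw, mem_singleton] at this
    exact hS.2.2.1 this
  have hback : ∀ w v c, ¬ D.Adj u w → w ≠ u → w ≠ x → D.Adj w v → ¬ D.Adj u v → D.Adj v c →
      ¬ D.Adj u c → c = w := fun w v c hw hwu hwx hwv hv hvc hc =>
    h.eq_of_adj_adj hwu (hX w hw hwu hwx).1 hwv hv hvc hc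
  have hXu : ∀ w, ¬ D.Adj u w → w ≠ x → ¬ D.Adj w u := by
    intro w hw hwx hwu
    obtain ⟨-, v, hwv, hv, hvu⟩ := hX w hw (h.strict.ne hwu) hwx
    exact hvu (away_unique h.away_le hwv hv hwu (h.strict u))
  have hzu : D.Adj z u := by
    obtain ⟨w₀, hw₀⟩ := exists_mem_notMem_of_card_lt_card
      (show ({x} : Finset V).card < ((outSet D u)ᶜ.erase u).card by rw [card_singleton]; omega)
    simp only [mem_erase, mem_compl, mem_outSet, mem_singleton] at hw₀
    exact h.adj_of_missing_eq hw₀.1.1 (hX w₀ hw₀.1.2 hw₀.1.1 hw₀.2).1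
  have hyd := h.mem_dead_of_isS hS hk6 hm2
  have := card_pos.2 ⟨y, hyd⟩
  have hheven : ¬ Even ((outSet D u)ᶜ.erase u).card := hodd (by omega)
  have hdy : dead D u = {y} := by
    obtain ⟨q, hq⟩ := card_eq_one.1 (show (dead D u).card = 1 by omega)
    rw [hq] at hyd ⊢
    rw [mem_singleton.1 hyd]
  obtain ⟨hmat, hsz⟩ := h.matches_of_dead hdy huz hzu
  have hsy : succIn D (succSet D u)ᶜ y = ∅ := succIn_eq_empty_of_dead hyd
  have hsX : ∀ w, ¬ D.Adj u w → w ≠ u → w ≠ x →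
      succIn D (succSet D u) w = succSet D u \ {z} := by
    intro w hw hwu hwx
    refine succIn_eq_of_missing fun b => ?_
    rw [(hX w hw hwu hwx).1]
    simp only [mem_singleton, Set.mem_singleton_iff]
    exact ⟨fun e => ⟨e ▸ huz, e⟩, fun e => e.2⟩
  refine ⟨?_, by omega⟩
  by_cases hax : (away D u x).card = 0
  · -- `x` has no successors outside `N⁺(u)`
    left
    rw [card_eq_zero, eq_empty_iff_forall_notMem] at hax
    have hxno : ∀ v, ¬ D.Adj u v → ¬ D.Adj x v := fun v hv hxv => hax v (mem_away.2 ⟨hxv, hv⟩)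
    have hnox : ∀ w, ¬ D.Adj u w → ¬ D.Adj w x := by
      intro w hw hwx
      have hwx' := h.strict.ne hwx
      have hwu : w ≠ u := by
        rintro rfl
        exact hx hwx
      have hdeg : (outSet D w).card = (outSet D u).card := by
        have h1 := hd w hw hwx'
        have h2 := h.le_card w
        unfold deficit at h1
        omega
      have h2 := hmin w hdeg
      obtain ⟨p, hp, q, hq, hpq⟩ := one_lt_card.1 (show 1 < _ from h2)
      simp only [mem_inter, mem_inSet, mem_outSet] at hp hq
      have hin : ∀ v, D.Adj v w ∧ D.Adj w v → D.Adj u v := by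
        rintro v ⟨hvw, hwv⟩
        by_contra hv
        obtain rfl := away_unique h.away_le hwv hv hwx hx
        exact hxno w hw hvw
      exact hpq (h.unique (Ne.symm hwu) (hin p hp) hp.1 (hin q hq) hq.1)
    obtain ⟨w', hw'⟩ := card_eq_one.1 (show (missing D u x).card = 1 by
      have h1 := h.card_missing x
      have h2 : (away D u x).card = 0 := by
        rw [card_eq_zero, eq_empty_iff_forall_notMem]; exact hax
      omega)
    have hw'u := h.adj_of_missing_eq hxu hw'
    have huw' : D.Adj u w' := by
      have : w' ∈ missing D u x := by simp [hw']
      exact (mem_missing.1 this).1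
    have hsx : succIn D (succSet D u) x = succSet D u \ {w'} := by
      refine succIn_eq_of_missing fun b => ?_
      rw [hw']
      simp only [mem_singleton, Set.mem_singleton_iff]
      exact ⟨fun e => ⟨e ▸ huw', e⟩, fun e => e.2⟩
    refine ⟨succSet D u, y, z, u, x, hfirst, hS, ⟨h.strict u, hx, hxu.symm, ?_, ?_⟩,
      ⟨hsz, hsy, hmat⟩, succIn_self, ?_, ?_⟩
    · rintro a (rfl | rfl) b hb
      · refine ⟨hb, ?_⟩
        by_cases hbx : b = x
        · subst hbx
          exact hxno a (h.strict a)
        · exact hXu b hb hbx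
      · exact ⟨hxno b hb, hnox b hb⟩
    · rintro w ⟨hw, hwS⟩
      simp only [Set.mem_insert_iff, Set.mem_singleton_iff, not_or] at hwS
      obtain ⟨-, v, hwv, hv, hvu⟩ := hX w hw hwS.1 hwS.2
      have hvx : v ≠ x := fun e => hnox w hw (e ▸ hwv)
      obtain ⟨-, c, hvc, hc, -⟩ := hX v hv hvu hvx
      obtain rfl := hback w v c hw hwS.1 hwS.2 hwv hv hvc hc
      refine ⟨v, ⟨hv, by simp [hvu, hvx]⟩, (h.strict.ne hwv).symm, hvc, fun d hd => ⟨fun hcd =>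
        away_unique h.away_le hcd hd.1 hwv hv, ?_⟩⟩
      rintro rfl
      exact hwv
    · rintro w ⟨hw, hwS⟩
      simp only [Set.mem_insert_iff, Set.mem_singleton_iff, not_or] at hwS
      exact hsX w hw hwS.1 hwS.2
    · by_cases hwz : w' = z
      · left
        rw [hsx, hwz]
      · right
        refine ⟨w', ⟨huw', ?_⟩, hw'u, hsx⟩
        simp only [Set.mem_insert_iff, Set.mem_singleton_iff, not_or]
        refine ⟨?_, hwz⟩
        rintro rfl
        exact h.strict u ((mem_dead.1 hyd).2 u hw'u)
  · right
    obtain ⟨x₁, hx₁⟩ := card_pos.1 (Nat.pos_of_ne_zero hax)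
    rw [mem_away] at hx₁
    obtain ⟨hxx₁, hux₁⟩ := hx₁
    have hzx := hzmiss x x₁ hx hxx₁ hux₁
    have hx₁x : x₁ ≠ x := (h.strict.ne hxx₁).symm
    have hx₁u : x₁ ≠ u := by
      rintro rfl
      -- `z` has maximum out-degree, but smaller in-degree than `u`
      have hout : (outSet D z).card = (outSet D x₁).card := by
        refine le_antisymm (h.le_card z) ?_
        have hsub : insert x₁ ((outSet D x₁).erase z) ⊆ outSet D z := by
          intro b hb
          rw [mem_insert, mem_erase, mem_outSet] at hb
          rw [mem_outSet]
          rcases hb with rfl | hb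
          · exact hzu
          · exact hdom b hb.2 hb.1
        have := card_le_card hsub
        rw [card_insert_of_notMem (by simp [h.strict x₁]),
          card_erase_add_one (mem_outSet.2 huz)] at this
        exact this
      have hin : (inSet D z).card ≤ 2 := by
        refine (card_le_card (t := {y, x₁}) fun v hv => ?_).trans card_le_two
        rw [mem_inSet] at hv
        rw [mem_insert, mem_singleton]
        by_cases huv : D.Adj x₁ v
        · exact Or.inl (h.unique (h.strict.ne huz) huv hv huy hyz)
        · right
          by_contra hvu
          by_cases hvx : v = x
          · subst hvx
            exact (mem_missing.1 hzx).2 hv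
          · have h1 := (hX v huv hvu hvx).1
            have h2 : z ∈ missing D x₁ v := by simp [h1]
            exact (mem_missing.1 h2).2 hv
      have hin' : 3 ≤ (inSet D x₁).card := by
        have hsub : {a₁, a₂, x} ⊆ inSet D x₁ := by
          intro v hv
          simp only [mem_insert, mem_singleton] at hv
          rw [mem_inSet]
          rcases hv with rfl | rfl | rfl
          · exact h.adj₁'
          · exact h.adj₂'
          · exact hxx₁
        have h3 : ({a₁, a₂, x} : Finset V).card = 3 :=
          card_eq_three.2 ⟨a₁, a₂, x, h.ne, fun e => hx (e ▸ h.adj₁), fun e => hx (e ▸ h.adj₂), rfl⟩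
        exact h3 ▸ card_le_card hsub
      have := hmin' z hout ((card_le_card inter_subset_left).trans hin)
      omega
    obtain ⟨-, x₂, hx₁₂, hux₂, hx₂u⟩ := hX x₁ hux₁ hx₁u hx₁x
    have hxin : ∀ w, ¬ D.Adj u w → w ≠ u → D.Adj w x → w = x₁ := by
      intro w hw hwu hwx
      exact (hback w x x₁ hw hwu (h.strict.ne hwx) hwx hx hxx₁ hux₁).symm
    have hnou : ∀ w, ¬ D.Adj u w → ¬ D.Adj w u := by
      intro w hw hwu
      by_cases hwx : w = x
      · subst hwx
        exact hx₁u (away_unique h.away_le hxx₁ hux₁ hwu (h.strict u))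
      · exact hXu w hw hwx hwu
    have hx₂x : x₂ ≠ x := by
      rintro rfl
      -- otherwise all vertices outside `N⁺(u)` other than `u` are on 2-cycles
      refine hheven (even_of_isTwoCycles ?_)
      rintro w ⟨hw, hwu⟩
      simp only [Set.mem_singleton_iff] at hwu
      by_cases hwx : w = x₂
      · subst hwx
        refine ⟨x₁, ⟨hux₁, hx₁u⟩, hx₁x, hx₁₂, fun c hc => ⟨fun hwc =>
          away_unique h.away_le hwc hc.1 hxx₁ hux₁, ?_⟩⟩
        rintro rfl
        exact hxx₁
      · obtain ⟨-, v, hwv, hv, hvu⟩ := hX w hw hwu hwx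
        have hvw : D.Adj v w := by
          by_cases hvx : v = x₂
          · subst hvx
            rw [hxin w hw hwu hwv]
            exact hxx₁
          · obtain ⟨-, c, hvc, hc, -⟩ := hX v hv hvu hvx
            exact hback w v c hw hwu hwx hwv hv hvc hc ▸ hvc
        refine ⟨v, ⟨hv, hvu⟩, (h.strict.ne hwv).symm, hvw, fun d hd => ⟨fun hwd =>
          away_unique h.away_le hwd hd.1 hwv hv, ?_⟩⟩
        rintro rfl
        exact hwv
    have hx₂₁ : D.Adj x₂ x₁ := by
      obtain ⟨-, c, hc1, hc2, -⟩ := hX x₂ hux₂ hx₂u hx₂x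
      exact hback x₁ x₂ c hux₁ hx₁u hx₁x hx₁₂ hux₂ hc1 hc2 ▸ hc1
    have out1 : ∀ c, ¬ D.Adj u c → (D.Adj x c ↔ c = x₁) := fun c hc =>
      ⟨fun e => away_unique h.away_le e hc hxx₁ hux₁, fun e => e ▸ hxx₁⟩
    have out2 : ∀ c, ¬ D.Adj u c → (D.Adj x₁ c ↔ c = x₂) := fun c hc =>
      ⟨fun e => away_unique h.away_le e hc hx₁₂ hux₂, fun e => e ▸ hx₁₂⟩
    have out3 : ∀ c, ¬ D.Adj u c → (D.Adj x₂ c ↔ c = x₁) := fun c hc =>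
      ⟨fun e => away_unique h.away_le e hc hx₂₁ hux₁, fun e => e ▸ hx₂₁⟩
    obtain ⟨p, hup, hpx₂⟩ := h.exists_pred x₂ hux₂ hx₂u
    have hpz : p ≠ z := by
      rintro rfl
      exact hx₂u (away_unique h.away_le hpx₂ hux₂ hzu (h.strict u))
    have hpm : p ∈ missing D u x := by
      rw [mem_missing]
      refine ⟨hup, fun hxp => ?_⟩
      exact hux₁ (h.unique (Ne.symm hx₂x) hxx₁ hx₁₂ hxp hpx₂ ▸ hup)
    have hmx : missing D u x = {z, p} := by
      symm
      refine eq_of_subset_of_card_le ?_ ?_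
      · intro b hb
        rw [mem_insert, mem_singleton] at hb
        rcases hb with rfl | rfl
        · exact hzx
        · exact hpm
      · rw [card_pair hpz.symm]
        exact hm2 x hx
    set C : Set V := ((succSet D u)ᶜ \ {u}) \ {x, x₁, x₂} with hC
    have hCmem : ∀ w, w ∈ C ↔ ¬ D.Adj u w ∧ w ≠ u ∧ w ≠ x ∧ w ≠ x₁ ∧ w ≠ x₂ := by
      intro w
      simp only [hC, Set.mem_sdiff, Set.mem_compl_iff, mem_succSet, Set.mem_singleton_iff,
        Set.mem_insert_iff, not_or]
      tauto
    clear_value C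
    have hC2 : ∀ w ∈ C, ∃ v ∈ C, D.Adj w v ∧ D.Adj v w := by
      intro w hwC
      obtain ⟨hw, hwu, hwx, hwx₁, hwx₂⟩ := (hCmem w).1 hwC
      obtain ⟨-, v, hwv, hv, hvu⟩ := hX w hw hwu hwx
      have hvx : v ≠ x := by
        rintro rfl
        exact hwx₁ (hxin w hw hwu hwv)
      obtain ⟨-, c, hvc, hc, -⟩ := hX v hv hvu hvx
      obtain rfl := hback w v c hw hwu hwx hwv hv hvc hc
      refine ⟨v, (hCmem v).2 ⟨hv, hvu, hvx, ?_, ?_⟩, hwv, hvc⟩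
      · rintro rfl
        exact hwx₂ ((out2 c hc).1 hvc)
      · rintro rfl
        exact hwx₁ ((out3 c hc).1 hvc)
    refine ⟨succSet D u, C, y, z, u, x, x₁, x₂, p, hfirst, hS, ⟨⟨?_, ?_, ?_, ?_, hx₁x.symm,
      hx₂x.symm, h.strict.ne hx₁₂⟩, ?_, ?_, ?_, ?_⟩, ⟨hsz, hsy, hmat⟩, succIn_self, ?_, hup, hpx₂, ?_⟩
    · ext w
      simp only [Set.mem_union, hCmem, Set.mem_singleton_iff, Set.mem_insert_iff,
        Set.mem_compl_iff, mem_succSet]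
      have huu := h.strict u
      constructor
      · rintro ((hw | rfl) | rfl | rfl | rfl)
        · exact hw.1
        all_goals assumption
      · tauto
    · simp [hCmem]
    · rw [Set.disjoint_left]
      intro w hw
      rw [hCmem] at hw
      simp only [Set.mem_insert_iff, Set.mem_singleton_iff, not_or]
      exact hw.2.2
    · simp [hxu.symm, hx₁u.symm, hx₂u.symm]
    · rintro a rfl b hb
      exact ⟨hb, hnou b hb⟩
    · intro a ha b hb
      obtain ⟨v, hvC, hav, -⟩ := hC2 a ha
      obtain ⟨h1, h2, h3, h4, h5⟩ := (hCmem a).1 ha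
      obtain ⟨g1, g2, g3, g4, g5⟩ := (hCmem v).1 hvC
      have huniq : ∀ c, ¬ D.Adj u c → D.Adj a c → c = v := fun c hc hac =>
        away_unique h.away_le hac hc hav g1
      rcases hb with rfl | rfl | rfl
      · exact ⟨fun e => g3 (huniq _ hx e).symm, fun e => h4 ((out1 a h1).1 e)⟩
      · exact ⟨fun e => g4 (huniq _ hux₁ e).symm, fun e => h5 ((out2 a h1).1 e)⟩
      · exact ⟨fun e => g5 (huniq _ hux₂ e).symm, fun e => h4 ((out3 a h1).1 e)⟩
    · intro a ha
      obtain ⟨v, hvC, hav, hva⟩ := hC2 a ha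
      refine ⟨v, hvC, (h.strict.ne hav).symm, hva, fun c hc => ⟨fun hac =>
        away_unique h.away_le hac ((hCmem c).1 hc).1 hav ((hCmem v).1 hvC).1, ?_⟩⟩
      rintro rfl
      exact hav
    · have h12 := h.strict.ne hx₁₂
      rintro a (rfl | rfl | rfl) b hb
      · rw [out1 b (by rcases hb with rfl | rfl | rfl <;> assumption)]
        simp [hx₁x.symm, hx₂x.symm]
      · rw [out2 b (by rcases hb with rfl | rfl | rfl <;> assumption)]
        simp [hx₁x, h12]
      · rw [out3 b (by rcases hb with rfl | rfl | rfl <;> assumption)]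
        simp [hx₂x, h12.symm]
    · rintro w ⟨hw, hwS⟩
      simp only [Set.mem_insert_iff, Set.mem_singleton_iff, not_or] at hwS
      exact hsX w hw hwS.1 hwS.2
    · refine succIn_eq_of_missing fun b => ?_
      rw [hmx]
      simp only [mem_insert, mem_singleton, Set.mem_insert_iff, Set.mem_singleton_iff]
      constructor
      · rintro (rfl | rfl)
        · exact ⟨huz, Or.inl rfl⟩
        · exact ⟨hup, Or.inr rfl⟩
      · exact fun e => e.2

end IsDoubled
end Extremal

/-! ### The upper bound and the extremal structure -/

/-- The value of `ex n`: all `k (n - k)` arcs from `V₁ᶜ` to `V₁`, with `k = |V₁| = ⌊n/2⌋ + 1`, and `n`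
further arcs, or `n + 1` of them if `4 ∣ n`. -/
def exSize (n : ℕ) : ℕ :=
  (n / 2 + 1) * (n - (n / 2 + 1)) + n + if n % 4 = 0 then 1 else 0

section Upper
variable {V : Type*} [Fintype V] [DecidableEq V] {D : Digraph V}

/-- The classes that describe the extremal digraphs of order `n`. -/
def InClasses {V : Type*} (n : ℕ) (D : Digraph V) : Prop :=
  (n % 2 = 1 → ClassD1 D ∨ ClassD2 D) ∧ (n % 4 = 0 → ClassD3 D) ∧
    (n % 4 = 2 → ClassD4 D ∨ ClassD5 D ∨ ClassD6 D ∨ ClassD7 D ∨ ClassD8 D ∨ ClassD9 D ∨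
      ClassD10 D)

theorem sq_add_le_exSize (n : ℕ) (hn : 2 ≤ n) : n ^ 2 + 4 * n ≤ 4 * exSize n + 4 := by
  have h : (n / 2 + 1) * (n - (n / 2 + 1)) + n ≤ exSize n := Nat.le_add_right _ _
  refine le_trans ?_ (Nat.add_le_add_right (Nat.mul_le_mul_left 4 h) 4)
  obtain ⟨m, rfl | rfl⟩ : ∃ m, n = 2 * (m + 1) ∨ n = 2 * m + 1 := ⟨(n - 1) / 2, by omega⟩
  · have e1 : 2 * (m + 1) / 2 + 1 = m + 2 := by omega
    have e2 : 2 * (m + 1) - (m + 2) = m := by omega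
    rw [e1, e2]
    nlinarith
  · have e1 : (2 * m + 1) / 2 + 1 = m + 1 := by omega
    have e2 : 2 * m + 1 - (m + 1) = m := by omega
    rw [e1, e2]
    nlinarith

/-- A vertex of maximum out-degree on the least number of 2-cycles, and of the least in-degree
among those. -/
theorem exists_frame [Nonempty V] (hS : Strict D) (hU : UniqueTwoPaths D) :
    ∃ u, IsFrame D u ∧ (∀ v, (outSet D v).card = (outSet D u).card →
      (inSet D u ∩ outSet D u).card ≤ (inSet D v ∩ outSet D v).card) ∧
      ∀ v, (outSet D v).card = (outSet D u).card →
        (inSet D v ∩ outSet D v).card ≤ (inSet D u ∩ outSet D u).card →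
        (inSet D u).card ≤ (inSet D v).card := by
  obtain ⟨u₀, -, hu₀⟩ := exists_max_image univ (fun v => (outSet D v).card) univ_nonempty
  obtain ⟨u, hu, hmin⟩ := exists_min_image
    (univ.filter fun v => (outSet D v).card = (outSet D u₀).card)
    (fun v => (Fintype.card V + 1) * (inSet D v ∩ outSet D v).card + (inSet D v).card)
    ⟨u₀, by simp⟩
  simp only [mem_filter, mem_univ, true_and] at hu hmin hu₀
  refine ⟨u, ⟨hS, hU, fun v => hu ▸ hu₀ v trivial⟩, fun v hv => ?_, fun v hv hle => ?_⟩
  · have h1 := hmin v (hv.trans hu)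
    have h2 : (inSet D v).card ≤ Fintype.card V := card_le_univ _
    by_contra! hlt
    have := Nat.mul_le_mul_left (Fintype.card V + 1) hlt
    rw [Nat.mul_succ] at this
    omega
  · have h1 := hmin v (hv.trans hu)
    have := Nat.mul_le_mul_left (Fintype.card V + 1) hle
    omega

/-- A digraph with unique 2-paths of size at least `exSize n` whose maximum in-degree is at most its
maximum out-degree has size `exSize n` and belongs to one of the classes. -/
theorem size_eq_and_inClasses (hS : Strict D) (hU : UniqueTwoPaths D) (hn : 13 ≤ Fintype.card V)
    (hio : ∃ v, ∀ w, (inSet D w).card ≤ (outSet D v).card)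
    (he : exSize (Fintype.card V) ≤ size D) :
    size D = exSize (Fintype.card V) ∧ InClasses (Fintype.card V) D := by
  have hne : Nonempty V := Fintype.card_pos_iff.1 (by omega)
  obtain ⟨u, hF, hmin, hmin'⟩ := exists_frame hS hU
  obtain ⟨v, hv⟩ := hio
  obtain ⟨haway, hc2, hk⟩ := hF.local_structure hn
    ((sq_add_le_exSize _ (by omega)).trans (by omega)) fun w => (hv w).trans (hF.le_card v)
  have hcard := hF.card_eq
  have hMc : (outSet D u)ᶜ.card = ((outSet D u)ᶜ.erase u).card + 1 :=
    (card_erase_add_one hF.self_mem_compl).symm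
  have hsize := hF.size_add
  have hdead := hF.card_dead_add haway
  have hk6 : 6 ≤ (outSet D u).card := by omega
  have hfirst : IsFirstPart (succSet D u) := by
    rw [IsFirstPart, ncard_succSet, Nat.card_eq_fintype_card]
    omega
  have hex : exSize (Fintype.card V) = (outSet D u).card * (outSet D u)ᶜ.card + Fintype.card V +
      if Fintype.card V % 4 = 0 then 1 else 0 := by
    unfold exSize
    have e1 : Fintype.card V / 2 + 1 = (outSet D u).card := by omega
    have e2 : Fintype.card V - (outSet D u).card = (outSet D u)ᶜ.card := by omega
    rw [e1, e2]
  have hpredN : (sourcesIn D u (outSet D u)).card = 0 →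
      ∀ b, D.Adj u b → ∃ a, D.Adj u a ∧ D.Adj a b := fun h0 b hb =>
    exists_pred_of_notMem (mem_outSet.2 hb) (by rw [card_eq_zero.1 h0]; simp)
  have hpredM : (sourcesIn D u ((outSet D u)ᶜ.erase u)).card = 0 →
      ∀ b, ¬ D.Adj u b → b ≠ u → ∃ a, D.Adj u a ∧ D.Adj a b := fun h0 b hb hbu =>
    exists_pred_of_notMem (T := (outSet D u)ᶜ.erase u) (by simp [hb, hbu]) (by rw [card_eq_zero.1 h0]; simp)
  have hc : (inSet D u ∩ outSet D u).card = 1 ∨ (inSet D u ∩ outSet D u).card = 2 := by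
    split_ifs at hex <;> omega
  rcases hc with hc | hc
  · have h4 : Fintype.card V % 4 ≠ 0 := by
      intro h4
      rw [if_pos h4] at hex
      omega
    rw [if_neg h4] at hex
    have hN := hpredN (by omega)
    have hM := hpredM (by omega)
    have ht : totalDeficit D u = 0 := by omega
    obtain ⟨a₀, ha₀⟩ := card_eq_one.1 hc
    have hall : ∀ b, ∃ a, (D.Adj u a ∧ D.Adj a b) ∧ ∀ a', D.Adj u a' → D.Adj a' b → a' = a := by
      intro b
      by_cases hbu : b = u
      · subst hbu
        have hmem := fun a => Finset.ext_iff.1 ha₀ a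
        simp only [mem_inter, mem_inSet, mem_outSet, mem_singleton] at hmem
        exact ⟨a₀, ((hmem a₀).2 rfl).symm, fun a h1 h2 => (hmem a).1 ⟨h2, h1⟩⟩
      · obtain ⟨a, h1, h2⟩ : ∃ a, D.Adj u a ∧ D.Adj a b := by
          by_cases hb : D.Adj u b
          · exact hN b hb
          · exact hM b hb hbu
        exact ⟨a, ⟨h1, h2⟩, fun a' h3 h4 => hU (Ne.symm hbu) h3 h4 h1 h2⟩
    choose π hπ hπ' using hall
    have hcov : IsCovered D u π :=
      { hF with
        mem := fun b => (hπ b).1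
        adj := fun b => (hπ b).2
        eq := fun a b h1 h2 => hπ' b a h1 h2
        away_le := haway
        card_missing := fun x hx => by rw [hF.card_missing, deficit_eq_zero ht hx, add_zero]
        six_le := hk6 }
    refine ⟨by omega, fun hodd => hcov.classD1_or_classD2 hfirst (by omega),
      fun h => absurd h h4, fun h2 => ?_⟩
    rcases hcov.class_of_card_dead_eq_two hfirst (by omega) with h | h | h | h | h
    · exact Or.inl h
    · exact Or.inr (Or.inl h)
    · exact Or.inr (Or.inr (Or.inl h))
    · exact Or.inr (Or.inr (Or.inr (Or.inl h)))
    · exact Or.inr (Or.inr (Or.inr (Or.inr (Or.inr (Or.inr h)))))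
  · rw [hc] at hmin hmin'
    have hP1 : (sourcesIn D u (outSet D u)).card +
      (sourcesIn D u ((outSet D u)ᶜ.erase u)).card + totalDeficit D u ≤ 1 := by
      split_ifs at hex <;> omega
    have hp' : (sourcesIn D u ((outSet D u)ᶜ.erase u)).card = 0 := by
      by_contra h0
      obtain ⟨w, hw⟩ := card_pos.1 (Nat.pos_of_ne_zero h0)
      simp only [sourcesIn, mem_filter, mem_erase, mem_compl, mem_outSet, card_eq_zero] at hw
      have hdw : deficit D u w = 0 := deficit_eq_zero (by omega) hw.1.2
      have h1 := hF.le_card w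
      have h2 : 2 ≤ (inSet D w ∩ outSet D w).card := hmin w (by unfold deficit at hdw; omega)
      have h3 := card_inter_le_one_of_source haway (w := w) fun a ha haw => by
        have : a ∈ inSet D w ∩ outSet D u := by simp [ha, haw]
        simp [hw.2] at this
      omega
    have hM := hpredM hp'
    obtain ⟨a₁, a₂, hne12, ha⟩ := card_eq_two.1 hc
    have hmem := fun a => Finset.ext_iff.1 ha a
    simp only [mem_inter, mem_inSet, mem_outSet, mem_insert, mem_singleton] at hmem
    have hdbl : IsDoubled D u a₁ a₂ :=
      { hF with
        away_le := haway
        six_le := hk6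
        ne := hne12
        adj₁ := ((hmem a₁).2 (Or.inl rfl)).2
        adj₁' := ((hmem a₁).2 (Or.inl rfl)).1
        adj₂ := ((hmem a₂).2 (Or.inr rfl)).2
        adj₂' := ((hmem a₂).2 (Or.inr rfl)).1
        eq_or_eq := fun a h1 h2 => (hmem a).1 ⟨h2, h1⟩
        exists_pred := hM }
    by_cases hP0 : (sourcesIn D u (outSet D u)).card + totalDeficit D u = 0
    · obtain ⟨h3, hk3, heven⟩ := hdbl.classD3_of_deficit hfirst (by omega) (hpredN (by omega))
        (by omega) (by omega) (by omega) (by omega)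
      have h4 : Fintype.card V % 4 = 0 := by
        obtain ⟨r, hr⟩ := heven
        omega
      rw [if_pos h4] at hex
      exact ⟨by omega, fun h => by omega, fun _ => h3, fun h => by omega⟩
    · have h4 : Fintype.card V % 4 ≠ 0 := by
        intro h4
        rw [if_pos h4] at hex
        omega
      rw [if_neg h4] at hex
      have hodd : (outSet D u).card = ((outSet D u)ᶜ.erase u).card + 3 →
          ¬ Even ((outSet D u)ᶜ.erase u).card := by
        rintro h3 ⟨r, hr⟩
        omega
      by_cases ht : totalDeficit D u = 0
      · exfalso
        obtain ⟨n₀, hn₀⟩ := card_eq_one.1 (show (sourcesIn D u (outSet D u)).card = 1 by omega)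
        have hn₀' : n₀ ∈ sourcesIn D u (outSet D u) := by simp [hn₀]
        simp only [sourcesIn, mem_filter, mem_outSet, card_eq_zero] at hn₀'
        refine hdbl.false_of_source hmin ht hn₀'.1 (fun a h1 h2 => ?_) (fun b hb hbn => ?_) hodd
          (by omega) (by omega) (by omega)
        · have : a ∈ inSet D n₀ ∩ outSet D u := by simp [h1, h2]
          simp [hn₀'.2] at this
        · exact exists_pred_of_notMem (mem_outSet.2 hb) (by rw [hn₀]; simpa using hbn)
      · obtain ⟨x, hx, hdx⟩ : ∃ x ∈ (outSet D u)ᶜ, deficit D u x ≠ 0 := by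
          by_contra! h0
          exact ht (sum_eq_zero h0)
        have hsum : deficit D u x + ∑ w ∈ (outSet D u)ᶜ.erase x, deficit D u w =
          totalDeficit D u := add_sum_erase _ _ hx
        have hrest := sum_eq_zero_iff.1
          (show ∑ w ∈ (outSet D u)ᶜ.erase x, deficit D u w = 0 by omega)
        obtain ⟨h89, hk3⟩ := hdbl.classD8_or_classD9 hmin hmin' hfirst (x := x) (by simpa using hx)
          (by omega) (fun w hw hwx => hrest w (by simp [hw, hwx])) (hpredN (by omega)) hodd
          (by omega) (by omega) (by omega)
        refine ⟨by omega, fun h => by omega, fun h => absurd h h4, fun _ => ?_⟩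
        rcases h89 with h8 | h9
        · exact Or.inr (Or.inr (Or.inr (Or.inr (Or.inl h8))))
        · exact Or.inr (Or.inr (Or.inr (Or.inr (Or.inr (Or.inl h9)))))

/-- The upper bound and the structure of the digraphs attaining it, up to reversal. -/
theorem size_eq_and_inClasses_or_reverse (hS : Strict D) (hU : UniqueTwoPaths D)
    (hn : 13 ≤ Fintype.card V) (he : exSize (Fintype.card V) ≤ size D) :
    size D = exSize (Fintype.card V) ∧
      (InClasses (Fintype.card V) D ∨ InClasses (Fintype.card V) (reverse D)) := by
  have hne : Nonempty V := Fintype.card_pos_iff.1 (by omega)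
  obtain ⟨v, -, hv⟩ := exists_max_image univ (fun v => (outSet D v).card) univ_nonempty
  obtain ⟨w, -, hw⟩ := exists_max_image univ (fun v => (inSet D v).card) univ_nonempty
  rcases le_total (inSet D w).card (outSet D v).card with h | h
  · obtain ⟨h1, h2⟩ := size_eq_and_inClasses hS hU hn
      ⟨v, fun x => (hw x (mem_univ x)).trans h⟩ he
    exact ⟨h1, Or.inl h2⟩
  · obtain ⟨h1, h2⟩ := size_eq_and_inClasses (D := reverse D) hS.reverse hU.reverse hn
      ⟨w, fun x => by
        rw [outSet_reverse, inSet_reverse]; exact (hv x (mem_univ x)).trans h⟩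
      (by rwa [size_reverse])
    exact ⟨by rwa [size_reverse] at h1, Or.inr h2⟩

end Upper

/-! ### Induced subdigraphs on `V₁` -/

section Parts
variable {V : Type*} {D : Digraph V}

/-- `D(X)` has no loops, every vertex of `X` has exactly one predecessor in `X`, and the 2-paths of
`D(X)` that are not part of a 2-cycle start in `Q`. -/
structure IsGoodPart (D : Digraph V) (X Q : Set V) : Prop where
  irrefl : ∀ a ∈ X, ¬ D.Adj a a
  pred : ∀ b ∈ X, ∃! a, a ∈ X ∧ D.Adj a b
  start : ∀ a ∈ X, ∀ b ∈ X, ∀ d ∈ X, D.Adj a b → D.Adj b d → a ≠ d → a ∈ Q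

theorem IsGoodPart.mono {X Q Q' : Set V} (h : IsGoodPart D X Q) (hQ : Q ⊆ Q') :
    IsGoodPart D X Q' :=
  ⟨h.irrefl, h.pred, fun a ha b hb d hd h1 h2 h3 => hQ (h.start a ha b hb d hd h1 h2 h3)⟩

theorem IsGoodPart.union {A C Q : Set V} (hA : IsGoodPart D A Q) (hC : IsGoodPart D C Q)
    (hAC : NoArcsBetween D A C) : IsGoodPart D (A ∪ C) Q where
  irrefl := by
    rintro a (ha | ha)
    · exact hA.irrefl a ha
    · exact hC.irrefl a ha
  pred := by
    rintro b (hb | hb)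
    · obtain ⟨a, ⟨ha, hab⟩, hu⟩ := hA.pred b hb
      refine ⟨a, ⟨Or.inl ha, hab⟩, ?_⟩
      rintro c ⟨hc | hc, hcb⟩
      · exact hu c ⟨hc, hcb⟩
      · exact absurd hcb (hAC b hb c hc).2
    · obtain ⟨a, ⟨ha, hab⟩, hu⟩ := hC.pred b hb
      refine ⟨a, ⟨Or.inr ha, hab⟩, ?_⟩
      rintro c ⟨hc | hc, hcb⟩
      · exact absurd hcb (hAC c hc b hb).1
      · exact hu c ⟨hc, hcb⟩
  start := by
    rintro a (ha | ha) b (hb | hb) d (hd | hd) hab hbd had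
    · exact hA.start a ha b hb d hd hab hbd had
    · exact absurd hbd (hAC b hb d hd).1
    · exact absurd hab (hAC a ha b hb).1
    · exact absurd hab (hAC a ha b hb).1
    · exact absurd hab (hAC b hb a ha).2
    · exact absurd hab (hAC b hb a ha).2
    · exact absurd hbd (hAC d hd b hb).2
    · exact hC.start a ha b hb d hd hab hbd had

theorem IsTwoCycles.isGoodPart {X : Set V} (h : IsTwoCycles D X) (Q : Set V) :
    IsGoodPart D X Q where
  irrefl a ha haa := by
    obtain ⟨b, hb, hba, -, huniq⟩ := h a ha
    exact hba ((huniq a ha).1 haa).symm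
  pred b hb := by
    obtain ⟨a, ha, -, hab, huniq⟩ := h b hb
    refine ⟨a, ⟨ha, hab⟩, ?_⟩
    rintro c ⟨hc, hcb⟩
    obtain ⟨d, hd, -, hdc, huniq'⟩ := h c hc
    obtain rfl := (huniq' b hb).1 hcb
    exact (huniq c hc).1 hdc
  start a ha b hb d hd hab hbd had := by
    exfalso
    obtain ⟨c, hc, -, hca, huniq⟩ := h a ha
    obtain rfl := (huniq b hb).1 hab
    obtain ⟨e, he, -, -, huniq'⟩ := h b hb
    exact had (((huniq' a ha).1 hca).trans ((huniq' d hd).1 hbd).symm)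

theorem IsS.isGoodPart {X : Set V} {y z : V} (h : IsS D X y z) : IsGoodPart D X {y} := by
  obtain ⟨hy, hz, hyz, hadj⟩ := h
  refine ⟨fun a ha => ?_, fun b hb => ?_, fun a ha b hb d hd => ?_⟩
  · rw [hadj a ha a ha]
    rintro (⟨rfl, h⟩ | ⟨rfl, h⟩)
    · exact hyz h
    · exact h rfl
  · by_cases hbz : b = z
    · subst hbz
      refine ⟨y, ⟨hy, (hadj y hy b hb).2 (Or.inl ⟨rfl, rfl⟩)⟩, ?_⟩
      rintro c ⟨hc, hcb⟩
      rcases (hadj c hc b hb).1 hcb with h | h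
      · exact h.1
      · exact absurd rfl h.2
    · refine ⟨z, ⟨hz, (hadj z hz b hb).2 (Or.inr ⟨rfl, hbz⟩)⟩, ?_⟩
      rintro c ⟨hc, hcb⟩
      rcases (hadj c hc b hb).1 hcb with h | h
      · exact absurd h.2 hbz
      · exact h.1
  · rw [hadj a ha b hb, hadj b hb d hd]
    rintro (⟨h1, h2⟩ | ⟨h1, h2⟩) (⟨h3, h4⟩ | ⟨h3, h4⟩) had
    · exact h1
    · exact h1
    · exact absurd (h1.trans h4.symm) had
    · exact absurd h3 h2

theorem IsSWithTwoCycles.isGoodPart {X : Set V} {y z : V} (h : IsSWithTwoCycles D X y z) :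
    IsGoodPart D X {y} := by
  obtain ⟨A, C, rfl, -, hAC, hS, hC⟩ := h
  exact hS.isGoodPart.union (hC.isGoodPart _) hAC

theorem IsSWithTwoCycles.mem {X : Set V} {y z : V} (h : IsSWithTwoCycles D X y z) :
    y ∈ X ∧ z ∈ X ∧ y ≠ z := by
  obtain ⟨A, C, rfl, -, -, hS, -⟩ := h
  exact ⟨Or.inl hS.1, Or.inl hS.2.1, hS.2.2.1⟩

section Arborescence
variable {A : Set V} {r : V}

theorem reflTransGen_of_isChain {R : V → V → Prop} {w : V} (l : List V) : ∀ u : V,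
    (u :: l).IsChain R → (u :: l).getLast? = some w → ∀ v ∈ u :: l, Relation.ReflTransGen R v w := by
  induction l with
  | nil =>
    intro u _ hl v hv
    simp only [List.getLast?_singleton, Option.some.injEq] at hl
    simp only [List.mem_singleton] at hv
    rw [hv, hl]
  | cons b l ih =>
    intro u hc hl v hv
    rw [List.isChain_cons_cons] at hc
    rw [List.getLast?_cons_cons] at hl
    rcases List.mem_cons.1 hv with rfl | hv
    · exact Relation.ReflTransGen.head hc.1 (ih b hc.2 hl b (List.mem_cons_self ..))
    · exact ih b hc.2 hl v hv

theorem IsPathIn.append {a w : V} {l : List V} (hacyc : ∀ a, ¬ Relation.TransGen (arcsIn D A) a a)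
    (h : IsPathIn D A r a l) (haw : arcsIn D A a w) : IsPathIn D A r w (l ++ [w]) := by
  obtain ⟨hc, hn, hl⟩ := h
  refine ⟨?_, ?_, ?_⟩
  · rw [← List.cons_append, List.isChain_append]
    refine ⟨hc, by simp, ?_⟩
    intro x hx y hy
    rw [hl] at hx
    simp only [Option.mem_def, Option.some.injEq, List.head?_cons] at hx hy
    rwa [← hx, ← hy]
  · rw [← List.cons_append, List.nodup_append]
    refine ⟨hn, by simp, ?_⟩
    intro x hx y hy
    simp only [List.mem_singleton] at hy
    rw [hy]
    rintro rfl
    exact hacyc x (Relation.TransGen.tail' (reflTransGen_of_isChain l r hc hl x hx) haw)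
  · rw [← List.cons_append, List.getLast?_append]
    simp

theorem IsArborescence.not_adj_root (h : IsArborescence D 2 A r) {a : V} (ha : a ∈ A) :
    ¬ D.Adj a r := by
  intro har
  obtain ⟨hr, hacyc, hex, -⟩ := h
  by_cases e : a = r
  · subst e
    exact hacyc a (Relation.TransGen.single ⟨hr, hr, har⟩)
  · obtain ⟨l, hl, -⟩ := hex a ha e
    exact hacyc r (Relation.TransGen.tail'
      (reflTransGen_of_isChain l r hl.1 hl.2.2 r (List.mem_cons_self ..)) ⟨ha, hr, har⟩)

theorem IsArborescence.existsUnique_pred (h : IsArborescence D 2 A r) {b : V} (hb : b ∈ A)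
    (hbr : b ≠ r) : ∃! a, a ∈ A ∧ D.Adj a b := by
  obtain ⟨hr, hacyc, hex, -⟩ := h
  have hpath : ∀ a ∈ A, ∃ l, IsPathIn D A r a l := by
    intro a ha
    by_cases e : a = r
    · exact ⟨[], by simp [IsPathIn, e]⟩
    · obtain ⟨l, hl, -⟩ := hex a ha e
      exact ⟨l, hl⟩
  obtain ⟨l, hl, huniq⟩ := hex b hb hbr
  obtain ⟨a, hab⟩ : ∃ a, arcsIn D A a b := by
    have := reflTransGen_of_isChain l r hl.1 hl.2.2 r (List.mem_cons_self ..)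
    rcases Relation.ReflTransGen.cases_tail this with e | ⟨a, -, h⟩
    · exact absurd e hbr
    · exact ⟨a, h⟩
  refine ⟨a, ⟨hab.1, hab.2.2⟩, ?_⟩
  rintro c ⟨hc, hcb⟩
  obtain ⟨l₁, h₁⟩ := hpath a hab.1
  obtain ⟨l₂, h₂⟩ := hpath c hc
  have e := (huniq _ (h₁.append hacyc hab)).trans (huniq _ (h₂.append hacyc ⟨hc, hb, hcb⟩)).symm
  have e' := List.append_cancel_right e
  have h3 := h₁.2.2
  have h4 := h₂.2.2
  rw [e', h4] at h3
  exact Option.some.inj h3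

theorem IsArborescence.eq_root (h : IsArborescence D 2 A r) {a b d : V} (ha : a ∈ A) (hb : b ∈ A)
    (hd : d ∈ A) (hab : D.Adj a b) (hbd : D.Adj b d) : a = r := by
  obtain ⟨hr, hacyc, hex, hlen⟩ := h
  by_contra e
  obtain ⟨l, hl, -⟩ := hex a ha e
  have h1 := (hl.append hacyc ⟨ha, hb, hab⟩).append hacyc ⟨hb, hd, hbd⟩
  have h2 := hlen d hd _ h1
  have h3 : l ≠ [] := by
    rintro rfl
    have := hl.2.2
    simp only [List.getLast?_singleton, Option.some.injEq] at this
    exact e this.symm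
  have := List.length_pos_iff.2 h3
  simp only [List.length_append, List.length_cons, List.length_nil] at h2
  omega

end Arborescence

theorem IsT.mem {X : Set V} {x y : V} (h : IsT D X x y) : x ∈ X ∧ y ∈ X ∧ x ≠ y := by
  obtain ⟨A, B, rfl, hAB, hA, hB, -⟩ := h
  exact ⟨Or.inl hA.1, Or.inr hB.1, fun e => Set.disjoint_left.1 hAB hA.1 (e ▸ hB.1)⟩

theorem IsT.isGoodPart {X : Set V} {x y : V} (h : IsT D X x y) : IsGoodPart D X {x, y} := by
  obtain ⟨A, B, rfl, hAB, hA, hB, hcross⟩ := h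
  have hx := hA.1
  have hy := hB.1
  refine ⟨?_, ?_, ?_⟩
  · rintro a (ha | ha) haa
    · exact hA.2.1 a (Relation.TransGen.single ⟨ha, ha, haa⟩)
    · exact hB.2.1 a (Relation.TransGen.single ⟨ha, ha, haa⟩)
  · rintro b (hb | hb)
    · by_cases e : b = x
      · subst e
        refine ⟨y, ⟨Or.inr hy, (hcross b hx y hy).2.2 ⟨rfl, rfl⟩⟩, ?_⟩
        rintro c ⟨hc | hc, hcb⟩
        · exact absurd hcb (hA.not_adj_root hc)
        · exact ((hcross b hx c hc).2.1 hcb).2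
      · obtain ⟨a, ⟨ha, hab⟩, huniq⟩ := hA.existsUnique_pred hb e
        refine ⟨a, ⟨Or.inl ha, hab⟩, ?_⟩
        rintro c ⟨hc | hc, hcb⟩
        · exact huniq c ⟨hc, hcb⟩
        · exact absurd ((hcross b hb c hc).2.1 hcb).1 e
    · by_cases e : b = y
      · subst e
        refine ⟨x, ⟨Or.inl hx, (hcross x hx b hy).1.2 ⟨rfl, rfl⟩⟩, ?_⟩
        rintro c ⟨hc | hc, hcb⟩
        · exact ((hcross c hc b hb).1.1 hcb).1
        · exact absurd hcb (hB.not_adj_root hc)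
      · obtain ⟨a, ⟨ha, hab⟩, huniq⟩ := hB.existsUnique_pred hb e
        refine ⟨a, ⟨Or.inr ha, hab⟩, ?_⟩
        rintro c ⟨hc | hc, hcb⟩
        · exact absurd ((hcross c hc b hb).1.1 hcb).2 e
        · exact huniq c ⟨hc, hcb⟩
  · rintro a (ha | ha) b (hb | hb) d (hd | hd) hab hbd -
    · exact Or.inl (hA.eq_root ha hb hd hab hbd)
    · have := ((hcross b hb d hd).1.1 hbd).1
      exact absurd (this ▸ hab) (hA.not_adj_root ha)
    · exact Or.inl ((hcross a ha b hb).1.1 hab).1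
    · exact Or.inl ((hcross a ha b hb).1.1 hab).1
    · exact Or.inr ((hcross b hb a ha).2.1 hab).2
    · exact Or.inr ((hcross b hb a ha).2.1 hab).2
    · have := ((hcross d hd b hb).2.1 hbd).2
      exact absurd (this ▸ hab) (hB.not_adj_root ha)
    · exact Or.inr (hB.eq_root ha hb hd hab hbd)

end Parts

/-! ### The classes are optimal: empty complement, or a star and 2-cycles -/

section Layout
variable {V : Type*} {D : Digraph V} {V₁ Q : Set V}

/-- The 2-paths between two distinct vertices are unique if they are so for each of the possible
positions of the middle vertices relative to `V₁`. -/
theorem uniqueTwoPaths_of_layout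
    (hout : ∀ p x y, x ∉ V₁ → y ∉ V₁ → D.Adj p x → D.Adj p y → x = y)
    (hin : ∀ a b d, a ∈ V₁ → b ∈ V₁ → d ∈ V₁ → D.Adj a d → D.Adj b d → a = b)
    (hin' : ∀ p a b w, a ∈ V₁ → b ∈ V₁ → w ∉ V₁ → p ≠ w → D.Adj p a → D.Adj a w → D.Adj p b →
      D.Adj b w → a = b)
    (hmix : ∀ p a x d, a ∈ V₁ → x ∉ V₁ → d ∈ V₁ → p ≠ d → D.Adj p a → D.Adj a d → D.Adj p x →
      ¬ D.Adj x d)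
    (hmix' : ∀ p a x w, a ∈ V₁ → x ∉ V₁ → w ∉ V₁ → p ≠ w → D.Adj p a → D.Adj a w → D.Adj p x →
      ¬ D.Adj x w) : UniqueTwoPaths D := by
  intro p a b q hpq hpa haq hpb hbq
  by_cases ha : a ∈ V₁ <;> by_cases hb : b ∈ V₁ <;> by_cases hq : q ∈ V₁
  · exact hin a b q ha hb hq haq hbq
  · exact hin' p a b q ha hb hq hpq hpa haq hpb hbq
  · exact absurd hbq (hmix p a b q ha hb hq hpq hpa haq hpb)
  · exact absurd hbq (hmix' p a b q ha hb hq hpq hpa haq hpb)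
  · exact absurd haq (hmix p b a q hb ha hq hpq hpb hbq hpa)
  · exact absurd haq (hmix' p b a q hb ha hq hpq hpb hbq hpa)
  · exact hout p a b ha hb hpa hpb
  · exact hout p a b ha hb hpa hpb

theorem ncard_eq_one_of_existsUnique {X : Set V} {a : V} (h : ∃! w, w ∈ X ∧ D.Adj a w) :
    (succIn D X a).ncard = 1 := by
  obtain ⟨w, hw, hu⟩ := h
  rw [Set.ncard_eq_one]
  exact ⟨w, Set.eq_singleton_iff_unique_mem.2 ⟨hw, hu⟩⟩

open Finset in
/-- The size of a digraph in which every vertex of `V₁` has one predecessor in `V₁`, every vertex of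
`V₁ \ Q` one successor outside `V₁`, and those of `Q` none. -/
theorem size_of_layout [Fintype V] (hQ : Q ⊆ V₁)
    (hN : ∀ b ∈ V₁, ∃! a, a ∈ V₁ ∧ D.Adj a b)
    (hM : ∀ a ∈ V₁ \ Q, ∃! w, w ∈ V₁ᶜ ∧ D.Adj a w)
    (hQ0 : ∀ a ∈ Q, succIn D V₁ᶜ a = ∅) (S : Set V) (hS : S ⊆ V₁ᶜ)
    (hx : ∀ x ∈ V₁ᶜ \ S, (succIn D V₁ x).ncard + (succIn D V₁ᶜ x).ncard = V₁.ncard)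
    (hx' : ∀ x ∈ S, (succIn D V₁ x).ncard + (succIn D V₁ᶜ x).ncard + 1 = V₁.ncard) :
    size D + Q.ncard + S.ncard = 2 * V₁.ncard + V₁ᶜ.ncard * V₁.ncard := by
  classical
  obtain ⟨F, rfl⟩ : ∃ F : Finset V, V₁ = F := ⟨V₁.toFinset, by simp⟩
  obtain ⟨P, rfl⟩ : ∃ P : Finset V, Q = P := ⟨Q.toFinset, by simp⟩
  obtain ⟨T, rfl⟩ : ∃ T : Finset V, S = T := ⟨S.toFinset, by simp⟩
  have hcoe : ∀ x, (outSet D x).card =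
      (succIn D (F : Set V) x).ncard + (succIn D (F : Set V)ᶜ x).ncard := by
    intro x
    have e1 : succIn D (F : Set V) x = ((outSet D x ∩ F : Finset V) : Set V) := by
      ext; simp [succIn, and_comm]
    have e2 : succIn D (F : Set V)ᶜ x = ((outSet D x \ F : Finset V) : Set V) := by
      ext; simp [succIn, and_comm]
    rw [e1, e2, Set.ncard_coe_finset, Set.ncard_coe_finset, card_inter_add_card_sdiff]
  have hin : ∀ b ∈ F, (inSet D b ∩ F).card = 1 := by
    intro b hb
    obtain ⟨a, ⟨ha, hab⟩, hu⟩ := hN b hb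
    rw [card_eq_one]
    refine ⟨a, eq_singleton_iff_unique_mem.2 ⟨by simpa using ⟨hab, ha⟩, fun c hc => ?_⟩⟩
    rw [mem_inter, mem_inSet] at hc
    exact hu c ⟨hc.2, hc.1⟩
  have hout : ∀ a, (outSet D a ∩ Fᶜ).card = (succIn D (F : Set V)ᶜ a).ncard := by
    intro a
    rw [← Set.ncard_coe_finset]
    congr 1
    ext; simp [succIn, and_comm]
  have h1 : ∑ b ∈ F, (inSet D b ∩ F).card = F.card := by
    rw [sum_congr rfl hin, card_eq_sum_ones]
  have h2 : ∑ b ∈ Fᶜ, (inSet D b ∩ F).card + P.card = F.card := by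
    rw [← sum_card_outSet_inter, ← sum_sdiff (coe_subset.1 hQ), ← card_sdiff_add_card_eq_card
      (coe_subset.1 hQ), card_eq_sum_ones (F \ P)]
    congr 1
    have e1 : ∑ a ∈ P, (outSet D a ∩ Fᶜ).card = 0 := sum_eq_zero fun a ha => by
      rw [hout, hQ0 a ha, Set.ncard_empty]
    rw [e1, add_zero]
    refine sum_congr rfl fun a ha => ?_
    rw [hout]
    exact ncard_eq_one_of_existsUnique (hM a (by simpa using ha))
  have hT : T ⊆ Fᶜ := by
    intro x hx
    have := hS hx
    simpa using this
  have h3 : ∑ x ∈ Fᶜ, (outSet D x).card + T.card = Fᶜ.card * F.card := by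
    rw [← sum_sdiff hT, ← card_sdiff_add_card_eq_card hT, add_mul, ← smul_eq_mul, ← smul_eq_mul,
      ← sum_const, ← sum_const, card_eq_sum_ones T, add_assoc, ← sum_add_distrib]
    congr 1
    · refine sum_congr rfl fun x hxT => ?_
      rw [hcoe, hx _ (by simpa using hxT), Set.ncard_coe_finset]
    · refine sum_congr rfl fun x hxT => ?_
      rw [hcoe, hx' _ (by simpa using hxT), Set.ncard_coe_finset]
  have hc : (F : Set V)ᶜ.ncard = Fᶜ.card := by
    rw [← coe_compl, Set.ncard_coe_finset]
  rw [size_eq_of_split F, Set.ncard_coe_finset, Set.ncard_coe_finset, Set.ncard_coe_finset, hc]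
  omega

/-- `D` is strict with unique 2-paths, and has the size given by `exSize`. -/
def IsOptimal [Fintype V] (D : Digraph V) : Prop :=
  Strict D ∧ UniqueTwoPaths D ∧ size D = exSize (Fintype.card V)

/-- With `|V₁| = ⌊n/2⌋ + 1`, the size given by `size_of_layout` is `exSize n` if the two defects add up
to the number belonging to the residue of `n` modulo 4. -/
theorem size_eq_exSize [Fintype V] (hfirst : IsFirstPart V₁) {q s : ℕ}
    (h : size D + q + s = 2 * V₁.ncard + V₁ᶜ.ncard * V₁.ncard)
    (hq : q + s = if Fintype.card V % 2 = 1 then 1 else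
      if Fintype.card V % 4 = 0 then 1 else 2) :
    size D = exSize (Fintype.card V) := by
  have h1 := Set.ncard_add_ncard_compl V₁
  unfold IsFirstPart at hfirst
  rw [Nat.card_eq_fintype_card] at hfirst h1
  have h2 : V₁ᶜ.ncard = Fintype.card V - (Fintype.card V / 2 + 1) := by omega
  rw [hfirst, h2, mul_comm (Fintype.card V - _)] at h
  unfold exSize
  rw [h2, hfirst] at h1
  split_ifs at hq ⊢ <;> omega

/-- The digraphs with no arcs outside `V₁`. -/
theorem isOptimal_of_isEmptyOn [Fintype V] (hfirst : IsFirstPart V₁) (hQ : Q ⊆ V₁)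
    (hgood : IsGoodPart D V₁ Q) (hempty : IsEmptyOn D V₁ᶜ) (hmatch : Matches D (V₁ \ Q) V₁ᶜ)
    (hQ0 : ∀ a ∈ Q, succIn D V₁ᶜ a = ∅) (hall : ∀ u ∈ V₁ᶜ, succIn D V₁ u = V₁)
    (hq : Q.ncard = if Fintype.card V % 2 = 1 then 1 else
      if Fintype.card V % 4 = 0 then 1 else 2) : IsOptimal D := by
  have hnQ : ∀ a w, w ∉ V₁ → D.Adj a w → a ∉ Q := by
    intro a w hw haw ha
    have : w ∈ succIn D V₁ᶜ a := ⟨hw, haw⟩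
    rw [hQ0 a ha] at this
    exact this
  refine ⟨fun a => ?_, ?_, ?_⟩
  · by_cases ha : a ∈ V₁
    · exact hgood.irrefl a ha
    · exact hempty a ha a ha
  · apply uniqueTwoPaths_of_layout (V₁ := V₁)
    · intro p x y hx hy hpx hpy
      by_cases hp : p ∈ V₁
      · exact (hmatch.1 p ⟨hp, hnQ p x hx hpx⟩).unique ⟨hx, hpx⟩ ⟨hy, hpy⟩
      · exact absurd hpx (hempty p hp x hx)
    · exact fun a b d ha hb hd had hbd => (hgood.pred d hd).unique ⟨ha, had⟩ ⟨hb, hbd⟩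
    · exact fun p a b w ha hb hw _ _ haw _ hbw => (hmatch.2 w hw).unique
        ⟨⟨ha, hnQ a w hw haw⟩, haw⟩ ⟨⟨hb, hnQ b w hw hbw⟩, hbw⟩
    · intro p a x d ha hx hd hpd hpa had hpx _
      by_cases hp : p ∈ V₁
      · exact hnQ p x hx hpx (hgood.start p hp a ha d hd hpa had hpd)
      · exact hempty p hp x hx hpx
    · exact fun p a x w _ hx hw _ _ _ _ => hempty x hx w hw
  · have h := size_of_layout (D := D) hQ hgood.pred hmatch.1 hQ0 ∅ (Set.empty_subset _)
      (fun x hx => by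
        have : succIn D V₁ᶜ x = ∅ := by
          ext w
          simp only [succIn, Set.mem_ofPred_eq, Set.mem_empty_iff_false, iff_false, not_and]
          exact hempty x hx.1 w
        rw [hall x hx.1, this, Set.ncard_empty, add_zero]) (fun x hx => absurd hx (by simp))
    exact size_eq_exSize hfirst h (by rw [Set.ncard_empty, add_zero, hq])

theorem ClassD1.isOptimal [Fintype V] (h : ClassD1 D) (hn : Fintype.card V % 2 = 1) :
    IsOptimal D := by
  obtain ⟨V₁, y, z, hfirst, hS, hempty, ⟨hmatch, hy⟩, hall⟩ := h
  refine isOptimal_of_isEmptyOn hfirst ?_ hS.isGoodPart hempty hmatch ?_ hall (by simp [hn])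
  · simpa using hS.mem.1
  · rintro a rfl
    exact hy

theorem ClassD4.isOptimal [Fintype V] (h : ClassD4 D) (hn : Fintype.card V % 4 = 2) :
    IsOptimal D := by
  obtain ⟨V₁, A, C, y₁, y₂, hfirst, ⟨rfl, -, hAC, hT, hC⟩, hempty, ⟨hmatch, h1, h2⟩, hall⟩ := h
  obtain ⟨m1, m2, hne⟩ := hT.mem
  refine isOptimal_of_isEmptyOn hfirst ?_ (hT.isGoodPart.union (hC.isGoodPart _) hAC) hempty hmatch
    ?_ hall ?_
  · rintro a (rfl | rfl)
    · exact Or.inl m1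
    · exact Or.inl m2
  · rintro a (rfl | rfl) <;> assumption
  · rw [Set.ncard_pair hne, if_neg (by omega), if_neg (by omega)]

theorem ClassD5.isOptimal [Fintype V] (h : ClassD5 D) (hn : Fintype.card V % 4 = 2) :
    IsOptimal D := by
  obtain ⟨V₁, A, B, C, y₁, z₁, y₂, z₂, hfirst, ⟨rfl, hABd, -, -, hAB, hAC, hBC, hA, hB, hC⟩, hempty,
    ⟨hmatch, h1, h2⟩, hall⟩ := h
  have hne : y₁ ≠ y₂ := fun e => Set.disjoint_left.1 hABd hA.1 (e ▸ hB.1)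
  refine isOptimal_of_isEmptyOn hfirst ?_ (((hA.isGoodPart.mono (by simp)).union
    (hB.isGoodPart.mono (by simp)) hAB).union (hC.isGoodPart _) ?_) hempty hmatch ?_ hall ?_
  · rintro a (rfl | rfl)
    · exact Or.inl (Or.inl hA.1)
    · exact Or.inl (Or.inr hB.1)
  · rintro a (ha | ha) b hb
    · exact hAC a ha b hb
    · exact hBC a ha b hb
  · rintro a (rfl | rfl) <;> assumption
  · rw [Set.ncard_pair hne, if_neg (by omega), if_neg (by omega)]

theorem ClassD10.isOptimal [Fintype V] (h : ClassD10 D) (hn : Fintype.card V % 4 = 2) :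
    IsOptimal D := by
  obtain ⟨V₁, y, z, w, hfirst, hS, hempty, ⟨⟨hw, hwyz⟩, hmatch, h1, h2⟩, hall⟩ := h
  simp only [Set.mem_insert_iff, Set.mem_singleton_iff, not_or] at hwyz
  refine isOptimal_of_isEmptyOn hfirst ?_ (hS.isGoodPart.mono (by simp)) hempty hmatch ?_ hall ?_
  · rintro a (rfl | rfl)
    · exact hS.mem.1
    · exact hw
  · rintro a (rfl | rfl) <;> assumption
  · rw [Set.ncard_pair (Ne.symm hwyz.1), if_neg (by omega), if_neg (by omega)]

/-- The digraphs with `D(V₁) = S(y, z)`. -/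
theorem isOptimal_of_isS [Fintype V] {y z : V} (hfirst : IsFirstPart V₁) (hS : IsS D V₁ y z)
    (hQ : Q ⊆ V₁) (hM : ∀ a ∈ V₁ \ Q, ∃! w, w ∈ V₁ᶜ ∧ D.Adj a w)
    (hQ0 : ∀ a ∈ Q, succIn D V₁ᶜ a = ∅) (hy : succIn D V₁ᶜ y = ∅)
    (hirr : ∀ x ∉ V₁, ¬ D.Adj x x)
    (hout : ∀ p x w, p ∉ V₁ → x ∉ V₁ → w ∉ V₁ → D.Adj p x → D.Adj p w → x = w)
    -- Vertices outside `V₁` have one predecessor in `V₁` other than `z`.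
    (hpred : ∀ a b w, a ∈ V₁ → b ∈ V₁ → w ∉ V₁ → a ≠ z → b ≠ z → D.Adj a w → D.Adj b w → a = b)
    (hpredz : ∀ p b w, p ∉ V₁ → b ∈ V₁ → w ∉ V₁ → p ≠ w → b ≠ z → D.Adj p z → D.Adj z w →
      D.Adj p b → ¬ D.Adj b w)
    (hmiss : ∀ p x, p ∉ V₁ → x ∉ V₁ → D.Adj p x → ¬ D.Adj p z ∧ ¬ D.Adj x z)
    (hzout : ∀ x w, x ∉ V₁ → w ∉ V₁ → D.Adj z x → ¬ D.Adj x w)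
    (hsq : ∀ p a x w, p ∉ V₁ → a ∈ V₁ → x ∉ V₁ → w ∉ V₁ → p ≠ w → D.Adj p x → D.Adj x w →
      D.Adj a w → ¬ D.Adj p a)
    (S : Set V) (hSM : S ⊆ V₁ᶜ)
    (hx : ∀ x ∈ V₁ᶜ \ S, (succIn D V₁ x).ncard + (succIn D V₁ᶜ x).ncard = V₁.ncard)
    (hx' : ∀ x ∈ S, (succIn D V₁ x).ncard + (succIn D V₁ᶜ x).ncard + 1 = V₁.ncard)
    (hq : Q.ncard + S.ncard = if Fintype.card V % 2 = 1 then 1 else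
      if Fintype.card V % 4 = 0 then 1 else 2) : IsOptimal D := by
  have hgood := hS.isGoodPart
  obtain ⟨hyV, hzV, hyz, hadj⟩ := hS
  have hy' : ∀ x, x ∉ V₁ → ¬ D.Adj y x := by
    intro x hx hyx
    have : x ∈ succIn D V₁ᶜ y := ⟨hx, hyx⟩
    rw [hy] at this
    exact this
  refine ⟨fun a => ?_, ?_, size_eq_exSize hfirst
    (size_of_layout hQ hgood.pred hM hQ0 S hSM hx hx') hq⟩
  · by_cases ha : a ∈ V₁
    · exact hgood.irrefl a ha
    · exact hirr a ha
  · apply uniqueTwoPaths_of_layout (V₁ := V₁)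
    · intro p x w hx hw hpx hpw
      by_cases hp : p ∈ V₁
      · have hpQ : p ∉ Q := fun h => by
          have : x ∈ succIn D V₁ᶜ p := ⟨hx, hpx⟩
          rw [hQ0 p h] at this
          exact this
        exact (hM p ⟨hp, hpQ⟩).unique ⟨hx, hpx⟩ ⟨hw, hpw⟩
      · exact hout p x w hp hx hw hpx hpw
    · exact fun a b d ha hb hd had hbd => (hgood.pred d hd).unique ⟨ha, had⟩ ⟨hb, hbd⟩
    · have key : ∀ p b w, b ∈ V₁ → w ∉ V₁ → p ≠ w → b ≠ z → D.Adj p z → D.Adj z w →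
          D.Adj p b → ¬ D.Adj b w := by
        intro p b w hb hw hpw hbz hpz hzw hpb hbw
        by_cases hp : p ∈ V₁
        · rcases (hadj p hp b hb).1 hpb with h | h
          · exact hbz h.2
          · exact hgood.irrefl z hzV (h.1 ▸ hpz)
        · exact hpredz p b w hp hb hw hpw hbz hpz hzw hpb hbw
      intro p a b w ha hb hw hpw hpa haw hpb hbw
      by_cases haz : a = z
      · subst haz
        by_contra hab
        exact key p b w hb hw hpw (Ne.symm hab) hpa haw hpb hbw
      · by_cases hbz : b = z
        · subst hbz
          exact absurd haw (key p a w ha hw hpw haz hpb hbw hpa)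
        · exact hpred a b w ha hb hw haz hbz haw hbw
    · intro p a x d ha hx hd hpd hpa had hpx hxd
      by_cases hp : p ∈ V₁
      · have hpy : p = y := hgood.start p hp a ha d hd hpa had hpd
        exact hy' x hx (hpy ▸ hpx)
      · have h1 := hmiss p x hp hx hpx
        rcases (hadj a ha d hd).1 had with h | h
        · exact h1.2 (h.2 ▸ hxd)
        · exact h1.1 (h.1 ▸ hpa)
    · intro p a x w ha hx hw hpw hpa haw hpx hxw
      by_cases hp : p ∈ V₁
      · rcases (hadj p hp a ha).1 hpa with h | h
        · exact hy' x hx (h.1 ▸ hpx)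
        · exact hzout x w hx hw (h.1 ▸ hpx) hxw
      · exact hsq p a x w hp ha hx hw hpw hpx hxw haw hpa

theorem ncard_succIn_add_of_isTwoCycles [Finite V] {V₄ : Set V} {x z : V} (hz : z ∈ V₁)
    (h4 : IsTwoCycles D V₄) (hV₄ : V₄ ⊆ V₁ᶜ) (hno : ∀ a ∈ V₄, ∀ b ∈ V₁ᶜ, D.Adj a b → b ∈ V₄)
    (hx : x ∈ V₄) (hsucc : succIn D V₁ x = V₁ \ {z}) :
    (succIn D V₁ x).ncard + (succIn D V₁ᶜ x).ncard = V₁.ncard := by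
  have h1 : (succIn D V₁ᶜ x).ncard = 1 := by
    obtain ⟨b, hb, -, -, huniq⟩ := h4 x hx
    apply ncard_eq_one_of_existsUnique
    exact ⟨b, ⟨hV₄ hb, (huniq b hb).2 rfl⟩, fun c hc => (huniq c (hno x hx c hc.1 hc.2)).1 hc.2⟩
  rw [hsucc, h1, Set.ncard_sdiff_singleton_add_one hz]

/-- The digraphs with `D(V₁) = S(y, z)` and no arcs outside `V₁` but those of 2-cycles on `V₄`. -/
theorem isOptimal_of_isS_of_isTwoCycles [Fintype V] {V₃ V₄ : Set V} {y z : V}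
    (hfirst : IsFirstPart V₁) (hS : IsS D V₁ y z) (h34 : V₃ ∪ V₄ = V₁ᶜ)
    (hno : NoArcsBetween D V₃ V₄) (h3 : IsEmptyOn D V₃)
    (h4 : IsTwoCycles D V₄) (hQ : Q ⊆ V₁) (hyQ : y ∈ Q) (hmatch : Matches D (V₁ \ Q) V₁ᶜ)
    (hQ0 : ∀ a ∈ Q, succIn D V₁ᶜ a = ∅) (hz : ∀ w, w ∉ V₁ → D.Adj z w → w ∈ V₃)
    (hs3 : ∀ x ∈ V₃, succIn D V₁ x = V₁) (hs4 : ∀ x ∈ V₄, succIn D V₁ x = V₁ \ {z})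
    (hq : Q.ncard = if Fintype.card V % 2 = 1 then 1 else
      if Fintype.card V % 4 = 0 then 1 else 2) : IsOptimal D := by
  have hcase : ∀ x, x ∉ V₁ → x ∈ V₃ ∨ x ∈ V₄ := fun x hx => by
    have : x ∈ V₁ᶜ := hx
    rwa [← h34] at this
  have hnQ : ∀ a w, w ∉ V₁ → D.Adj a w → a ∉ Q := by
    intro a w hw haw ha
    have : w ∈ succIn D V₁ᶜ a := ⟨hw, haw⟩
    rw [hQ0 a ha] at this
    exact this
  have hV₃ : V₃ ⊆ V₁ᶜ := h34 ▸ Set.subset_union_left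
  have hV₄ : V₄ ⊆ V₁ᶜ := h34 ▸ Set.subset_union_right
  have hno3 : ∀ a ∈ V₃, ∀ b, b ∉ V₁ → ¬ D.Adj a b := by
    intro a ha b hb
    rcases hcase b hb with h | h
    · exact h3 a ha b h
    · exact (hno a ha b h).1
  have harc : ∀ a b, a ∉ V₁ → b ∉ V₁ → D.Adj a b → a ∈ V₄ ∧ b ∈ V₄ := by
    intro a b ha hb hab
    have ha4 : a ∈ V₄ := (hcase a ha).resolve_left fun h => hno3 a h b hb hab
    exact ⟨ha4, (hcase b hb).resolve_left fun h => (hno b h a ha4).2 hab⟩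
  have hpartner : ∀ a b c, a ∉ V₁ → b ∉ V₁ → c ∉ V₁ → D.Adj a b → D.Adj b c → c = a := by
    intro a b c ha hb hc hab hbc
    obtain ⟨ha4, hb4⟩ := harc a b ha hb hab
    obtain ⟨-, hc4⟩ := harc b c hb hc hbc
    obtain ⟨d, hd, -, hda, huniq⟩ := h4 a ha4
    obtain rfl := (huniq b hb4).1 hab
    obtain ⟨e, he, -, -, huniq'⟩ := h4 b hb4
    exact ((huniq' c hc4).1 hbc).trans ((huniq' a ha4).1 hda).symm
  have hz4 : ∀ x ∈ V₄, ¬ D.Adj x z := by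
    intro x hx hxz
    have : z ∈ succIn D V₁ x := ⟨hS.2.1, hxz⟩
    rw [hs4 x hx] at this
    exact this.2 rfl
  refine isOptimal_of_isS (S := ∅) hfirst hS hQ hmatch.1 hQ0 (hQ0 y hyQ) ?_ ?_ ?_ ?_ ?_ ?_ ?_
    (Set.empty_subset _) ?_ (fun x hx => absurd hx (by simp)) (by rw [Set.ncard_empty, add_zero, hq])
  · intro x hx hxx
    obtain ⟨hx4, -⟩ := harc x x hx hx hxx
    exact (h4.isGoodPart ∅).irrefl x hx4 hxx
  · intro p x w hp hx hw hpx hpw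
    obtain ⟨hp4, hx4⟩ := harc p x hp hx hpx
    obtain ⟨-, hw4⟩ := harc p w hp hw hpw
    obtain ⟨d, -, -, -, huniq⟩ := h4 p hp4
    exact ((huniq x hx4).1 hpx).trans ((huniq w hw4).1 hpw).symm
  · exact fun a b w ha hb hw _ _ haw hbw => (hmatch.2 w hw).unique
      ⟨⟨ha, hnQ a w hw haw⟩, haw⟩ ⟨⟨hb, hnQ b w hw hbw⟩, hbw⟩
  · intro p b w hp hb hw hpw hbz _ hzw _ hbw
    exact hbz ((hmatch.2 w hw).unique ⟨⟨hb, hnQ b w hw hbw⟩, hbw⟩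
      ⟨⟨hS.2.1, hnQ z w hw hzw⟩, hzw⟩)
  · intro p x hp hx hpx
    obtain ⟨hp4, hx4⟩ := harc p x hp hx hpx
    exact ⟨hz4 p hp4, hz4 x hx4⟩
  · exact fun x w hx hw hzx => hno3 x (hz x hx hzx) w hw
  · exact fun p a x w hp ha hx hw hpw hpx hxw haw hpa => hpw (hpartner p x w hp hx hw hpx hxw).symm
  · rintro x ⟨hx, -⟩
    rcases hcase x hx with h | h
    · have : succIn D V₁ᶜ x = ∅ := by
        ext w
        simp only [succIn, Set.mem_ofPred_eq, Set.mem_empty_iff_false, iff_false, not_and]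
        exact hno3 x h w
      rw [hs3 x h, this, Set.ncard_empty, add_zero]
    · exact ncard_succIn_add_of_isTwoCycles hS.2.1 h4 hV₄
        (fun a ha b hb hab => (harc a b (hV₄ ha) hb hab).2) h (hs4 x h)

theorem ClassD2.isOptimal [Fintype V] (h : ClassD2 D) (hn : Fintype.card V % 2 = 1) :
    IsOptimal D := by
  obtain ⟨V₁, V₃, V₄, y, z, hfirst, hS, ⟨h34, -, hno, h3, h4⟩, ⟨hmatch, hy, w, hw, hzw⟩,
    hs3, hs4⟩ := h
  have hwV : w ∈ V₁ᶜ := h34 ▸ Or.inl hw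
  refine isOptimal_of_isS_of_isTwoCycles hfirst hS h34 hno h3 h4 (Q := {y})
    (by simpa using hS.1) rfl hmatch ?_ ?_ hs3 hs4 (by simp [hn])
  · rintro a rfl
    exact hy
  · intro x hx hzx
    rwa [(hmatch.1 z ⟨hS.2.1, hS.2.2.1.symm⟩).unique ⟨hx, hzx⟩ ⟨hwV, hzw⟩]

theorem ClassD6.isOptimal [Fintype V] (h : ClassD6 D) (hn : Fintype.card V % 4 = 2) :
    IsOptimal D := by
  obtain ⟨V₁, V₃, V₄, y, z, hfirst, hS, ⟨h34, -, hno, h3, h4⟩, ⟨hmatch, hy, hz⟩, hs4, hs3⟩ := h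
  refine isOptimal_of_isS_of_isTwoCycles hfirst hS h34 hno h3 h4 (Q := {y, z}) ?_ (by simp)
    hmatch ?_ ?_ hs3 hs4 ?_
  · rintro a (rfl | rfl)
    · exact hS.1
    · exact hS.2.1
  · rintro a (rfl | rfl) <;> assumption
  · intro x hx hzx
    have : x ∈ succIn D V₁ᶜ z := ⟨hx, hzx⟩
    rw [hz] at this
    exact absurd this (by simp)
  · rw [Set.ncard_pair hS.2.2.1, if_neg (by omega), if_neg (by omega)]

theorem ClassD7.isOptimal [Fintype V] (h : ClassD7 D) (hn : Fintype.card V % 4 = 2) :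
    IsOptimal D := by
  obtain ⟨V₁, V₃, V₄, y, z, x, hfirst, hS, ⟨h34, -, hno, h3, h4⟩,
    ⟨⟨hxV, hxyz⟩, hmatch, hx, hy, w, hw, hzw⟩, hs4, hs3⟩ := h
  simp only [Set.mem_insert_iff, Set.mem_singleton_iff, not_or] at hxyz
  have hwV : w ∈ V₁ᶜ := h34 ▸ Or.inl hw
  refine isOptimal_of_isS_of_isTwoCycles hfirst hS h34 hno h3 h4 (Q := {x, y}) ?_ (by simp)
    hmatch ?_ ?_ hs3 hs4 ?_
  · rintro a (rfl | rfl)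
    · exact hxV
    · exact hS.1
  · rintro a (rfl | rfl) <;> assumption
  · intro v hv hzv
    rwa [(hmatch.1 z ⟨hS.2.1, by simp [Ne.symm hxyz.2, hS.2.2.1.symm]⟩).unique ⟨hv, hzv⟩ ⟨hwV, hzw⟩]
  · rw [Set.ncard_pair hxyz.1, if_neg (by omega), if_neg (by omega)]

/-- The matching of the classes in which `v` has the additional predecessor `z`. -/
theorem matching_of_matches {y z v : V} (hz : succIn D V₁ᶜ z = {v}) (hy : succIn D V₁ᶜ y = ∅)
    (hmatch : Matches D (V₁ \ {y, z}) V₁ᶜ) :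
    (∀ a ∈ V₁ \ {y}, ∃! w, w ∈ V₁ᶜ ∧ D.Adj a w) ∧
      ∀ a b w, a ∈ V₁ → b ∈ V₁ → w ∉ V₁ → a ≠ z → b ≠ z → D.Adj a w → D.Adj b w → a = b := by
  have hy' : ∀ a w, w ∉ V₁ → D.Adj a w → a ≠ y := by
    rintro a w hw haw rfl
    have : w ∈ succIn D V₁ᶜ a := ⟨hw, haw⟩
    rw [hy] at this
    exact this
  constructor
  · rintro a ⟨ha, hay⟩
    by_cases haz : a = z
    · subst haz
      have hmem : ∀ w, w ∈ succIn D V₁ᶜ a ↔ w = v := fun w => by rw [hz]; rfl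
      exact ⟨v, (hmem v).2 rfl, fun w hw => (hmem w).1 hw⟩
    · exact hmatch.1 a ⟨ha, by simpa [haz] using hay⟩
  · intro a b w ha hb hw haz hbz haw hbw
    exact (hmatch.2 w hw).unique ⟨⟨ha, by simpa [haz] using hy' a w hw haw⟩, haw⟩
      ⟨⟨hb, by simpa [hbz] using hy' b w hw hbw⟩, hbw⟩

theorem not_adj_of_succIn_eq {x z : V} {S : Set V} (hz : z ∈ V₁) (h : succIn D V₁ x = V₁ \ S)
    (hzS : z ∈ S) : ¬ D.Adj x z := by
  intro hxz
  have : z ∈ succIn D V₁ x := ⟨hz, hxz⟩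
  rw [h] at this
  exact this.2 hzS

theorem adj_iff_of_succIn_eq {z v w : V} (hz : succIn D V₁ᶜ z = {v}) (hw : w ∉ V₁) :
    D.Adj z w ↔ w = v := by
  have : w ∈ succIn D V₁ᶜ z ↔ w = v := by rw [hz]; rfl
  rw [← this]
  exact ⟨fun h => ⟨hw, h⟩, fun h => h.2⟩

end Layout

/-! ### The classes are optimal: isolated vertices, `D₃`, `D₈` and `D₉` -/

section IsolatedVertices
variable {V : Type*} {D : Digraph V} {V₁ : Set V}

theorem succIn_compl_eq_empty_of_noArcsBetween {W : Set V} (hW : NoArcsBetween D W V₁ᶜ) {x : V}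
    (hx : x ∈ W) : succIn D V₁ᶜ x = ∅ := by
  ext w
  simp only [succIn, Set.mem_ofPred_eq, Set.mem_empty_iff_false, iff_false, not_and]
  exact fun hw => (hW x hx w hw).1

/-- The digraphs with `D(V₁) = S(y, z)` in which the vertices outside `V₁` are either isolated in
`D(V₁ᶜ)` (those of `W`) or lie on 2-cycles.  The vertex `v` has the predecessor `z` and one further
predecessor in `V₁`, and every vertex of `W` other than `v` misses one of these two. -/
theorem isOptimal_of_isS_of_isolated [Fintype V] {W : Set V} {y z v : V}
    (hfirst : IsFirstPart V₁) (hS : IsS D V₁ y z) (hWV : W ⊆ V₁ᶜ) (hvW : v ∈ W)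
    (hW : NoArcsBetween D W V₁ᶜ) (hC : IsTwoCycles D (V₁ᶜ \ W))
    (hz : succIn D V₁ᶜ z = {v}) (hy : succIn D V₁ᶜ y = ∅) (hmatch : Matches D (V₁ \ {y, z}) V₁ᶜ)
    (hv : succIn D V₁ v = V₁) (hsC : ∀ u ∈ V₁ᶜ \ W, succIn D V₁ u = V₁ \ {z})
    (hsW : ∀ u ∈ W \ {v}, ∃ w ∈ V₁, (w = z ∨ D.Adj w v) ∧ succIn D V₁ u = V₁ \ {w})
    (hq : 1 + (W \ {v}).ncard = if Fintype.card V % 2 = 1 then 1 else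
      if Fintype.card V % 4 = 0 then 1 else 2) : IsOptimal D := by
  obtain ⟨hM, hpred⟩ := matching_of_matches hz hy hmatch
  have hyz := hS.2.2.1
  have harc : ∀ a b, a ∉ V₁ → b ∉ V₁ → D.Adj a b → a ∈ V₁ᶜ \ W ∧ b ∈ V₁ᶜ \ W := by
    intro a b ha hb hab
    exact ⟨⟨ha, fun h => (hW a h b hb).1 hab⟩, ⟨hb, fun h => (hW b h a ha).2 hab⟩⟩
  refine isOptimal_of_isS (Q := {y}) (S := W \ {v}) hfirst hS (by simpa using hS.1) hM ?_ hy ?_ ?_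
    hpred ?_ ?_ ?_ ?_ (fun a ha => hWV ha.1) ?_ ?_ (by rw [Set.ncard_singleton, hq])
  · rintro a rfl
    exact hy
  · intro x hx hxx
    exact (hC.isGoodPart ∅).irrefl x (harc x x hx hx hxx).1 hxx
  · intro p x w hp hx hw hpx hpw
    obtain ⟨hp4, hx4⟩ := harc p x hp hx hpx
    obtain ⟨-, hw4⟩ := harc p w hp hw hpw
    obtain ⟨d, -, -, -, huniq⟩ := hC p hp4
    exact ((huniq x hx4).1 hpx).trans ((huniq w hw4).1 hpw).symm
  · intro p b w hp hb hw hpw hbz hpz hzw hpb hbw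
    obtain rfl := (adj_iff_of_succIn_eq hz hw).1 hzw
    by_cases hpW : p ∈ W
    · obtain ⟨c, hc, hcw, hsucc⟩ := hsW p ⟨hpW, hpw⟩
      rcases hcw with rfl | hcw
      · exact not_adj_of_succIn_eq hc hsucc rfl hpz
      · -- The vertex missed by `p` is the predecessor of `v` other than `z`, which is `b`.
        have hcz : c ≠ z := by
          rintro rfl
          exact not_adj_of_succIn_eq hc hsucc rfl hpz
        obtain rfl := hpred b c w hb hc hw hbz hcz hbw hcw
        exact not_adj_of_succIn_eq hb hsucc rfl hpb
    · exact not_adj_of_succIn_eq hS.2.1 (hsC p ⟨hp, hpW⟩) rfl hpz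
  · intro p x hp hx hpx
    obtain ⟨hp4, hx4⟩ := harc p x hp hx hpx
    exact ⟨not_adj_of_succIn_eq hS.2.1 (hsC p hp4) rfl,
      not_adj_of_succIn_eq hS.2.1 (hsC x hx4) rfl⟩
  · intro x w hx hw hzx
    obtain rfl := (adj_iff_of_succIn_eq hz hx).1 hzx
    exact (hW x hvW w hw).1
  · intro p a x w hp ha hx hw hpw hpx hxw haw hpa
    obtain ⟨hp4, hx4⟩ := harc p x hp hx hpx
    obtain ⟨-, hw4⟩ := harc x w hx hw hxw
    obtain ⟨d, -, -, hdp, huniq⟩ := hC p hp4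
    obtain rfl := (huniq x hx4).1 hpx
    obtain ⟨e, -, -, -, huniq'⟩ := hC x hx4
    exact hpw (((huniq' p hp4).1 hdp).trans ((huniq' w hw4).1 hxw).symm)
  · rintro x ⟨hx, hxW⟩
    by_cases h : x ∈ W
    · obtain rfl : x = v := by
        by_contra hne
        exact hxW ⟨h, hne⟩
      rw [hv, succIn_compl_eq_empty_of_noArcsBetween hW h, Set.ncard_empty, add_zero]
    · exact ncard_succIn_add_of_isTwoCycles hS.2.1 hC Set.sdiff_subset
        (fun a ha b hb hab => (harc a b ha.1 hb hab).2) ⟨hx, h⟩ (hsC x ⟨hx, h⟩)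
  · intro x hx
    obtain ⟨c, hc, -, hsucc⟩ := hsW x hx
    rw [hsucc, succIn_compl_eq_empty_of_noArcsBetween hW hx.1, Set.ncard_empty, add_zero,
      Set.ncard_sdiff_singleton_add_one hc]

theorem ClassD3.isOptimal [Fintype V] (h : ClassD3 D) (hn : Fintype.card V % 4 = 0) :
    IsOptimal D := by
  obtain ⟨V₁, y, z, v, hfirst, hS, ⟨hv, hno, hC⟩, ⟨hz, hy, hmatch⟩, hsv, hsC⟩ := h
  refine isOptimal_of_isS_of_isolated (W := {v}) hfirst hS (by simpa using hv) rfl hno hC hz hy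
    hmatch hsv hsC (fun u hu => absurd hu.1 hu.2) ?_
  rw [if_neg (by omega), if_pos hn]
  simp

theorem ClassD8.isOptimal [Fintype V] (h : ClassD8 D) (hn : Fintype.card V % 4 = 2) :
    IsOptimal D := by
  obtain ⟨V₁, y, z, v, x, hfirst, hS, ⟨hv, hx, hvx, hno, hC⟩, ⟨hz, hy, hmatch⟩, hsv, hsC, hsx⟩ := h
  have hW : ({v, x} : Set V) \ {v} = {x} := by
    ext a
    simp only [Set.mem_sdiff, Set.mem_insert_iff, Set.mem_singleton_iff]
    constructor
    · rintro ⟨rfl | h, h'⟩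
      · exact absurd rfl h'
      · exact h
    · rintro rfl
      exact ⟨Or.inr rfl, Ne.symm hvx⟩
  refine isOptimal_of_isS_of_isolated (W := {v, x}) hfirst hS ?_ (by simp) hno hC hz hy
    hmatch hsv hsC ?_ ?_
  · rintro a (rfl | rfl)
    · exact hv
    · exact hx
  · rw [hW]
    rintro u rfl
    rcases hsx with h | ⟨w, hw, hwv, h⟩
    · exact ⟨z, hS.2.1, Or.inl rfl, h⟩
    · exact ⟨w, hw.1, Or.inr hwv, h⟩
  · rw [hW, if_neg (by omega), if_neg (by omega), Set.ncard_singleton]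

theorem ClassD9.isOptimal [Fintype V] (h : ClassD9 D) (hn : Fintype.card V % 4 = 2) :
    IsOptimal D := by
  obtain ⟨V₁, C, y, z, v, x, x₁, x₂, p, hfirst, hS,
    ⟨⟨hcov, hvC, hCT, hvT, hx1, hx2, h12⟩, hnov, hnoC, hC, hT⟩, ⟨hz, hy, hmatch⟩, hsv, hs, hp, hpx2,
    hsx⟩ := h
  obtain ⟨hM, hpred⟩ := matching_of_matches hz hy hmatch
  have hcase : ∀ a, a ∉ V₁ → a = v ∨ a ∈ C ∨ a ∈ ({x, x₁, x₂} : Set V) := by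
    intro a ha
    have h : a ∈ V₁ᶜ := ha
    rw [← hcov] at h
    rcases h with (h | h) | h
    exacts [Or.inr (Or.inl h), Or.inl h, Or.inr (Or.inr h)]
  have hCV : C ⊆ V₁ᶜ := fun a ha => hcov ▸ Or.inl (Or.inl ha)
  have hTV : ({x, x₁, x₂} : Set V) ⊆ V₁ᶜ := fun a ha => hcov ▸ Or.inr ha
  have hvV : v ∉ V₁ := by
    have : v ∈ V₁ᶜ := hcov ▸ Or.inl (Or.inr rfl)
    exact this
  have hxV : x ∉ V₁ := hTV (by simp)
  have hx1V : x₁ ∉ V₁ := hTV (by simp)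
  have hx2V : x₂ ∉ V₁ := hTV (by simp)
  simp only [Set.mem_insert_iff, Set.mem_singleton_iff, not_or] at hvT
  have harc : ∀ a b, a ∉ V₁ → b ∉ V₁ → D.Adj a b →
      (a ∈ C ∧ b ∈ C) ∨ (a = x ∧ b = x₁) ∨ (a = x₁ ∧ b = x₂) ∨ (a = x₂ ∧ b = x₁) := by
    intro a b ha hb hab
    rcases hcase a ha with rfl | haC | haT
    · exact absurd hab (hnov a rfl b hb).1
    · rcases hcase b hb with rfl | hbC | hbT
      · exact absurd hab (hnov b rfl a ha).2
      · exact Or.inl ⟨haC, hbC⟩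
      · exact absurd hab (hnoC a haC b hbT).1
    · rcases hcase b hb with rfl | hbC | hbT
      · exact absurd hab (hnov b rfl a ha).2
      · exact absurd hab (hnoC b hbC a haT).2
      · exact Or.inr ((hT a haT b hbT).1 hab)
  have hxC : x ∉ C := fun h => Set.disjoint_left.1 hCT h (by simp)
  have hx1C : x₁ ∉ C := fun h => Set.disjoint_left.1 hCT h (by simp)
  have hx2C : x₂ ∉ C := fun h => Set.disjoint_left.1 hCT h (by simp)
  have hmissz : ∀ a, a ∉ V₁ → a ≠ v → ¬ D.Adj a z := by
    intro a ha hav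
    by_cases hax : a = x
    · subst hax
      exact not_adj_of_succIn_eq hS.2.1 hsx (by simp)
    · exact not_adj_of_succIn_eq hS.2.1 (hs a ⟨ha, by simp [hav, hax]⟩) rfl
  have hne : ∀ a b, a ∉ V₁ → b ∉ V₁ → D.Adj a b → a ≠ v ∧ b ≠ v := by
    intro a b ha hb hab
    constructor
    · rintro rfl
      exact (hnov a rfl b hb).1 hab
    · rintro rfl
      exact (hnov b rfl a ha).2 hab
  have hzx2 : ¬ D.Adj z x₂ := fun h => hvT.2.2 ((adj_iff_of_succIn_eq hz hx2V).1 h).symm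
  have hpz : p ≠ z := by
    rintro rfl
    exact hzx2 hpx2
  have hout : ∀ p x w, p ∉ V₁ → x ∉ V₁ → w ∉ V₁ → D.Adj p x → D.Adj p w → x = w := by
    intro a b c ha hb hc hab hac
    rcases harc a b ha hb hab with ⟨h, h'⟩ | ⟨rfl, rfl⟩ | ⟨rfl, rfl⟩ | ⟨rfl, rfl⟩ <;>
    rcases harc _ c ha hc hac with ⟨k, k'⟩ | ⟨k, rfl⟩ | ⟨k, rfl⟩ | ⟨k, rfl⟩ <;>
    first
    | rfl
    | contradiction
    | exact absurd k.symm ‹_›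
    | (subst k; contradiction)
    | skip
    obtain ⟨d, -, -, -, huniq⟩ := hC a h
    exact ((huniq b h').1 hab).trans ((huniq c k').1 hac).symm
  have hone : ∀ a, a ∉ V₁ → a ≠ v → (succIn D V₁ᶜ a).ncard = 1 := by
    intro a ha hav
    apply ncard_eq_one_of_existsUnique
    obtain ⟨b, hb, hab⟩ : ∃ b, b ∈ V₁ᶜ ∧ D.Adj a b := by
      rcases hcase a ha with h | haC | haT
      · exact absurd h hav
      · obtain ⟨b, hb, -, -, huniq⟩ := hC a haC
        exact ⟨b, hCV hb, (huniq b hb).2 rfl⟩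
      · rcases haT with rfl | rfl | rfl
        · exact ⟨x₁, hx1V, (hT _ (by simp) _ (by simp)).2 (Or.inl ⟨rfl, rfl⟩)⟩
        · exact ⟨x₂, hx2V, (hT _ (by simp) _ (by simp)).2 (Or.inr (Or.inl ⟨rfl, rfl⟩))⟩
        · exact ⟨x₁, hx1V, (hT _ (by simp) _ (by simp)).2 (Or.inr (Or.inr ⟨rfl, rfl⟩))⟩
    exact ⟨b, ⟨hb, hab⟩, fun c hc => hout a c b ha hc.1 hb hc.2 hab⟩
  refine isOptimal_of_isS (Q := {y}) (S := {x}) hfirst hS (by simpa using hS.1) hM ?_ hy ?_ hout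
    hpred ?_ ?_ ?_ ?_ (by simpa using hxV) ?_ ?_ ?_
  · rintro a rfl
    exact hy
  · intro a ha haa
    rcases harc a a ha ha haa with ⟨h, -⟩ | ⟨h, h'⟩ | ⟨h, h'⟩ | ⟨h, h'⟩
    · exact (hC.isGoodPart ∅).irrefl a h haa
    · exact hx1 (h.symm.trans h')
    · exact h12 (h.symm.trans h')
    · exact h12 (h'.symm.trans h)
  · intro a b w ha hb hw haw hbz haz hzw hab hbw
    obtain rfl := (adj_iff_of_succIn_eq hz hw).1 hzw
    exact hmissz a ha haw haz
  · intro a b ha hb hab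
    exact ⟨hmissz a ha (hne a b ha hb hab).1, hmissz b hb (hne a b ha hb hab).2⟩
  · intro a w ha hw hza
    obtain rfl := (adj_iff_of_succIn_eq hz ha).1 hza
    exact (hnov a rfl w hw).1
  · intro b a c w hb ha hc hw hbw hbc hcw haw hba
    rcases harc b c hb hc hbc with ⟨hbC, hcC⟩ | ⟨rfl, rfl⟩ | ⟨rfl, rfl⟩ | ⟨rfl, rfl⟩
    · obtain ⟨d, -, -, hdb, huniq⟩ := hC b hbC
      obtain rfl := (huniq c hcC).1 hbc
      exact hbw (hout c b w hc hb hw hdb hcw)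
    · -- The path `x → x₁ → x₂`: the predecessor of `x₂` in `V₁` is missed by `x`.
      obtain rfl := hout c w x₂ hc hw hx2V hcw
        ((hT _ (by simp) _ (by simp)).2 (Or.inr (Or.inl ⟨rfl, rfl⟩)))
      have haz : a ≠ z := by
        rintro rfl
        exact hzx2 haw
      obtain rfl := hpred a p w ha hp hw haz hpz haw hpx2
      exact not_adj_of_succIn_eq ha hsx (by simp) hba
    · exact hbw (hout c b w hc hb hw
        ((hT _ (by simp) _ (by simp)).2 (Or.inr (Or.inr ⟨rfl, rfl⟩))) hcw)
    · exact hbw (hout c b w hc hb hw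
        ((hT _ (by simp) _ (by simp)).2 (Or.inr (Or.inl ⟨rfl, rfl⟩))) hcw)
  · rintro a ⟨ha, hax⟩
    by_cases hav : a = v
    · rw [hav, hsv, succIn_compl_eq_empty_of_noArcsBetween hnov rfl, Set.ncard_empty, add_zero]
    · rw [hs a ⟨ha, by simpa [hav] using hax⟩, hone a ha hav,
        Set.ncard_sdiff_singleton_add_one hS.2.1]
  · rintro a rfl
    have h2 : (V₁ \ {z, p}).ncard + 2 = V₁.ncard := by
      rw [← Set.ncard_pair hpz.symm, Set.ncard_sdiff_add_ncard_of_subset]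
      rintro b (rfl | rfl)
      exacts [hS.2.1, hp]
    rw [hsx, hone a hxV (Ne.symm hvT.1), ← h2]
  · rw [Set.ncard_singleton, Set.ncard_singleton, if_neg (by omega), if_neg (by omega)]

end IsolatedVertices

/-! ### Existence of optimal digraphs -/

section Existence
variable {n : ℕ}

/-- On `{0, …, n - 1}`, with `V₁ = {0, …, k - 1}`: the digraph with `D(V₁) = S(0, 1)`, all arcs from
`V₁ᶜ` to `V₁`, no arcs in `V₁ᶜ`, and the arcs `i → i + k - 1` for `1 ≤ i < k`. -/
def matchedStar (n k : ℕ) : Digraph (Fin n) where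
  Adj i j := (i.val < k ∧ j.val < k ∧ ((i.val = 0 ∧ j.val = 1) ∨ (i.val = 1 ∧ j.val ≠ 1))) ∨
    (k ≤ i.val ∧ j.val < k) ∨ (1 ≤ i.val ∧ i.val < k ∧ k ≤ j.val ∧ j.val + 1 = i.val + k)

/-- On `{0, …, n - 1}`, with `V₁ = {0, …, k - 1}`: the digraph with `D(V₁) = S(0, 1)`, the arc
`1 → k`, the arcs `i → i + k - 2` for `2 ≤ i < k`, a 2-cycle on each pair `{j, j + 1} ⊆ V₁ᶜ \ {k}`
with `j` even, all arcs from `k` to `V₁`, and all arcs from `V₁ᶜ \ {k}` to `V₁ \ {1}`. -/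
def matchedStarWithTwoCycles (n k : ℕ) : Digraph (Fin n) where
  Adj i j := (i.val < k ∧ j.val < k ∧ ((i.val = 0 ∧ j.val = 1) ∨ (i.val = 1 ∧ j.val ≠ 1))) ∨
    (k ≤ i.val ∧ j.val < k ∧ (i.val = k ∨ j.val ≠ 1)) ∨
    (i.val = 1 ∧ j.val = k) ∨
    (2 ≤ i.val ∧ i.val < k ∧ k ≤ j.val ∧ j.val + 2 = i.val + k) ∨
    (k < i.val ∧ k < j.val ∧
      ((i.val % 2 = 0 ∧ j.val = i.val + 1) ∨ (i.val % 2 = 1 ∧ i.val = j.val + 1)))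

theorem ncard_val_lt {k : ℕ} (hk : k ≤ n) : {i : Fin n | i.val < k}.ncard = k := by
  have : {i : Fin n | i.val < k} = (Fin.castLE hk) '' Set.univ := by
    ext i
    simp only [Set.mem_ofPred_eq, Set.image_univ, Set.mem_range]
    exact ⟨fun h => ⟨⟨i, h⟩, rfl⟩, by rintro ⟨j, rfl⟩; exact j.2⟩
  rw [this, Set.ncard_image_of_injective _ (Fin.castLE_injective hk), Set.ncard_univ, Nat.card_fin]

theorem isFirstPart_val_lt (hn : 13 ≤ n) :
    IsFirstPart {i : Fin n | i.val < n / 2 + 1} := by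
  unfold IsFirstPart
  rw [ncard_val_lt (by omega), Nat.card_fin]

theorem isSWithTwoCycles_matchedStar (hn : 13 ≤ n) :
    IsSWithTwoCycles (matchedStar n (n / 2 + 1)) {i : Fin n | i.val < n / 2 + 1}
      ⟨0, by omega⟩ ⟨1, by omega⟩ := by
  refine ⟨_, ∅, Set.union_empty _, Set.disjoint_empty _, fun _ _ _ h => absurd h (by simp), ?_,
    fun _ h => absurd h (by simp)⟩
  refine ⟨?_, ?_, by simp, ?_⟩ <;>
  simp only [Set.mem_ofPred_eq, matchedStar, Fin.ext_iff, ne_eq]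
  · omega
  · omega
  · intro a ha b hb
    omega

theorem classD1_matchedStar (hn : 13 ≤ n) (h : n % 2 = 1) : ClassD1 (matchedStar n (n / 2 + 1)) := by
  refine ⟨_, _, _, isFirstPart_val_lt hn, isSWithTwoCycles_matchedStar hn, ?_,
    ⟨⟨?_, ?_⟩, ?_⟩, ?_⟩
  · intro a ha b hb
    simp only [Set.mem_compl_iff, Set.mem_ofPred_eq, matchedStar] at *
    omega
  · rintro a ⟨ha, ha0⟩
    simp only [Set.mem_compl_iff, Set.mem_ofPred_eq, matchedStar, Set.mem_singleton_iff,
      Fin.ext_iff] at *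
    refine ⟨⟨a + (n / 2), by omega⟩, ?_, fun b hb => Fin.ext ?_⟩
    · simp only []
      omega
    · simp only [] at *
      omega
  · intro b hb
    simp only [Set.mem_compl_iff, Set.mem_ofPred_eq, matchedStar, Set.mem_singleton_iff,
      Fin.ext_iff, Set.mem_sdiff] at *
    refine ⟨⟨b - (n / 2), by omega⟩, ?_, fun c hc => Fin.ext ?_⟩
    · simp only []
      omega
    · simp only [] at *
      omega
  · ext b
    simp only [succIn, Set.mem_compl_iff, Set.mem_ofPred_eq, matchedStar, Set.mem_empty_iff_false,
      iff_false] at *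
    omega
  · intro b hb
    ext c
    simp only [succIn, Set.mem_compl_iff, Set.mem_ofPred_eq, matchedStar] at *
    omega

theorem classD10_matchedStar (hn : 13 ≤ n) (h : n % 4 = 2) :
    ClassD10 (matchedStar n (n / 2 + 1)) := by
  refine ⟨_, _, _, ⟨n / 2, by omega⟩, isFirstPart_val_lt hn,
    isSWithTwoCycles_matchedStar hn, ?_, ⟨?_, ⟨?_, ?_⟩, ?_, ?_⟩, ?_⟩
  · intro a ha b hb
    simp only [Set.mem_compl_iff, Set.mem_ofPred_eq, matchedStar] at *
    omega
  · simp only [Set.mem_ofPred_eq, Set.mem_sdiff, Set.mem_insert_iff, Set.mem_singleton_iff,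
      Fin.ext_iff]
    omega
  · rintro a ⟨ha, ha0⟩
    simp only [Set.mem_compl_iff, Set.mem_ofPred_eq, matchedStar, Set.mem_insert_iff,
      Set.mem_singleton_iff, Fin.ext_iff] at *
    refine ⟨⟨a + (n / 2), by omega⟩, ?_, fun b hb => Fin.ext ?_⟩
    · simp only []
      omega
    · simp only [] at *
      omega
  · intro b hb
    simp only [Set.mem_compl_iff, Set.mem_ofPred_eq, matchedStar, Set.mem_insert_iff,
      Set.mem_singleton_iff, Fin.ext_iff, Set.mem_sdiff] at *
    refine ⟨⟨b - (n / 2), by omega⟩, ?_, fun c hc => Fin.ext ?_⟩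
    · simp only []
      omega
    · simp only [] at *
      omega
  · ext b
    simp only [succIn, Set.mem_compl_iff, Set.mem_ofPred_eq, matchedStar, Set.mem_empty_iff_false,
      iff_false] at *
    omega
  · ext b
    simp only [succIn, Set.mem_compl_iff, Set.mem_ofPred_eq, matchedStar, Set.mem_empty_iff_false,
      iff_false] at *
    omega
  · intro b hb
    ext c
    simp only [succIn, Set.mem_compl_iff, Set.mem_ofPred_eq, matchedStar] at *
    omega

theorem classD3_matchedStarWithTwoCycles (hn : 13 ≤ n) (h : n % 4 = 0) :
    ClassD3 (matchedStarWithTwoCycles n (n / 2 + 1)) := by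
  refine ⟨_, ⟨0, by omega⟩, ⟨1, by omega⟩, ⟨n / 2 + 1, by omega⟩,
    isFirstPart_val_lt hn, ⟨?_, ?_, ?_, ?_⟩, ⟨?_, ?_, ?_⟩,
    ⟨?_, ?_, ?_, ?_⟩, ?_, ?_⟩
  · simp only [Set.mem_ofPred_eq]
    omega
  · simp only [Set.mem_ofPred_eq]
    omega
  · simp
  · intro a ha b hb
    simp only [Set.mem_ofPred_eq, matchedStarWithTwoCycles, Fin.ext_iff, ne_eq] at *
    omega
  · simp
  · intro a ha b hb
    simp only [Set.mem_compl_iff, Set.mem_ofPred_eq, matchedStarWithTwoCycles,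
      Set.mem_singleton_iff, Fin.ext_iff] at *
    omega
  · rintro a ⟨ha, hav⟩
    simp only [Set.mem_compl_iff, Set.mem_ofPred_eq, matchedStarWithTwoCycles,
      Set.mem_singleton_iff, Fin.ext_iff, Set.mem_sdiff, ne_eq] at *
    refine ⟨⟨if a.val % 2 = 0 then a + 1 else a - 1, by split_ifs <;> omega⟩, ?_⟩
    simp only []
    split_ifs <;> refine ⟨by omega, by omega, by omega, fun c hc => by omega⟩
  · ext a
    simp only [succIn, Set.mem_compl_iff, Set.mem_ofPred_eq, matchedStarWithTwoCycles,
      true_and, Set.mem_singleton_iff, Fin.ext_iff]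
    omega
  · ext a
    simp only [succIn, Set.mem_compl_iff, Set.mem_ofPred_eq, matchedStarWithTwoCycles,
      Set.mem_empty_iff_false, iff_false]
    omega
  · rintro a ⟨ha, ha0⟩
    simp only [Set.mem_compl_iff, Set.mem_ofPred_eq, matchedStarWithTwoCycles, Set.mem_insert_iff,
      Set.mem_singleton_iff, Fin.ext_iff] at *
    refine ⟨⟨a + (n / 2) - 1, by omega⟩, ?_, fun b hb => Fin.ext ?_⟩
    · simp only []
      omega
    · simp only [] at *
      omega
  · intro b hb
    simp only [Set.mem_compl_iff, Set.mem_ofPred_eq, matchedStarWithTwoCycles, Set.mem_insert_iff,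
      Set.mem_singleton_iff, Fin.ext_iff, Set.mem_sdiff] at *
    refine ⟨⟨b + 1 - (n / 2), by omega⟩, ?_, fun c hc => Fin.ext ?_⟩
    · simp only []
      omega
    · simp only [] at *
      omega
  · ext c
    simp only [succIn, Set.mem_ofPred_eq, matchedStarWithTwoCycles, true_or, and_true]
    omega
  · rintro b ⟨hb, hbv⟩
    ext c
    simp only [succIn, Set.mem_compl_iff, Set.mem_ofPred_eq, matchedStarWithTwoCycles,
      Set.mem_singleton_iff, Fin.ext_iff, Set.mem_sdiff] at *
    omega

theorem exists_isOptimal (hn : 13 ≤ n) : ∃ D : Digraph (Fin n), IsOptimal D := by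
  have h : n % 2 = 1 ∨ n % 4 = 0 ∨ n % 4 = 2 := by omega
  rcases h with h | h | h
  · exact ⟨_, (classD1_matchedStar hn h).isOptimal (by simpa using h)⟩
  · exact ⟨_, (classD3_matchedStarWithTwoCycles hn h).isOptimal (by simpa using h)⟩
  · exact ⟨_, (classD10_matchedStar hn h).isOptimal (by simpa using h)⟩

theorem InClasses.isOptimal {D : Digraph (Fin n)} (h : InClasses n D) : IsOptimal D := by
  obtain ⟨h1, h2, h3⟩ := h
  have hpar : n % 2 = 1 ∨ n % 4 = 0 ∨ n % 4 = 2 := by omega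
  rcases hpar with hp | hp | hp
  · have hc : Fintype.card (Fin n) % 2 = 1 := by simpa using hp
    rcases h1 hp with h | h
    exacts [h.isOptimal hc, h.isOptimal hc]
  · exact (h2 hp).isOptimal (by simpa using hp)
  · have hc : Fintype.card (Fin n) % 4 = 2 := by simpa using hp
    rcases h3 hp with h | h | h | h | h | h | h
    all_goals exact h.isOptimal hc

end Existence

/-! ### Isomorphism and the extremal number -/

section Transport
variable {V W : Type*} {D : Digraph V} {H : Digraph W}

theorem Isomorphic.symm (h : Isomorphic D H) : Isomorphic H D := by
  obtain ⟨f, hf⟩ := h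
  exact ⟨f.symm, fun a b => by rw [hf, f.apply_symm_apply, f.apply_symm_apply]⟩

theorem Isomorphic.reverse (h : Isomorphic D H) :
    Isomorphic (ExtremalP22.reverse D) (ExtremalP22.reverse H) := by
  obtain ⟨f, hf⟩ := h
  exact ⟨f, fun a b => hf b a⟩

theorem Isomorphic.strict (h : Isomorphic D H) (hH : Strict H) : Strict D := by
  obtain ⟨f, hf⟩ := h
  exact fun a ha => hH (f a) ((hf a a).1 ha)

theorem Isomorphic.uniqueTwoPaths (h : Isomorphic D H) (hH : UniqueTwoPaths H) :
    UniqueTwoPaths D := by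
  obtain ⟨f, hf⟩ := h
  intro p a b q hpq hpa haq hpb hbq
  exact f.injective (hH (f.injective.ne hpq) ((hf _ _).1 hpa)
    ((hf _ _).1 haq) ((hf _ _).1 hpb) ((hf _ _).1 hbq))

theorem Isomorphic.size_eq (h : Isomorphic D H) : size D = size H := by
  obtain ⟨f, hf⟩ := h
  have : {p : W × W | H.Adj p.1 p.2} = Prod.map f f '' {p : V × V | D.Adj p.1 p.2} := by
    ext ⟨a, b⟩
    simp only [Set.mem_ofPred_eq, Set.mem_image, Prod.exists, Prod.map_apply, Prod.mk.injEq]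
    constructor
    · intro hab
      exact ⟨f.symm a, f.symm b, by rw [hf]; simpa using hab, by simp⟩
    · rintro ⟨c, d, hcd, rfl, rfl⟩
      exact (hf c d).1 hcd
  unfold size
  rw [this, Set.ncard_image_of_injective _ (f.injective.prodMap f.injective)]

end Transport

theorem ex_eq_exSize {n : ℕ} (hn : 13 ≤ n) : ex n = exSize n := by
  obtain ⟨⟨D, hD, hsize⟩, hub⟩ := isGreatest_ex n
  obtain ⟨H, hS, hU, hH⟩ := exists_isOptimal hn
  rw [Fintype.card_fin] at hH
  have hle : exSize n ≤ ex n := hub ⟨H, strictP22Free_iff.2 ⟨hS, hU⟩, hH⟩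
  obtain ⟨hS', hU'⟩ := strictP22Free_iff.1 hD
  have := (size_eq_and_inClasses_or_reverse hS' hU' (by simpa using hn)
    (by rw [Fintype.card_fin, hsize]; exact hle)).1
  rw [Fintype.card_fin, hsize] at this
  exact this

/-- The extremal digraphs are, up to isomorphism and reversal, those of the classes belonging to the
residue of `n`. -/
theorem isExtremal_iff_upToReverse {n : ℕ} (hn : 13 ≤ n) {V : Type*} (D : Digraph V) :
    IsExtremal n D ↔ UpToReverse n (InClasses n) D := by
  constructor
  · rintro ⟨hV, hfree, hsize⟩
    have hfin : Finite V := Nat.finite_of_card_ne_zero (by omega)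
    have e : V ≃ Fin n := Finite.equivFinOfCardEq hV
    let H : Digraph (Fin n) := ⟨fun a b => D.Adj (e.symm a) (e.symm b)⟩
    have hDH : Isomorphic D H := ⟨e, fun a b => by simp [H]⟩
    obtain ⟨hS, hU⟩ := strictP22Free_iff.1 hfree
    have := (size_eq_and_inClasses_or_reverse (hDH.symm.strict hS) (hDH.symm.uniqueTwoPaths hU)
      (by simpa using hn)
      (by rw [Fintype.card_fin, hDH.symm.size_eq, hsize, ex_eq_exSize hn])).2
    rw [Fintype.card_fin] at this
    rcases this with h | h
    · exact ⟨H, h, Or.inl hDH⟩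
    · exact ⟨ExtremalP22.reverse H, h, Or.inr hDH.reverse⟩
  · rintro ⟨H, hH, hDH⟩
    obtain ⟨hS, hU, hsize⟩ := hH.isOptimal
    rw [Fintype.card_fin, ← ex_eq_exSize hn] at hsize
    rcases hDH with h | h
    · refine ⟨?_, strictP22Free_iff.2 ⟨h.strict hS, h.uniqueTwoPaths hU⟩, h.size_eq.trans hsize⟩
      obtain ⟨f, -⟩ := h
      rw [Nat.card_congr f, Nat.card_fin]
    · have h' : Isomorphic D (ExtremalP22.reverse H) := h.reverse
      refine ⟨?_, strictP22Free_iff.2 ⟨h'.strict hS.reverse, h'.uniqueTwoPaths hU.reverse⟩,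
        (h'.size_eq.trans size_reverse).trans hsize⟩
      obtain ⟨f, -⟩ := h
      rw [Nat.card_congr f, Nat.card_fin]

theorem upToReverse_or {n : ℕ} {C C' : Digraph (Fin n) → Prop} {V : Type*} {D : Digraph V} :
    UpToReverse n (fun H => C H ∨ C' H) D ↔ UpToReverse n C D ∨ UpToReverse n C' D := by
  constructor
  · rintro ⟨H, h | h, hD⟩
    exacts [Or.inl ⟨H, h, hD⟩, Or.inr ⟨H, h, hD⟩]
  · rintro (⟨H, h, hD⟩ | ⟨H, h, hD⟩)
    exacts [⟨H, Or.inl h, hD⟩, ⟨H, Or.inr h, hD⟩]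

theorem cast_exSize_of_odd {n : ℕ} (h : Odd n) :
    (exSize n : ℚ) = ((n : ℚ) ^ 2 + 4 * n - 1) / 4 := by
  obtain ⟨m, rfl⟩ := h
  have e : exSize (2 * m + 1) = (m + 1) * m + (2 * m + 1) := by
    unfold exSize
    rw [show (2 * m + 1) / 2 = m by omega, show 2 * m + 1 - (m + 1) = m by omega,
      if_neg (by omega), add_zero]
  rw [e]
  push_cast
  ring

theorem cast_exSize_of_even {n : ℕ} (h : Even n) (h' : Even (n / 2)) (hn : 0 < n) :
    (exSize n : ℚ) = ((n : ℚ) ^ 2 + 4 * n) / 4 := by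
  obtain ⟨m, rfl⟩ : ∃ m, n = 4 * m + 4 := ⟨n / 4 - 1, by grind⟩
  have e : exSize (4 * m + 4) = (2 * m + 3) * (2 * m + 1) + (4 * m + 4) + 1 := by
    unfold exSize
    rw [show (4 * m + 4) / 2 + 1 = 2 * m + 3 by omega,
      show 4 * m + 4 - (2 * m + 3) = 2 * m + 1 by omega, if_pos (by omega)]
  rw [e]
  push_cast
  ring

theorem cast_exSize_of_odd_half {n : ℕ} (h : Even n) (h' : Odd (n / 2)) :
    (exSize n : ℚ) = ((n : ℚ) ^ 2 + 4 * n - 4) / 4 := by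
  obtain ⟨m, rfl⟩ : ∃ m, n = 4 * m + 2 := ⟨n / 4, by grind⟩
  have e : exSize (4 * m + 2) = (2 * m + 2) * (2 * m) + (4 * m + 2) := by
    unfold exSize
    rw [show (4 * m + 2) / 2 + 1 = 2 * m + 2 by omega,
      show 4 * m + 2 - (2 * m + 2) = 2 * m by omega, if_neg (by omega), add_zero]
  rw [e]
  push_cast
  ring

theorem inClasses_eq_of_odd {n : ℕ} (h : Odd n) :
    InClasses n = fun D : Digraph (Fin n) => ClassD1 D ∨ ClassD2 D := by
  rw [Nat.odd_iff] at h
  ext D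
  exact ⟨fun H => H.1 h, fun H => ⟨fun _ => H, fun _ => by omega, fun _ => by omega⟩⟩

theorem inClasses_eq_of_even {n : ℕ} (h : Even n) (h' : Even (n / 2)) :
    InClasses n = fun D : Digraph (Fin n) => ClassD3 D := by
  rw [Nat.even_iff] at h h'
  ext D
  exact ⟨fun H => H.2.1 (by omega), fun H => ⟨fun _ => by omega, fun _ => H, fun _ => by omega⟩⟩

theorem inClasses_eq_of_odd_half {n : ℕ} (h : Even n) (h' : Odd (n / 2)) :
    InClasses n = fun D : Digraph (Fin n) => ClassD4 D ∨ ClassD5 D ∨ ClassD6 D ∨ ClassD7 D ∨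
      ClassD8 D ∨ ClassD9 D ∨ ClassD10 D := by
  rw [Nat.even_iff] at h
  rw [Nat.odd_iff] at h'
  ext D
  exact ⟨fun H => H.2.2 (by omega), fun H => ⟨fun _ => by omega, fun _ => by omega, fun _ => H⟩⟩

end ExtremalP22

open ExtremalP22
theorem theorem2p1 (n : ℕ) (hn : 13 ≤ n) :
    (IsGreatest (freeSizes n) (ex n) ∧
      (Odd n → (ex n : ℚ) = ((n : ℚ) ^ 2 + 4 * n - 1) / 4) ∧
      (Even n ∧ Even (n / 2) → (ex n : ℚ) = ((n : ℚ) ^ 2 + 4 * n) / 4) ∧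
      (Even n ∧ Odd (n / 2) → (ex n : ℚ) = ((n : ℚ) ^ 2 + 4 * n - 4) / 4)) ∧
    ∀ (V : Type*) (D : Digraph V),
      IsExtremal n D ↔
        (Odd n ∧ (UpToReverse n ClassD1 D ∨ UpToReverse n ClassD2 D)) ∨
        (Even n ∧ Even (n / 2) ∧ UpToReverse n ClassD3 D) ∨
        (Even n ∧ Odd (n / 2) ∧
          (UpToReverse n ClassD4 D ∨ UpToReverse n ClassD5 D ∨ UpToReverse n ClassD6 D ∨
            UpToReverse n ClassD7 D ∨ UpToReverse n ClassD8 D ∨ UpToReverse n ClassD9 D ∨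
            UpToReverse n ClassD10 D)) := by
  refine ⟨⟨isGreatest_ex n, ?_⟩, fun V D => ?_⟩
  · rw [ex_eq_exSize hn]
    exact ⟨cast_exSize_of_odd, fun h => cast_exSize_of_even h.1 h.2 (by omega),
      fun h => cast_exSize_of_odd_half h.1 h.2⟩
  · rw [isExtremal_iff_upToReverse hn]
    rcases Nat.even_or_odd n with h | h
    · have hno : ¬ Odd n := Nat.not_odd_iff_even.2 h
      rcases Nat.even_or_odd (n / 2) with h' | h'
      · have hno' : ¬ Odd (n / 2) := Nat.not_odd_iff_even.2 h'
        simp only [inClasses_eq_of_even h h', h, h', hno, hno', true_and, false_and, false_or,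
          or_false]
      · have hno' : ¬ Even (n / 2) := Nat.not_even_iff_odd.2 h'
        simp only [inClasses_eq_of_odd_half h h', upToReverse_or, h, h', hno, hno', true_and,
          false_and, and_false, false_or]
    · have hno : ¬ Even n := Nat.not_even_iff_odd.2 h
      simp only [inClasses_eq_of_odd h, upToReverse_or, h, hno, true_and, false_and, or_false]
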